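/- Write $x=(x_1,x_2)\in\mathbb{R}^2$ and, for $r>0$, let $\Omega_r=\{x\in\mathbb{R}^2 : x_2\ge 0,\ |x|>r\}$. Let $0<\lambda\le\Lambda<\infty$. There is a constant $\alpha\in(0,1)$ depending only on $\lambda$ and $\Lambda$ such that for every $\bar C>0$ and every $R>1$ there is a constant $C>0$, depending only on $\lambda,\Lambda,\bar C$ and $R$, with the following property. Let $[a_{ij}(x)]_{i,j=1}^2$ be real coefficients (no regularity in $x$ is required) with $$\lambda|\xi|^2\le\sum_{i,j=1}^2a_{ij}(x)\xi_i\xi_j\le\Lambda|\xi|^2\qquad\text{for all }\xi\in\mathbb{R}^2\text{ and all }x\text{ with }x_2>0,\ |x|>1,$$ and let $u\in C^2(\Omega_1)$ (that is, $C^2$ up to the flat boundary part $\{x_2=0,\ |x_1|>1\}$) satisfy $$\sum_{i,j=1}^2a_{ij}(x)u_{x_ix_j}(x)=0\ \text{ for } x_2>0,\ |x|>1,\qquad u(x)=0\ \text{ for } x_2=0,\ |x_1|>1,$$ and the linear growth condition $|u(x)|\le\bar C(1+|x|)$ for $x_2>0$, $|x|>1$. Then $$|Du(x)-Du(y)|\le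 C|x-y|^{\alpha}\qquad\text{for all }x,y\in\Omega_R,$$ and $Du(x)$ tends, as $|x|\to\infty$ in $\Omega_1$, to a limit $Du(\infty)=(0,u_{x_2}(\infty))$ with $$|Du(x)-Du(\infty)|\le C|x|^{-\alpha}\qquad\text{for all }x\in\Omega_R.$$ -/

import Mathlib

open Filter Topology

/-- The closed upper half-plane minus the closed half-disc of radius `r` centred at the origin:
`{x ∈ ℝ² | x₂ ≥ 0, |x| > r}`. It contains the flat boundary portion `{x₂ = 0, |x₁| > r}`. The
coordinates `x₁, x₂` are `x 0, x 1`. -/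
def closedExtHalfPlane (r : ℝ) : Set (EuclideanSpace ℝ (Fin 2)) :=
  {x | 0 ≤ x 1 ∧ r < ‖x‖}

/-- The open upper half-plane minus the closed half-disc of radius `r` centred at the origin:
`{x ∈ ℝ² | x₂ > 0, |x| > r}`. -/
def openExtHalfPlane (r : ℝ) : Set (EuclideanSpace ℝ (Fin 2)) :=
  {x | 0 < x 1 ∧ r < ‖x‖}

/-- The second order partial derivative `u_{ij}(x)`. -/
noncomputable def secondPartial (u : EuclideanSpace ℝ (Fin 2) → ℝ) (i j : Fin 2)
    (x : EuclideanSpace ℝ (Fin 2)) : ℝ :=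
  fderiv ℝ (fun y => fderiv ℝ u y (EuclideanSpace.single i 1)) x (EuclideanSpace.single j 1)

/-- The gradient `Du` on `{x₂ ≥ 0, |x| > 1}`. In the interior it is the ordinary gradient; on the
flat boundary portion it is the one-sided gradient, taken within the set. -/
noncomputable def extGradient (u : EuclideanSpace ℝ (Fin 2) → ℝ)
    (x : EuclideanSpace ℝ (Fin 2)) : EuclideanSpace ℝ (Fin 2) :=
  gradientWithin u (closedExtHalfPlane 1) x

/-!
The flat boundary is removed by reflection and the equation is replaced by a property of the
gradient map `(p, q) = Dv` alone, where `v` is the odd extension of `u` across the axis.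

In two dimensions a solution of a uniformly elliptic nondivergence equation satisfies
`|D²u|² ≤ (2Λ/λ) (-det D²u)` (`hessian_sq_le_of_elliptic`), whatever the regularity of the
coefficients. Hence `Du` is an orientation-reversing quasiregular map. Since `u` vanishes on the
axis, so does its horizontal derivative, and the odd extension `p` of that derivative together with
the even extension `q` of the vertical one is locally Lipschitz and quasiregular across the axis
(`exteriorGradient_of_halfPlane`). It remains to study locally Lipschitz quasiregular gradient maps
in the exterior of a bounded set.

The Jacobian is a null Lagrangian, so that one derivative may be moved to a cutoff, and a constant
may be subtracted from `p`. This gives the Caccioppoli inequality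
(`QuasiregularOn.caccioppoli`), and with it two kinds of estimate for the energy `∫ |Dp|² + |Dq|²`.

* A further integration by parts bounds the energy by the supremum of the potential
  (`QuasiregularOn.integral_energy_le_of_potential`). By scaling, linear growth of `v` bounds the
  energy of all dyadic annuli by the same constant, so the Caccioppoli inequality between two
  distant annuli bounds the total energy near infinity (`ExteriorGradient.sum_dyadicEnergy_le`).
* The Poincaré inequality on annuli (`poincare_ann`) and hole filling make the energy decay
  geometrically, both on shrinking squares (`QuasiregularOn.energy_halve`) and outside growing
  squares (`ExteriorGradient.tailEnergy_succ_le`). The rate depends on `Λ/λ` only.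

Comparing the constants in the Poincaré inequalities on dyadic squares turns energy decay into
pointwise bounds (`QuasiregularOn.abs_sub_le_of_energy`). On small squares these give the Hölder
estimate, and on large annuli the limit at infinity with a rate (`exists_limit_and_holder`). The
limit of `p` is zero since `p` vanishes on the axis.

The plane is `ℝ × ℝ` with its maximum norm, so that balls are squares and Fubini's theorem applies
to them directly; the Euclidean plane of the statement is compared with it at the end.
-/

section
open MeasureTheory Set Metric
open scoped NNReal

namespace PlanarQuasiregular

/-! ### Lipschitz functions and integration by parts -/

/-- The partial derivative of a function on the plane in the first coordinate. -/
noncomputable def dx (f : ℝ × ℝ → ℝ) (z : ℝ × ℝ) : ℝ := fderiv ℝ f z (1, 0)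

/-- The partial derivative of a function on the plane in the second coordinate. -/
noncomputable def dy (f : ℝ × ℝ → ℝ) (z : ℝ × ℝ) : ℝ := fderiv ℝ f z (0, 1)

lemma measurable_dx (f : ℝ × ℝ → ℝ) : Measurable (dx f) := measurable_fderiv_apply_const ℝ f _

lemma measurable_dy (f : ℝ × ℝ → ℝ) : Measurable (dy f) := measurable_fderiv_apply_const ℝ f _

lemma abs_dx_le (f : ℝ × ℝ → ℝ) (z : ℝ × ℝ) : |dx f z| ≤ ‖fderiv ℝ f z‖ := by
  have := (fderiv ℝ f z).le_opNorm (1, 0)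
  simpa [dx, Prod.norm_def] using this

lemma abs_dy_le (f : ℝ × ℝ → ℝ) (z : ℝ × ℝ) : |dy f z| ≤ ‖fderiv ℝ f z‖ := by
  have := (fderiv ℝ f z).le_opNorm (0, 1)
  simpa [dy, Prod.norm_def] using this

lemma dx_congr {f g : ℝ × ℝ → ℝ} {z : ℝ × ℝ} (h : f =ᶠ[𝓝 z] g) : dx f z = dx g z := by
  simp [dx, h.fderiv_eq]

lemma dy_congr {f g : ℝ × ℝ → ℝ} {z : ℝ × ℝ} (h : f =ᶠ[𝓝 z] g) : dy f z = dy g z := by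
  simp [dy, h.fderiv_eq]

lemma dx_eq_zero_of_notMem_tsupport {f : ℝ × ℝ → ℝ} {z : ℝ × ℝ} (h : z ∉ tsupport f) :
    dx f z = 0 := by
  rw [dx_congr (notMem_tsupport_iff_eventuallyEq.1 h)]; simp [dx]

lemma dy_eq_zero_of_notMem_tsupport {f : ℝ × ℝ → ℝ} {z : ℝ × ℝ} (h : z ∉ tsupport f) :
    dy f z = 0 := by
  rw [dy_congr (notMem_tsupport_iff_eventuallyEq.1 h)]; simp [dy]

/-- A measurable function that vanishes off a compact set and is bounded on it is integrable. -/
lemma integrable_of_bounded_of_compact {F : ℝ × ℝ → ℝ} {K : Set (ℝ × ℝ)} (hK : IsCompact K)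
    (hF : Measurable F) {C : ℝ} (hb : ∀ z ∈ K, |F z| ≤ C) (h0 : ∀ z, z ∉ K → F z = 0) :
    Integrable F := by
  have h1 : IntegrableOn F K := by
    refine Measure.integrableOn_of_bounded (M := C) hK.measure_lt_top.ne hF.aestronglyMeasurable ?_
    exact (ae_restrict_iff' hK.measurableSet).2 (Eventually.of_forall fun z hz => by
      simpa using hb z hz)
  rwa [integrableOn_iff_integrable_of_support_subset] at h1
  intro z hz
  by_contra h
  exact hz (h0 z h)

lemma exists_lipschitzWith_mul {η f : ℝ × ℝ → ℝ} {A B : ℝ≥0} (hη : LipschitzWith A η)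
    (hc : HasCompactSupport η) (hf : LipschitzWith B f) :
    ∃ C, LipschitzWith C (fun z => η z * f z) := by
  obtain ⟨M, hM⟩ := hc.exists_bound_of_continuous hη.continuous
  obtain ⟨N, hN⟩ := IsCompact.exists_bound_of_continuousOn hc hf.continuous.continuousOn
  have hM0 : 0 ≤ M := (norm_nonneg _).trans (hM 0)
  refine ⟨Real.toNNReal (M * B + |N| * A), LipschitzWith.of_dist_le_mul fun x y => ?_⟩
  rw [Real.coe_toNNReal _ (by positivity), Real.dist_eq]
  have h1 := hη.dist_le_mul x y
  have h2 := hf.dist_le_mul x y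
  rw [Real.dist_eq] at h1 h2
  have hd : 0 ≤ dist x y := dist_nonneg
  have key : ∀ z ∈ tsupport η, |f z| ≤ |N| := fun z hz => (hN z hz).trans (le_abs_self N)
  have hMB : 0 ≤ M * (B * dist x y) := by positivity
  by_cases hy : y ∈ tsupport η
  · have e : η x * f x - η y * f y = η x * (f x - f y) + f y * (η x - η y) := by ring
    rw [e]
    calc _ ≤ |η x| * |f x - f y| + |f y| * |η x - η y| := by
          rw [← abs_mul, ← abs_mul]; exact abs_add_le _ _
      _ ≤ M * (B * dist x y) + |N| * (A * dist x y) := by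
          have := hM x
          rw [Real.norm_eq_abs] at this
          exact add_le_add (mul_le_mul this h2 (abs_nonneg _) hM0)
            (mul_le_mul (key y hy) h1 (abs_nonneg _) (abs_nonneg _))
      _ = _ := by ring
  · have hy0 : η y = 0 := image_eq_zero_of_notMem_tsupport hy
    by_cases hx : x ∈ tsupport η
    · have e : η x * f x - η y * f y = f x * (η x - η y) := by rw [hy0]; ring
      rw [e, abs_mul]
      calc _ ≤ |N| * (A * dist x y) := mul_le_mul (key x hx) h1 (abs_nonneg _) (abs_nonneg _)
        _ ≤ _ := by nlinarith
    · rw [hy0, image_eq_zero_of_notMem_tsupport hx]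
      simp only [zero_mul, sub_zero, abs_zero]
      positivity

/-- The Lipschitz cutoff that is `1` on the square `‖z - x₀‖ ≤ r`, is `0` where `s ≤ ‖z - x₀‖`, and
is linear in `‖z - x₀‖` in between. The norm of `ℝ × ℝ` is the maximum norm. -/
noncomputable def cutoff (x₀ : ℝ × ℝ) (r s : ℝ) (z : ℝ × ℝ) : ℝ :=
  max 0 (min 1 ((s - ‖z - x₀‖) / (s - r)))

lemma cutoff_nonneg (x₀ : ℝ × ℝ) (r s : ℝ) (z : ℝ × ℝ) : 0 ≤ cutoff x₀ r s z := le_max_left _ _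

lemma cutoff_le_one (x₀ : ℝ × ℝ) (r s : ℝ) (z : ℝ × ℝ) : cutoff x₀ r s z ≤ 1 :=
  max_le zero_le_one (min_le_left _ _)

lemma cutoff_eq_one {x₀ : ℝ × ℝ} {r s : ℝ} (hrs : r < s) {z : ℝ × ℝ} (hz : ‖z - x₀‖ ≤ r) :
    cutoff x₀ r s z = 1 := by
  have : 1 ≤ (s - ‖z - x₀‖) / (s - r) := by
    rw [le_div_iff₀ (by linarith)]; linarith
  simp [cutoff, min_eq_left this]

lemma cutoff_eq_zero {x₀ : ℝ × ℝ} {r s : ℝ} (hrs : r < s) {z : ℝ × ℝ} (hz : s ≤ ‖z - x₀‖) :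
    cutoff x₀ r s z = 0 := by
  have : (s - ‖z - x₀‖) / (s - r) ≤ 0 :=
    div_nonpos_of_nonpos_of_nonneg (by linarith) (by linarith)
  simp [cutoff, this]

lemma lipschitzWith_cutoff (x₀ : ℝ × ℝ) {r s : ℝ} (hrs : r < s) :
    LipschitzWith (Real.toNNReal (s - r)⁻¹) (cutoff x₀ r s) := by
  have h : LipschitzWith (Real.toNNReal (s - r)⁻¹) (fun z => (s - ‖z - x₀‖) / (s - r)) := by
    refine LipschitzWith.of_dist_le_mul fun x y => ?_
    have hp : 0 < s - r := by linarith
    rw [Real.coe_toNNReal _ (by positivity), Real.dist_eq, ← sub_div, abs_div, abs_of_pos hp,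
      div_eq_inv_mul, dist_eq_norm]
    gcongr
    have := abs_norm_sub_norm_le (y - x₀) (x - x₀)
    have e : y - x₀ - (x - x₀) = -(x - y) := by abel
    rw [e, norm_neg] at this
    rwa [show s - ‖x - x₀‖ - (s - ‖y - x₀‖) = ‖y - x₀‖ - ‖x - x₀‖ by ring]
  exact (h.const_min 1).const_max 0

lemma hasCompactSupport_cutoff (x₀ : ℝ × ℝ) {r s : ℝ} (hrs : r < s) :
    HasCompactSupport (cutoff x₀ r s) :=
  HasCompactSupport.intro (isCompact_closedBall x₀ s) fun z hz =>
    cutoff_eq_zero hrs (by simpa [dist_eq_norm] using (not_le.1 hz).le)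

/-- Near a compact subset of an open set, a locally Lipschitz function agrees with a compactly
supported, globally Lipschitz function. -/
lemma exists_lipschitzWith_eventuallyEq {U K : Set (ℝ × ℝ)} (hU : IsOpen U) (hK : IsCompact K)
    (hKU : K ⊆ U) {f : ℝ × ℝ → ℝ} (hf : LocallyLipschitzOn U f) :
    ∃ F C, LipschitzWith C F ∧ HasCompactSupport F ∧ ∀ z ∈ K, f =ᶠ[𝓝 z] F := by
  obtain ⟨K', hK', hKK', hK'U⟩ := exists_compact_between hK hU hKU
  obtain ⟨C, hC⟩ := LocallyLipschitzOn.exists_lipschitzOnWith_of_compact hK' (hf.mono hK'U)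
  obtain ⟨F, hF, hfF⟩ := hC.extend_real
  obtain ⟨N, hN⟩ := hK'.isBounded.subset_closedBall 0
  have hlt : N < N + 1 := by linarith
  obtain ⟨B, hB⟩ := exists_lipschitzWith_mul (lipschitzWith_cutoff 0 hlt)
    (hasCompactSupport_cutoff 0 hlt) hF
  refine ⟨_, B, hB, (hasCompactSupport_cutoff 0 hlt).mul_right, fun z hz => ?_⟩
  filter_upwards [mem_interior_iff_mem_nhds.1 (hKK' hz)] with w hw
  rw [cutoff_eq_one hlt (by simpa using hN hw), one_mul, hfF hw]

lemma integrable_fderiv_apply {f : ℝ × ℝ → ℝ} {C : ℝ≥0} (hf : LipschitzWith C f)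
    (hc : HasCompactSupport f) (v : ℝ × ℝ) : Integrable (fun z => fderiv ℝ f z v) := by
  refine integrable_of_bounded_of_compact hc (measurable_fderiv_apply_const ℝ f v)
    (C := C * ‖v‖) (fun z _ => ?_) fun z hz => ?_
  · have := (fderiv ℝ f z).le_opNorm v
    rw [Real.norm_eq_abs] at this
    exact this.trans (by gcongr; exact norm_fderiv_le_of_lipschitz ℝ hf)
  · rw [(notMem_tsupport_iff_eventuallyEq.1 hz).fderiv_eq]; simp

lemma lineDeriv_ae_eq {f : ℝ × ℝ → ℝ} {C : ℝ≥0} (hf : LipschitzWith C f)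
    (v : ℝ × ℝ) : (fun z => lineDeriv ℝ f z v) =ᵐ[volume] fun z => fderiv ℝ f z v := by
  filter_upwards [hf.ae_differentiableAt] with z hz
  exact hz.lineDeriv_eq_fderiv

lemma integral_fderiv_mul_eq_neg {f g : ℝ × ℝ → ℝ} {A B : ℝ≥0} (hf : LipschitzWith A f)
    (hg : LipschitzWith B g) (hgc : HasCompactSupport g) (v : ℝ × ℝ) :
    ∫ z, fderiv ℝ f z v * g z = -∫ z, fderiv ℝ g z v * f z := by
  have h := LipschitzWith.integral_lineDeriv_mul_eq (μ := volume) hf hg hgc v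
  rw [integral_congr_ae (f := fun z => lineDeriv ℝ f z v * g z)
      (g := fun z => fderiv ℝ f z v * g z)
      ((lineDeriv_ae_eq hf v).mul (ae_eq_refl g)),
    integral_congr_ae (f := fun z => lineDeriv ℝ g z (-v) * f z)
      (g := fun z => fderiv ℝ g z (-v) * f z)
      ((lineDeriv_ae_eq hg (-v)).mul (ae_eq_refl f))] at h
  simpa [integral_neg] using h

lemma lipschitzWith_shift {f : ℝ × ℝ → ℝ} {C : ℝ≥0} (hf : LipschitzWith C f) (v : ℝ × ℝ) :
    LipschitzWith C (fun z => f (z + v)) :=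
  LipschitzWith.of_dist_le_mul fun x y => by simpa using hf.dist_le_mul (x + v) (y + v)

/-- The weak form of the symmetry of second derivatives: in the duality between `g` and `q` the two
derivatives may be exchanged, although neither function has second derivatives. -/
lemma integral_fderiv_mul_fderiv_comm {g q : ℝ × ℝ → ℝ} {A B : ℝ≥0} (hg : LipschitzWith A g)
    (hgc : HasCompactSupport g) (hq : LipschitzWith B q) (hqc : HasCompactSupport q)
    (v w : ℝ × ℝ) :
    ∫ z, fderiv ℝ g z v * fderiv ℝ q z w = ∫ z, fderiv ℝ g z w * fderiv ℝ q z v := by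
  have Ig : Integrable (fun z => lineDeriv ℝ g z (-w)) :=
    (integrable_congr (lineDeriv_ae_eq hg (-w))).2 (integrable_fderiv_apply hg hgc (-w))
  have Iq : Integrable (fun z => lineDeriv ℝ q z w) :=
    (integrable_congr (lineDeriv_ae_eq hq w)).2 (integrable_fderiv_apply hq hqc w)
  have h1 := LipschitzWith.integral_inv_smul_sub_mul_tendsto_integral_lineDeriv_mul
    (μ := volume) hg Iq v
  have h2 := LipschitzWith.integral_inv_smul_sub_mul_tendsto_integral_lineDeriv_mul
    (μ := volume) hq Ig (-v)
  -- integration by parts in the difference quotient moves the shift from `g` to `q`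
  have key : ∀ t : ℝ, ∫ x, (t⁻¹ • (g (x + t • v) - g x)) * lineDeriv ℝ q x w
      = ∫ x, (t⁻¹ • (q (x + t • (-v)) - q x)) * lineDeriv ℝ g x (-w) := by
    intro t
    have e1 : ∫ x, lineDeriv ℝ q x w * g x = ∫ x, lineDeriv ℝ g x (-w) * q x :=
      LipschitzWith.integral_lineDeriv_mul_eq hq hg hgc w
    have hg' : LipschitzWith A (fun x => g (x + t • v)) :=
      lipschitzWith_shift hg _
    have hgc' : HasCompactSupport (fun x => g (x + t • v)) :=
      hgc.comp_homeomorph (Homeomorph.addRight (t • v))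
    have e2 : ∫ x, lineDeriv ℝ q x w * g (x + t • v)
        = ∫ x, lineDeriv ℝ (fun x => g (x + t • v)) x (-w) * q x :=
      LipschitzWith.integral_lineDeriv_mul_eq hq hg' hgc' w
    have e3 : ∫ x, lineDeriv ℝ (fun x => g (x + t • v)) x (-w) * q x
        = ∫ x, lineDeriv ℝ g x (-w) * q (x + t • (-v)) := by
      rw [← integral_add_right_eq_self
        (fun x => lineDeriv ℝ g x (-w) * q (x + t • (-v))) (t • v)]
      refine integral_congr_ae (Eventually.of_forall fun x => ?_)
      simp only [smul_neg, add_neg_cancel_right]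
      congr 1
      simp only [lineDeriv]
      congr 1
      funext s
      congr 1
      abel
    have i1 : Integrable (fun x => lineDeriv ℝ q x w * g (x + t • v)) := by
      obtain ⟨M, hM⟩ := hgc'.exists_bound_of_continuous hg'.continuous
      exact Iq.mul_bdd hg'.continuous.aestronglyMeasurable (Eventually.of_forall hM)
    have i2 : Integrable (fun x => lineDeriv ℝ q x w * g x) := by
      obtain ⟨M, hM⟩ := hgc.exists_bound_of_continuous hg.continuous
      exact Iq.mul_bdd hg.continuous.aestronglyMeasurable (Eventually.of_forall hM)
    have hq' : LipschitzWith B (fun x => q (x + t • (-v))) :=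
      lipschitzWith_shift hq _
    have hqc' : HasCompactSupport (fun x => q (x + t • (-v))) :=
      hqc.comp_homeomorph (Homeomorph.addRight (t • (-v)))
    have i3 : Integrable (fun x => lineDeriv ℝ g x (-w) * q (x + t • (-v))) := by
      obtain ⟨M, hM⟩ := hqc'.exists_bound_of_continuous hq'.continuous
      exact Ig.mul_bdd hq'.continuous.aestronglyMeasurable (Eventually.of_forall hM)
    have i4 : Integrable (fun x => lineDeriv ℝ g x (-w) * q x) := by
      obtain ⟨M, hM⟩ := hqc.exists_bound_of_continuous hq.continuous
      exact Ig.mul_bdd hq.continuous.aestronglyMeasurable (Eventually.of_forall hM)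
    calc _ = ∫ x, t⁻¹ * (lineDeriv ℝ q x w * g (x + t • v) - lineDeriv ℝ q x w * g x) := by
          congr 1; funext x; simp only [smul_eq_mul]; ring
      _ = ∫ x, t⁻¹ * (lineDeriv ℝ g x (-w) * q (x + t • (-v)) - lineDeriv ℝ g x (-w) * q x) := by
          rw [integral_const_mul, integral_const_mul, integral_sub i1 i2, integral_sub i3 i4, e1,
            e2, e3]
      _ = _ := by congr 1; funext x; simp only [smul_eq_mul]; ring
  simp only [key] at h1
  have h3 := tendsto_nhds_unique h1 h2
  rw [integral_congr_ae (f := fun z => lineDeriv ℝ g z v * lineDeriv ℝ q z w)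
      (g := fun z => fderiv ℝ g z v * fderiv ℝ q z w)
      ((lineDeriv_ae_eq hg v).mul (lineDeriv_ae_eq hq w)),
    integral_congr_ae (f := fun z => lineDeriv ℝ q z (-v) * lineDeriv ℝ g z (-w))
      (g := fun z => fderiv ℝ q z (-v) * fderiv ℝ g z (-w))
      ((lineDeriv_ae_eq hq (-v)).mul (lineDeriv_ae_eq hg (-w)))] at h3
  rw [h3]
  congr 1
  funext z
  simp only [map_neg]
  ring

/-! ### Null Lagrangians and the Caccioppoli inequality -/

/-- Measurable and bounded on every compact subset of `U`. All integrands below have this property,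
which gives their integrability. -/
def LocBdd (U : Set (ℝ × ℝ)) (f : ℝ × ℝ → ℝ) : Prop :=
  ∀ K ⊆ U, IsCompact K → AEStronglyMeasurable f (volume.restrict K) ∧ ∃ M, ∀ z ∈ K, |f z| ≤ M

namespace LocBdd

variable {U : Set (ℝ × ℝ)} {f g : ℝ × ℝ → ℝ}

lemma add (hf : LocBdd U f) (hg : LocBdd U g) : LocBdd U (fun z => f z + g z) := by
  intro K hKU hK
  obtain ⟨h1, M, hM⟩ := hf K hKU hK
  obtain ⟨h2, N, hN⟩ := hg K hKU hK
  exact ⟨h1.add h2, M + N, fun z hz => (abs_add_le _ _).trans (add_le_add (hM z hz) (hN z hz))⟩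

lemma mul (hf : LocBdd U f) (hg : LocBdd U g) : LocBdd U (fun z => f z * g z) := by
  intro K hKU hK
  obtain ⟨h1, M, hM⟩ := hf K hKU hK
  obtain ⟨h2, N, hN⟩ := hg K hKU hK
  refine ⟨h1.mul h2, M * N, fun z hz => ?_⟩
  rw [abs_mul]
  exact mul_le_mul (hM z hz) (hN z hz) (abs_nonneg _) ((abs_nonneg _).trans (hM z hz))

lemma const (c : ℝ) : LocBdd U (fun _ => c) :=
  fun _ _ _ => ⟨aestronglyMeasurable_const, |c|, fun _ _ => le_rfl⟩

lemma neg (hf : LocBdd U f) : LocBdd U (fun z => -f z) := by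
  simpa using (const (-1)).mul hf

lemma sub (hf : LocBdd U f) (hg : LocBdd U g) : LocBdd U (fun z => f z - g z) := by
  simpa [sub_eq_add_neg] using hf.add hg.neg

lemma sq (hf : LocBdd U f) : LocBdd U (fun z => f z ^ 2) := by
  simpa [_root_.sq] using hf.mul hf

lemma integrableOn (hf : LocBdd U f) {K : Set (ℝ × ℝ)} (hK : IsCompact K) (hKU : K ⊆ U) :
    IntegrableOn f K := by
  obtain ⟨h1, M, hM⟩ := hf K hKU hK
  have : IsFiniteMeasure (volume.restrict K) := isFiniteMeasure_restrict.2 hK.measure_lt_top.ne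
  exact Integrable.of_bound h1 M
    ((ae_restrict_iff' hK.measurableSet).2 (Eventually.of_forall fun z hz => by
      simpa using hM z hz))

lemma integrable (hf : LocBdd U f) {K : Set (ℝ × ℝ)} (hK : IsCompact K) (hKU : K ⊆ U)
    (h0 : ∀ z, z ∉ K → f z = 0) : Integrable f := by
  have h1 := hf.integrableOn hK hKU
  rwa [integrableOn_iff_integrable_of_support_subset] at h1
  intro z hz
  by_contra h
  exact hz (h0 z h)

end LocBdd

section LocallyLipschitz

variable {U : Set (ℝ × ℝ)} {f : ℝ × ℝ → ℝ}

lemma locBdd_of_continuousOn (hf : ContinuousOn f U) : LocBdd U f := fun K hKU hK =>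
  ⟨(hf.mono hKU).aestronglyMeasurable hK.measurableSet, by
    simpa using hK.exists_bound_of_continuousOn (hf.mono hKU)⟩

lemma locBdd_of_locallyLipschitzOn (hf : LocallyLipschitzOn U f) : LocBdd U f :=
  locBdd_of_continuousOn hf.continuousOn

lemma exists_norm_fderiv_le (hU : IsOpen U) (hf : LocallyLipschitzOn U f) {K : Set (ℝ × ℝ)}
    (hK : IsCompact K) (hKU : K ⊆ U) : ∃ M, ∀ z ∈ K, ‖fderiv ℝ f z‖ ≤ M := by
  obtain ⟨F, C, hF, -, hfF⟩ := exists_lipschitzWith_eventuallyEq hU hK hKU hf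
  exact ⟨C, fun z hz => by rw [(hfF z hz).fderiv_eq]; exact norm_fderiv_le_of_lipschitz ℝ hF⟩

lemma locBdd_dx (hU : IsOpen U) (hf : LocallyLipschitzOn U f) : LocBdd U (dx f) :=
  fun K hKU hK => ⟨(measurable_dx f).aestronglyMeasurable, by
    obtain ⟨M, hM⟩ := exists_norm_fderiv_le hU hf hK hKU
    exact ⟨M, fun z hz => (abs_dx_le f z).trans (hM z hz)⟩⟩

lemma locBdd_dy (hU : IsOpen U) (hf : LocallyLipschitzOn U f) : LocBdd U (dy f) :=
  fun K hKU hK => ⟨(measurable_dy f).aestronglyMeasurable, by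
    obtain ⟨M, hM⟩ := exists_norm_fderiv_le hU hf hK hKU
    exact ⟨M, fun z hz => (abs_dy_le f z).trans (hM z hz)⟩⟩

lemma locallyLipschitzOn_of_lipschitzWith {C : ℝ≥0} (hf : LipschitzWith C f) :
    LocallyLipschitzOn U f := hf.locallyLipschitz.locallyLipschitzOn

end LocallyLipschitz

lemma setIntegral_le_integral_mul {U S : Set (ℝ × ℝ)} {φ w : ℝ × ℝ → ℝ} {C : ℝ≥0}
    (hφ : LocBdd U φ) (hφ0 : ∀ z, 0 ≤ φ z) (hw : LipschitzWith C w) (hwc : HasCompactSupport w)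
    (hwU : tsupport w ⊆ U) (hw0 : ∀ z, 0 ≤ w z) (hS : IsCompact S) (hSU : S ⊆ U)
    (hw1 : ∀ z ∈ S, w z = 1) : ∫ z in S, φ z ≤ ∫ z, w z * φ z := by
  rw [← integral_indicator hS.measurableSet]
  refine integral_mono ((integrable_indicator_iff hS.measurableSet).2 (hφ.integrableOn hS hSU))
    ?_ fun z => ?_
  · exact ((locBdd_of_locallyLipschitzOn (locallyLipschitzOn_of_lipschitzWith hw)).mul
      hφ).integrable hwc hwU (fun z hz => by rw [image_eq_zero_of_notMem_tsupport hz, zero_mul])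
  · by_cases hz : z ∈ S
    · simp only [indicator_of_mem hz]
      rw [hw1 z hz, one_mul]
    · simp only [indicator_of_notMem hz]
      exact mul_nonneg (hw0 z) (hφ0 z)

lemma fderiv_mul_apply {f g : ℝ × ℝ → ℝ} {z : ℝ × ℝ} (hf : DifferentiableAt ℝ f z)
    (hg : DifferentiableAt ℝ g z) (w : ℝ × ℝ) :
    fderiv ℝ (fun z => f z * g z) z w = f z * fderiv ℝ g z w + g z * fderiv ℝ f z w := by
  rw [fderiv_fun_mul hf hg]
  simp

/-- The Jacobian of `(p, q)` against a test function: since the Jacobian is a null Lagrangian, one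
derivative can be moved to the test function, and a constant subtracted from `p`. -/
lemma integral_mul_jacobian {U : Set (ℝ × ℝ)} (hU : IsOpen U) {p q η : ℝ × ℝ → ℝ}
    (hp : LocallyLipschitzOn U p) (hq : LocallyLipschitzOn U q) {C : ℝ≥0}
    (hη : LipschitzWith C η) (hηc : HasCompactSupport η) (hηU : tsupport η ⊆ U) (c : ℝ) :
    ∫ z, η z * (dy p z * dx q z - dx p z * dy q z)
      = ∫ z, (p z - c) * (dx η z * dy q z - dy η z * dx q z) := by
  obtain ⟨P, A, hP, hPc, hpP⟩ := exists_lipschitzWith_eventuallyEq hU hηc hηU hp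
  obtain ⟨Q, B, hQ, hQc, hqQ⟩ := exists_lipschitzWith_eventuallyEq hU hηc hηU hq
  have hPs : LipschitzWith A (fun z => P z - c) := by
    simpa using hP.sub (LipschitzWith.const c)
  obtain ⟨G, hG⟩ := exists_lipschitzWith_mul hη hηc hPs
  have hGc : HasCompactSupport (fun z => η z * (P z - c)) := hηc.mul_right
  have comm := integral_fderiv_mul_fderiv_comm hG hGc hQ hQc (1, 0) (0, 1)
  have bdQ : ∀ v z, ‖fderiv ℝ Q z v‖ ≤ B * ‖v‖ := fun v z =>
    ((fderiv ℝ Q z).le_opNorm v).trans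
      (by gcongr; exact norm_fderiv_le_of_lipschitz ℝ hQ)
  have I1 : ∀ v w, Integrable (fun z =>
      fderiv ℝ (fun z => η z * (P z - c)) z v * fderiv ℝ Q z w) := fun v w =>
    (integrable_fderiv_apply hG hGc v).mul_bdd
      (measurable_fderiv_apply_const ℝ Q w).aestronglyMeasurable
      (Eventually.of_forall (bdQ w))
  have hpl := locBdd_of_locallyLipschitzOn hp
  have J1 : Integrable (fun z => η z * (dy p z * dx q z - dx p z * dy q z)) :=
    ((locBdd_of_locallyLipschitzOn (locallyLipschitzOn_of_lipschitzWith hη)).mul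
      (((locBdd_dy hU hp).mul (locBdd_dx hU hq)).sub
      ((locBdd_dx hU hp).mul (locBdd_dy hU hq)))).integrable hηc hηU
      (fun z hz => by rw [image_eq_zero_of_notMem_tsupport hz, zero_mul])
  have hηl := locallyLipschitzOn_of_lipschitzWith (U := U) hη
  have J2 : Integrable (fun z => (p z - c) * (dx η z * dy q z - dy η z * dx q z)) :=
    ((hpl.sub (LocBdd.const c)).mul
      (((locBdd_dx hU hηl).mul (locBdd_dy hU hq)).sub
      ((locBdd_dy hU hηl).mul (locBdd_dx hU hq)))).integrable hηc hηU
      (fun z hz => by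
        rw [dx_eq_zero_of_notMem_tsupport hz, dy_eq_zero_of_notMem_tsupport hz]; ring)
  rw [← sub_eq_zero, ← integral_sub (I1 _ _) (I1 _ _)] at comm
  rw [← sub_eq_zero, ← integral_sub J1 J2, ← neg_eq_zero, ← integral_neg, ← comm]
  refine integral_congr_ae ?_
  filter_upwards [hη.ae_differentiableAt, hPs.ae_differentiableAt] with z h1 h2
  rw [fderiv_mul_apply h1 h2, fderiv_mul_apply h1 h2]
  simp only [fderiv_sub_const]
  by_cases hz : z ∈ tsupport η
  · simp only [dx, dy]
    rw [(hpP z hz).fderiv_eq, (hqQ z hz).fderiv_eq, (hpP z hz).eq_of_nhds]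
    ring
  · rw [image_eq_zero_of_notMem_tsupport hz, dx_eq_zero_of_notMem_tsupport hz,
      dy_eq_zero_of_notMem_tsupport hz]
    have e1 : fderiv ℝ η z (1, 0) = 0 := dx_eq_zero_of_notMem_tsupport hz
    have e2 : fderiv ℝ η z (0, 1) = 0 := dy_eq_zero_of_notMem_tsupport hz
    rw [e1, e2]
    ring

/-- Integration by parts against a compactly supported Lipschitz `ζ`. -/
lemma integral_mul_mul_fderiv {U : Set (ℝ × ℝ)} (hU : IsOpen U) {p v ζ : ℝ × ℝ → ℝ}
    (hp : LocallyLipschitzOn U p) (hv : LocallyLipschitzOn U v) {C : ℝ≥0}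
    (hζ : LipschitzWith C ζ) (hζc : HasCompactSupport ζ) (hζU : tsupport ζ ⊆ U) (w : ℝ × ℝ) :
    ∫ z, ζ z * p z * fderiv ℝ v z w
      = -∫ z, v z * (fderiv ℝ ζ z w * p z + ζ z * fderiv ℝ p z w) := by
  obtain ⟨P, A, hP, hPc, hpP⟩ := exists_lipschitzWith_eventuallyEq hU hζc hζU hp
  obtain ⟨V, B, hV, hVc, hvV⟩ := exists_lipschitzWith_eventuallyEq hU hζc hζU hv
  obtain ⟨G, hG⟩ := exists_lipschitzWith_mul hζ hζc hP
  have hGc : HasCompactSupport (fun z => ζ z * P z) := hζc.mul_right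
  have h := integral_fderiv_mul_eq_neg hV hG hGc w
  have e1 : ∫ z, fderiv ℝ V z w * (ζ z * P z) = ∫ z, ζ z * p z * fderiv ℝ v z w := by
    congr 1
    funext z
    by_cases hz : z ∈ tsupport ζ
    · rw [(hvV z hz).fderiv_eq, (hpP z hz).eq_of_nhds]; ring
    · rw [image_eq_zero_of_notMem_tsupport hz]; ring
  have e2 : ∫ z, fderiv ℝ (fun z => ζ z * P z) z w * V z
      = ∫ z, v z * (fderiv ℝ ζ z w * p z + ζ z * fderiv ℝ p z w) := by
    refine integral_congr_ae ?_
    filter_upwards [hζ.ae_differentiableAt, hP.ae_differentiableAt] with z h1 h2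
    rw [fderiv_mul_apply h1 h2]
    by_cases hz : z ∈ tsupport ζ
    · rw [(hvV z hz).eq_of_nhds, (hpP z hz).eq_of_nhds, (hpP z hz).fderiv_eq]; ring
    · rw [image_eq_zero_of_notMem_tsupport hz,
        (notMem_tsupport_iff_eventuallyEq.1 hz).fderiv_eq]
      simp
  rw [← e1, ← e2, h]

/-- The energy density `|Dp|² + |Dq|²` of the planar map `(p, q)`. -/
noncomputable def energy (p q : ℝ × ℝ → ℝ) (z : ℝ × ℝ) : ℝ :=
  dx p z ^ 2 + dy p z ^ 2 + dx q z ^ 2 + dy q z ^ 2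

lemma energy_nonneg (p q : ℝ × ℝ → ℝ) (z : ℝ × ℝ) : 0 ≤ energy p q z := by
  unfold energy; positivity

/-- `(p, q)` is an orientation-reversing quasiregular map on the open set `U`: it is locally
Lipschitz and its energy density is at most `K` times minus its Jacobian, almost everywhere. -/
structure QuasiregularOn (U : Set (ℝ × ℝ)) (K : ℝ) (p q : ℝ × ℝ → ℝ) : Prop where
  isOpen : IsOpen U
  pos : 0 < K
  lip_fst : LocallyLipschitzOn U p
  lip_snd : LocallyLipschitzOn U q
  energy_le : ∀ᵐ z, z ∈ U → energy p q z ≤ K * (dy p z * dx q z - dx p z * dy q z)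

namespace QuasiregularOn

variable {U : Set (ℝ × ℝ)} {K : ℝ} {p q : ℝ × ℝ → ℝ}

lemma locBdd_energy (h : QuasiregularOn U K p q) : LocBdd U (energy p q) :=
  ((((locBdd_dx h.isOpen h.lip_fst).sq.add (locBdd_dy h.isOpen h.lip_fst).sq).add
    (locBdd_dx h.isOpen h.lip_snd).sq).add (locBdd_dy h.isOpen h.lip_snd).sq)

/-- The Caccioppoli inequality before the derivatives of the cutoff are estimated. -/
lemma integral_mul_energy_le (h : QuasiregularOn U K p q) {η : ℝ × ℝ → ℝ} {C : ℝ≥0}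
    (hη : LipschitzWith C η) (hηc : HasCompactSupport η) (hηU : tsupport η ⊆ U)
    (hη0 : ∀ z, 0 ≤ η z) (c : ℝ) :
    ∫ z, η z * energy p q z
      ≤ K * ∫ z, (p z - c) * (dx η z * dy q z - dy η z * dx q z) := by
  have hU := h.isOpen
  have hp := h.lip_fst
  have hq := h.lip_snd
  rw [← integral_mul_jacobian hU hp hq hη hηc hηU c, ← integral_const_mul]
  have hl := locBdd_of_locallyLipschitzOn (locallyLipschitzOn_of_lipschitzWith (U := U) hη)
  refine integral_mono_ae ?_ ?_ ?_
  · exact (hl.mul h.locBdd_energy).integrable hηc hηU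
      (fun z hz => by rw [image_eq_zero_of_notMem_tsupport hz, zero_mul])
  · exact (((hl.mul
      (((locBdd_dy hU hp).mul (locBdd_dx hU hq)).sub
      ((locBdd_dx hU hp).mul (locBdd_dy hU hq)))).integrable hηc hηU
      (fun z hz => by rw [image_eq_zero_of_notMem_tsupport hz, zero_mul]))).const_mul K
  · filter_upwards [h.energy_le] with z hz
    by_cases hzη : z ∈ tsupport η
    · have := mul_le_mul_of_nonneg_left (hz (hηU hzη)) (hη0 z)
      linarith
    · simp [image_eq_zero_of_notMem_tsupport hzη]

/-- The Caccioppoli inequality for a cutoff whose gradient lives on two compact sets, with a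
separate bound and a separate weight on each. -/
lemma caccioppoli (h : QuasiregularOn U K p q) {η : ℝ × ℝ → ℝ} {C : ℝ≥0}
    (hη : LipschitzWith C η) (hηc : HasCompactSupport η) (hηU : tsupport η ⊆ U)
    (hη0 : ∀ z, 0 ≤ η z) (c : ℝ) {A₁ A₂ : Set (ℝ × ℝ)} (hA₁ : IsCompact A₁) (hA₂ : IsCompact A₂)
    (hA₁U : A₁ ⊆ U) (hA₂U : A₂ ⊆ U) {M₁ M₂ τ₁ τ₂ : ℝ} (hτ₁ : 0 < τ₁) (hτ₂ : 0 < τ₂)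
    (h₁ : ∀ z ∈ A₁, |dx η z| ≤ M₁ ∧ |dy η z| ≤ M₁)
    (h₂ : ∀ z ∈ A₂, |dx η z| ≤ M₂ ∧ |dy η z| ≤ M₂)
    (h₀ : ∀ z, z ∉ A₁ → z ∉ A₂ → dx η z = 0 ∧ dy η z = 0) :
    ∫ z, η z * energy p q z
      ≤ K * (τ₁ * M₁ ^ 2 * (∫ z in A₁, (p z - c) ^ 2) + τ₁⁻¹ * ∫ z in A₁, energy p q z)
        + K * (τ₂ * M₂ ^ 2 * (∫ z in A₂, (p z - c) ^ 2) + τ₂⁻¹ * ∫ z in A₂, energy p q z) := by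
  have hU := h.isOpen
  have hp := h.lip_fst
  have hq := h.lip_snd
  have hpc : LocBdd U (fun z => (p z - c) ^ 2) :=
    ((locBdd_of_locallyLipschitzOn hp).sub (LocBdd.const c)).sq
  have hηl := locallyLipschitzOn_of_lipschitzWith (U := U) hη
  have pt : ∀ {M τ : ℝ} {z : ℝ × ℝ}, 0 < τ → |dx η z| ≤ M ∧ |dy η z| ≤ M →
      (p z - c) * (dx η z * dy q z - dy η z * dx q z)
        ≤ τ * M ^ 2 * (p z - c) ^ 2 + τ⁻¹ * energy p q z := by
    rintro M τ z hτ ⟨hx, hy⟩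
    have hM : 0 ≤ M := (abs_nonneg _).trans hx
    have e1 : (p z - c) * (dx η z * dy q z - dy η z * dx q z)
        ≤ (M * |p z - c|) * (|dy q z| + |dx q z|) := by
      calc _ ≤ |(p z - c) * (dx η z * dy q z - dy η z * dx q z)| := le_abs_self _
        _ = |p z - c| * |dx η z * dy q z - dy η z * dx q z| := abs_mul _ _
        _ ≤ |p z - c| * (|dx η z| * |dy q z| + |dy η z| * |dx q z|) := by
            gcongr
            rw [← abs_mul, ← abs_mul]
            exact abs_sub _ _
        _ ≤ |p z - c| * (M * |dy q z| + M * |dx q z|) := by gcongr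
        _ = _ := by ring
    have e2 : (|dy q z| + |dx q z|) ^ 2 ≤ 2 * energy p q z := by
      have a1 := sq_abs (dy q z)
      have a2 := sq_abs (dx q z)
      unfold energy
      nlinarith [sq_nonneg (|dy q z| - |dx q z|), sq_nonneg (dx p z), sq_nonneg (dy p z)]
    have e3 : (M * |p z - c|) * (|dy q z| + |dx q z|)
        ≤ τ * (M * |p z - c|) ^ 2 / 2 + τ⁻¹ * (|dy q z| + |dx q z|) ^ 2 / 2 := by
      have := sq_nonneg (τ * (M * |p z - c|) - (|dy q z| + |dx q z|))
      have hi : 0 < τ⁻¹ := inv_pos.2 hτ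
      have h3 := mul_nonneg hi.le this
      have h4 : τ⁻¹ * (τ * (M * |p z - c|) - (|dy q z| + |dx q z|)) ^ 2
        = τ * (M * |p z - c|) ^ 2 - 2 * ((M * |p z - c|) * (|dy q z| + |dx q z|))
          + τ⁻¹ * (|dy q z| + |dx q z|) ^ 2 := by field_simp; ring
      linarith
    have e4 : (M * |p z - c|) ^ 2 = M ^ 2 * (p z - c) ^ 2 := by rw [mul_pow, sq_abs]
    have e5 : τ⁻¹ * (|dy q z| + |dx q z|) ^ 2 ≤ τ⁻¹ * (2 * energy p q z) := by gcongr
    have e6 : 0 ≤ τ * (M ^ 2 * (p z - c) ^ 2) := by positivity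
    rw [e4] at e3
    linarith
  have hi₁ : IntegrableOn (fun z => τ₁ * M₁ ^ 2 * (p z - c) ^ 2 + τ₁⁻¹ * energy p q z) A₁ :=
    (((LocBdd.const _).mul hpc).add ((LocBdd.const _).mul h.locBdd_energy)).integrableOn hA₁ hA₁U
  have hi₂ : IntegrableOn (fun z => τ₂ * M₂ ^ 2 * (p z - c) ^ 2 + τ₂⁻¹ * energy p q z) A₂ :=
    (((LocBdd.const _).mul hpc).add ((LocBdd.const _).mul h.locBdd_energy)).integrableOn hA₂ hA₂U
  have split : ∀ {A : Set (ℝ × ℝ)} (_ : IsCompact A) (_ : A ⊆ U) (a b : ℝ),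
      ∫ z in A, (a * (p z - c) ^ 2 + b * energy p q z)
        = a * (∫ z in A, (p z - c) ^ 2) + b * ∫ z in A, energy p q z := by
    intro A hA hAU a b
    rw [integral_add, integral_const_mul, integral_const_mul]
    · exact (hpc.integrableOn hA hAU).const_mul a
    · exact (h.locBdd_energy.integrableOn hA hAU).const_mul b
  refine (h.integral_mul_energy_le hη hηc hηU hη0 c).trans ?_
  rw [← mul_add, ← split hA₁ hA₁U, ← split hA₂ hA₂U]
  refine mul_le_mul_of_nonneg_left ?_ h.pos.le
  rw [← integral_indicator hA₁.measurableSet, ← integral_indicator hA₂.measurableSet,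
    ← integral_add ((integrable_indicator_iff hA₁.measurableSet).2 hi₁)
      ((integrable_indicator_iff hA₂.measurableSet).2 hi₂)]
  refine integral_mono_ae ?_ ?_ (Eventually.of_forall fun z => ?_)
  · exact (((locBdd_of_locallyLipschitzOn hp).sub (LocBdd.const c)).mul
      (((locBdd_dx hU hηl).mul (locBdd_dy hU hq)).sub
      ((locBdd_dy hU hηl).mul (locBdd_dx hU hq)))).integrable hηc hηU
      (fun z hz => by
        rw [dx_eq_zero_of_notMem_tsupport hz, dy_eq_zero_of_notMem_tsupport hz]; ring)
  · exact ((integrable_indicator_iff hA₁.measurableSet).2 hi₁).add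
      ((integrable_indicator_iff hA₂.measurableSet).2 hi₂)
  · have n₁ : ∀ z, 0 ≤ A₁.indicator
        (fun z => τ₁ * M₁ ^ 2 * (p z - c) ^ 2 + τ₁⁻¹ * energy p q z) z := fun z =>
      indicator_nonneg (fun z _ => by have := energy_nonneg p q z; positivity) z
    have n₂ : ∀ z, 0 ≤ A₂.indicator
        (fun z => τ₂ * M₂ ^ 2 * (p z - c) ^ 2 + τ₂⁻¹ * energy p q z) z := fun z =>
      indicator_nonneg (fun z _ => by have := energy_nonneg p q z; positivity) z
    by_cases hz₁ : z ∈ A₁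
    · refine (pt hτ₁ (h₁ z hz₁)).trans ?_
      have := n₂ z
      simp only [indicator_of_mem hz₁]
      linarith
    by_cases hz₂ : z ∈ A₂
    · refine (pt hτ₂ (h₂ z hz₂)).trans ?_
      have := n₁ z
      simp only [indicator_of_mem hz₂]
      linarith
    · obtain ⟨e1, e2⟩ := h₀ z hz₁ hz₂
      simp only [e1, e2]
      have := n₁ z
      have := n₂ z
      simp only [zero_mul, sub_zero, mul_zero]
      linarith

end QuasiregularOn

/-! ### Square annuli and their cutoffs -/

/-- The closed square annulus of inner radius `r` and outer radius `s` about `x₀`, in the maximum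
norm. For `r ≤ 0` it is a closed square. -/
def ann (x₀ : ℝ × ℝ) (r s : ℝ) : Set (ℝ × ℝ) := {z | r ≤ ‖z - x₀‖ ∧ ‖z - x₀‖ ≤ s}

lemma isCompact_ann (x₀ : ℝ × ℝ) (r s : ℝ) : IsCompact (ann x₀ r s) := by
  refine (isCompact_closedBall x₀ s).of_isClosed_subset ?_ fun z hz => ?_
  · have hc : Continuous fun z : ℝ × ℝ => ‖z - x₀‖ := by fun_prop
    exact (isClosed_le continuous_const hc).inter (isClosed_le hc continuous_const)
  · simpa [dist_eq_norm] using hz.2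

lemma ann_mono {x₀ : ℝ × ℝ} {r r' s s' : ℝ} (hr : r' ≤ r) (hs : s ≤ s') :
    ann x₀ r s ⊆ ann x₀ r' s' := fun _ hz => ⟨hr.trans hz.1, hz.2.trans hs⟩

lemma volume_sphere (x₀ : ℝ × ℝ) (r : ℝ) : volume {z : ℝ × ℝ | ‖z - x₀‖ = r} = 0 := by
  have := Measure.addHaar_sphere (volume : Measure (ℝ × ℝ)) x₀ r
  simpa [sphere, dist_eq_norm] using this

/-- Adjacent annuli overlap only in a square contour, which is a null set. -/
lemma setIntegral_ann_add {x₀ : ℝ × ℝ} {r s t : ℝ} (hrs : r ≤ s) (hst : s ≤ t)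
    {f : ℝ × ℝ → ℝ} (hf : IntegrableOn f (ann x₀ r t)) :
    (∫ z in ann x₀ r s, f z) + ∫ z in ann x₀ s t, f z = ∫ z in ann x₀ r t, f z := by
  have hu : ann x₀ r s ∪ ann x₀ s t = ann x₀ r t := by
    ext z
    simp only [ann, mem_union, mem_ofPred_eq]
    constructor
    · rintro (⟨h1, h2⟩ | ⟨h1, h2⟩)
      · exact ⟨h1, h2.trans hst⟩
      · exact ⟨hrs.trans h1, h2⟩
    · rintro ⟨h1, h2⟩
      rcases le_total ‖z - x₀‖ s with h | h
      · exact Or.inl ⟨h1, h⟩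
      · exact Or.inr ⟨h, h2⟩
  rw [← hu, setIntegral_union₀]
  · refine measure_mono_null (fun z hz => ?_) (volume_sphere x₀ s)
    exact le_antisymm hz.1.2 hz.2.1
  · exact (isCompact_ann x₀ s t).measurableSet.nullMeasurableSet
  · exact hf.mono_set (ann_mono le_rfl hst)
  · exact hf.mono_set (ann_mono hrs le_rfl)

lemma closedBall_eq_prod (x₀ : ℝ × ℝ) (s : ℝ) :
    closedBall x₀ s = Icc (x₀.1 - s) (x₀.1 + s) ×ˢ Icc (x₀.2 - s) (x₀.2 + s) := by
  rw [← Real.closedBall_eq_Icc, ← Real.closedBall_eq_Icc, closedBall_prod_same]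

lemma volume_real_closedBall (x₀ : ℝ × ℝ) {s : ℝ} (hs : 0 ≤ s) :
    volume.real (closedBall x₀ s) = 4 * s ^ 2 := by
  rw [closedBall_eq_prod, Measure.real, Measure.volume_eq_prod, Measure.prod_prod, Real.volume_Icc,
    Real.volume_Icc, ENNReal.toReal_mul, ENNReal.toReal_ofReal (by linarith),
    ENNReal.toReal_ofReal (by linarith)]
  ring

lemma ann_zero (x₀ : ℝ × ℝ) (s : ℝ) : ann x₀ 0 s = closedBall x₀ s := by
  ext z; simp [ann, dist_eq_norm]

lemma ann_subset_closedBall (x₀ : ℝ × ℝ) (r s : ℝ) : ann x₀ r s ⊆ closedBall x₀ s :=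
  fun z hz => by simpa [dist_eq_norm] using hz.2

lemma volume_real_ann_le (x₀ : ℝ × ℝ) (r : ℝ) {s : ℝ} (hs : 0 ≤ s) :
    volume.real (ann x₀ r s) ≤ 4 * s ^ 2 := by
  rw [← volume_real_closedBall x₀ hs]
  exact measureReal_mono (ann_subset_closedBall x₀ r s)
    (isCompact_closedBall x₀ s).measure_lt_top.ne

lemma fderiv_eq_zero_of_extremal {η : ℝ × ℝ → ℝ} (h0 : ∀ z, 0 ≤ η z) (h1 : ∀ z, η z ≤ 1)
    {z : ℝ × ℝ} (hz : η z = 0 ∨ η z = 1) : fderiv ℝ η z = 0 := by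
  rcases hz with hz | hz
  · exact IsLocalMin.fderiv_eq_zero (Eventually.of_forall fun w => by rw [hz]; exact h0 w)
  · exact IsLocalMax.fderiv_eq_zero (Eventually.of_forall fun w => by rw [hz]; exact h1 w)

lemma abs_dx_dy_le_of_lipschitzWith {η : ℝ × ℝ → ℝ} {M : ℝ} (hM : 0 ≤ M)
    (h : LipschitzWith M.toNNReal η) (z : ℝ × ℝ) : |dx η z| ≤ M ∧ |dy η z| ≤ M := by
  have := norm_fderiv_le_of_lipschitz ℝ h (x₀ := z)
  rw [Real.coe_toNNReal _ hM] at this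
  exact ⟨(abs_dx_le _ _).trans this, (abs_dy_le _ _).trans this⟩

lemma dx_dy_eq_zero_of_fderiv {η : ℝ × ℝ → ℝ} {z : ℝ × ℝ} (h : fderiv ℝ η z = 0) :
    dx η z = 0 ∧ dy η z = 0 := by simp [dx, dy, h]

lemma tsupport_cutoff_subset (x₀ : ℝ × ℝ) {r s : ℝ} (hrs : r < s) :
    tsupport (cutoff x₀ r s) ⊆ ann x₀ 0 s := by
  refine closure_minimal (fun z hz => ⟨norm_nonneg _, ?_⟩) (isCompact_ann _ _ _).isClosed
  by_contra h
  exact hz (cutoff_eq_zero hrs (not_le.1 h).le)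

lemma dx_dy_cutoff_eq_zero {x₀ : ℝ × ℝ} {r s : ℝ} (hrs : r < s) {z : ℝ × ℝ}
    (hz : z ∉ ann x₀ r s) : dx (cutoff x₀ r s) z = 0 ∧ dy (cutoff x₀ r s) z = 0 := by
  refine dx_dy_eq_zero_of_fderiv (fderiv_eq_zero_of_extremal (cutoff_nonneg x₀ r s)
    (cutoff_le_one x₀ r s) ?_)
  by_cases h : r ≤ ‖z - x₀‖
  · exact Or.inl (cutoff_eq_zero hrs (not_le.1 fun h' => hz ⟨h, h'⟩).le)
  · exact Or.inr (cutoff_eq_one hrs (not_le.1 h).le)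

/-- The cutoff that rises from `0` to `1` across the annulus between the radii `r` and `s`, and
falls back to `0` between `r'` and `s'`. -/
noncomputable def ringCutoff (x₀ : ℝ × ℝ) (r s r' s' : ℝ) (z : ℝ × ℝ) : ℝ :=
  min (cutoff x₀ r' s' z) (1 - cutoff x₀ r s z)

section ringCutoff

variable {x₀ : ℝ × ℝ} {r s r' s' : ℝ}

lemma ringCutoff_nonneg (z : ℝ × ℝ) : 0 ≤ ringCutoff x₀ r s r' s' z :=
  le_min (cutoff_nonneg _ _ _ _) (by linarith [cutoff_le_one x₀ r s z])

lemma ringCutoff_le_one (z : ℝ × ℝ) : ringCutoff x₀ r s r' s' z ≤ 1 :=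
  (min_le_left _ _).trans (cutoff_le_one _ _ _ _)

lemma ringCutoff_eq_one (hrs : r < s) (hrs' : r' < s') {z : ℝ × ℝ} (hz : z ∈ ann x₀ s r') :
    ringCutoff x₀ r s r' s' z = 1 := by
  simp [ringCutoff, cutoff_eq_one hrs' hz.2, cutoff_eq_zero hrs hz.1]

lemma ringCutoff_eq_zero (hrs : r < s) (hrs' : r' < s') {z : ℝ × ℝ} (hz : z ∉ ann x₀ r s') :
    ringCutoff x₀ r s r' s' z = 0 := by
  by_cases h : r ≤ ‖z - x₀‖
  · have : cutoff x₀ r' s' z = 0 := cutoff_eq_zero hrs' (not_le.1 fun h' => hz ⟨h, h'⟩).le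
    simp [ringCutoff, this, cutoff_le_one]
  · have : cutoff x₀ r s z = 1 := cutoff_eq_one hrs (not_le.1 h).le
    simp [ringCutoff, this, cutoff_nonneg]

lemma lipschitzWith_one_sub_cutoff (x₀ : ℝ × ℝ) (hrs : r < s) :
    LipschitzWith (s - r)⁻¹.toNNReal (fun z => 1 - cutoff x₀ r s z) := by
  simpa using (LipschitzWith.const (1 : ℝ)).sub (lipschitzWith_cutoff x₀ hrs)

lemma lipschitzWith_ringCutoff (hrs : r < s) (hrs' : r' < s') :
    LipschitzWith (max (s' - r')⁻¹.toNNReal (s - r)⁻¹.toNNReal) (ringCutoff x₀ r s r' s') :=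
  (lipschitzWith_cutoff x₀ hrs').min (lipschitzWith_one_sub_cutoff x₀ hrs)

lemma hasCompactSupport_ringCutoff (hrs : r < s) (hrs' : r' < s') :
    HasCompactSupport (ringCutoff x₀ r s r' s') :=
  HasCompactSupport.intro (isCompact_ann x₀ r s') fun _ hz => ringCutoff_eq_zero hrs hrs' hz

lemma tsupport_ringCutoff_subset (hrs : r < s) (hrs' : r' < s') :
    tsupport (ringCutoff x₀ r s r' s') ⊆ ann x₀ r s' := by
  refine closure_minimal (fun z hz => ?_) (isCompact_ann _ _ _).isClosed
  by_contra h
  exact hz (ringCutoff_eq_zero hrs hrs' h)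

lemma abs_dx_dy_ringCutoff_inner (hrs : r < s) (hsr : s < r') (hrs' : r' < s') {z : ℝ × ℝ}
    (hz : z ∈ ann x₀ r s) :
    |dx (ringCutoff x₀ r s r' s') z| ≤ (s - r)⁻¹ ∧
      |dy (ringCutoff x₀ r s r' s') z| ≤ (s - r)⁻¹ := by
  have he : ringCutoff x₀ r s r' s' =ᶠ[𝓝 z] fun z => 1 - cutoff x₀ r s z := by
    have : ∀ᶠ w in 𝓝 z, ‖w - x₀‖ < r' :=
      (continuous_id.sub continuous_const).norm.continuousAt.eventually_lt
        continuousAt_const (by simpa using hz.2.trans_lt hsr)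
    filter_upwards [this] with w hw
    simp [ringCutoff, cutoff_eq_one hrs' hw.le, cutoff_nonneg]
  rw [dx_congr he, dy_congr he]
  exact abs_dx_dy_le_of_lipschitzWith (inv_nonneg.2 (by linarith))
    (lipschitzWith_one_sub_cutoff x₀ hrs) z

lemma abs_dx_dy_ringCutoff_outer (hrs : r < s) (hsr : s < r') (hrs' : r' < s') {z : ℝ × ℝ}
    (hz : z ∈ ann x₀ r' s') :
    |dx (ringCutoff x₀ r s r' s') z| ≤ (s' - r')⁻¹ ∧
      |dy (ringCutoff x₀ r s r' s') z| ≤ (s' - r')⁻¹ := by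
  have he : ringCutoff x₀ r s r' s' =ᶠ[𝓝 z] cutoff x₀ r' s' := by
    have : ∀ᶠ w in 𝓝 z, s < ‖w - x₀‖ :=
      continuousAt_const.eventually_lt
        (continuous_id.sub continuous_const).norm.continuousAt (by simpa using hsr.trans_le hz.1)
    filter_upwards [this] with w hw
    simp [ringCutoff, cutoff_eq_zero hrs hw.le, cutoff_le_one]
  rw [dx_congr he, dy_congr he]
  exact abs_dx_dy_le_of_lipschitzWith (inv_nonneg.2 (by linarith)) (lipschitzWith_cutoff x₀ hrs') z

lemma dx_dy_ringCutoff_eq_zero (hrs : r < s) (hrs' : r' < s') {z : ℝ × ℝ}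
    (hz : z ∉ ann x₀ r s) (hz' : z ∉ ann x₀ r' s') :
    dx (ringCutoff x₀ r s r' s') z = 0 ∧ dy (ringCutoff x₀ r s r' s') z = 0 := by
  refine dx_dy_eq_zero_of_fderiv (fderiv_eq_zero_of_extremal ringCutoff_nonneg
    ringCutoff_le_one ?_)
  by_cases h : z ∈ ann x₀ r s'
  · refine Or.inr (ringCutoff_eq_one hrs hrs' ⟨?_, ?_⟩)
    · exact (not_le.1 fun h' => hz ⟨h.1, h'⟩).le
    · exact (not_le.1 fun h' => hz' ⟨h', h.2⟩).le
  · exact Or.inl (ringCutoff_eq_zero hrs hrs' h)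

end ringCutoff

/-! ### Energy of a gradient map in terms of its potential -/

lemma fderiv_pow_four_apply {η : ℝ × ℝ → ℝ} {z : ℝ × ℝ} (h : DifferentiableAt ℝ η z)
    (w : ℝ × ℝ) :
    fderiv ℝ (fun z => (η z * η z) * (η z * η z)) z w = 4 * η z ^ 3 * fderiv ℝ η z w := by
  rw [fderiv_mul_apply (f := fun z => η z * η z) (g := fun z => η z * η z) (h.mul h) (h.mul h),
    fderiv_mul_apply h h]
  ring

/-- The integrand on the right of the Caccioppoli inequality with cutoff `η ^ 4`, after Young's
inequality: half of the energy can be absorbed. -/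
lemma jacobian_term_le (p px py qx qy : ℝ) {K M η ηx ηy : ℝ} (hK : 0 ≤ K) (hη : 0 ≤ η)
    (hx : |ηx| ≤ M) (hy : |ηy| ≤ M) (q : ℝ) :
    4 * K * η ^ 3 * (p * (ηx * qy - ηy * qx))
      ≤ 1 / 2 * (η ^ 4 * (px ^ 2 + py ^ 2 + qx ^ 2 + qy ^ 2))
        + 16 * K ^ 2 * M ^ 2 * (η ^ 2 * (p ^ 2 + q ^ 2)) := by
  set s := |qy| + |qx| with hs
  have b1 : p * (ηx * qy - ηy * qx) ≤ |p| * (M * s) := by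
    calc _ ≤ |p * (ηx * qy - ηy * qx)| := le_abs_self _
      _ = |p| * |ηx * qy - ηy * qx| := abs_mul _ _
      _ ≤ |p| * (|ηx| * |qy| + |ηy| * |qx|) := by
          gcongr
          rw [← abs_mul, ← abs_mul]
          exact abs_sub _ _
      _ ≤ |p| * (M * |qy| + M * |qx|) := by gcongr
      _ = _ := by rw [hs]; ring
  have b2 : s ^ 2 ≤ 2 * (px ^ 2 + py ^ 2 + qx ^ 2 + qy ^ 2) := by
    have a1 := sq_abs qy
    have a2 := sq_abs qx
    nlinarith [sq_nonneg (|qy| - |qx|), sq_nonneg px, sq_nonneg py]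
  have b3 := mul_le_mul_of_nonneg_left b1 (by positivity : 0 ≤ 4 * K * η ^ 3)
  have b4 := sq_nonneg (η ^ 2 * s / 2 - 4 * K * M * |p| * η)
  have b5 := mul_le_mul_of_nonneg_left b2 (by positivity : 0 ≤ η ^ 4)
  have b6 : 0 ≤ 16 * K ^ 2 * M ^ 2 * (η ^ 2 * q ^ 2) := by positivity
  have b7 : (η ^ 2 * s / 2 - 4 * K * M * |p| * η) ^ 2
      = η ^ 4 * s ^ 2 / 4 - 4 * K * η ^ 3 * (|p| * (M * s))
        + 16 * K ^ 2 * M ^ 2 * (η ^ 2 * p ^ 2) := by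
    rw [← sq_abs p]; ring
  linarith

/-- The integrand of `∫ η² |Dv|²` after the integration by parts onto `v`. The weight of the energy
term is chosen to be absorbed by means of `∫ η⁴ |D²v|² ≤ 32 K² M² ∫ η² |Dv|²`. -/
lemma potential_term_le (p q px py qx qy : ℝ) {K M S v η ηx ηy : ℝ} (hK : 0 < K) (hM : 0 < M)
    (hη : 0 ≤ η) (hx : |ηx| ≤ M) (hy : |ηy| ≤ M) (hv : |v| ≤ S) :
    -(v * ((η * ηx + η * ηx) * p + η * η * px) + v * ((η * ηy + η * ηy) * q + η * η * qy))
      ≤ 1 / 2 * (η ^ 2 * (p ^ 2 + q ^ 2))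
        + (128 * K ^ 2 * M ^ 2)⁻¹ * (η ^ 4 * (px ^ 2 + py ^ 2 + qx ^ 2 + qy ^ 2))
        + (4 + 64 * K ^ 2) * S ^ 2 * M ^ 2 := by
  have hS0 : 0 ≤ S := (abs_nonneg _).trans hv
  set t := |p| + |q| with ht
  set w := |px| + |qy| with hw
  have c1 : -(v * ((η * ηx + η * ηx) * p + η * η * px)
      + v * ((η * ηy + η * ηy) * q + η * η * qy)) ≤ S * (2 * η * M * t + η ^ 2 * w) := by
    have r1 : -(v * ((η * ηx + η * ηx) * p + η * η * px)
        + v * ((η * ηy + η * ηy) * q + η * η * qy))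
        = -(v * (2 * η * (ηx * p + ηy * q) + η ^ 2 * (px + qy))) := by ring
    rw [r1]
    refine (neg_le_abs _).trans ?_
    rw [abs_mul]
    refine mul_le_mul hv ?_ (abs_nonneg _) hS0
    refine (abs_add_le _ _).trans (add_le_add ?_ ?_)
    · rw [abs_mul, abs_of_nonneg (by positivity : 0 ≤ 2 * η), mul_assoc (2 * η)]
      gcongr
      calc _ ≤ |ηx| * |p| + |ηy| * |q| := by
            rw [← abs_mul, ← abs_mul]; exact abs_add_le _ _
        _ ≤ M * |p| + M * |q| := by gcongr
        _ = _ := by rw [ht]; ring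
    · rw [abs_mul, abs_of_nonneg (by positivity : 0 ≤ η ^ 2)]
      gcongr
      exact abs_add_le _ _
  have c2 : t ^ 2 ≤ 2 * (p ^ 2 + q ^ 2) := by
    have a1 := sq_abs p
    have a2 := sq_abs q
    nlinarith [sq_nonneg (|p| - |q|)]
  have c3 : w ^ 2 ≤ 2 * (px ^ 2 + py ^ 2 + qx ^ 2 + qy ^ 2) := by
    have a1 := sq_abs px
    have a2 := sq_abs qy
    nlinarith [sq_nonneg (|px| - |qy|), sq_nonneg qx, sq_nonneg py]
  have c4 : 0 ≤ η ^ 2 * t ^ 2 / 4 - S * (2 * η * M * t) + 4 * S ^ 2 * M ^ 2 := by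
    have := sq_nonneg (η * t / 2 - 2 * S * M)
    linarith
  have c5 := mul_le_mul_of_nonneg_left c2 (by positivity : 0 ≤ η ^ 2)
  have c6 := mul_le_mul_of_nonneg_left c3 (by positivity : 0 ≤ η ^ 4)
  set τ := (128 * K ^ 2 * M ^ 2)⁻¹ with hτ
  have hτ0 : 0 < τ := by positivity
  have c7 : S * (η ^ 2 * w) ≤ τ * (η ^ 4 * w ^ 2) / 2 + 64 * K ^ 2 * M ^ 2 * S ^ 2 := by
    have d1 := mul_nonneg hτ0.le (sq_nonneg (η ^ 2 * w - 128 * K ^ 2 * M ^ 2 * S))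
    have d2 : τ * (η ^ 2 * w - 128 * K ^ 2 * M ^ 2 * S) ^ 2
        = τ * (η ^ 4 * w ^ 2) - 2 * (S * (η ^ 2 * w)) + 128 * K ^ 2 * M ^ 2 * S ^ 2 := by
      rw [hτ]; field_simp; ring
    linarith
  have c8 := mul_le_mul_of_nonneg_left c6 hτ0.le
  linarith

/-- If `(p, q)` is moreover the gradient of `v`, its energy and its square integral are controlled
by the supremum of `v`. Two integrations by parts give `∫ η⁴ |D²v|² ≲ ∫ η² |Dv|²` and
`∫ η² |Dv|² ≲ |v|²_∞ + |v|_∞ (∫ η⁴ |D²v|²)^{1/2}`. -/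
lemma QuasiregularOn.integral_energy_le_of_potential {U : Set (ℝ × ℝ)} {K : ℝ}
    {p q v : ℝ × ℝ → ℝ} (h : QuasiregularOn U K p q) (hv : LocallyLipschitzOn U v)
    (hgrad : ∀ᵐ z, z ∈ U → dx v z = p z ∧ dy v z = q z)
    {η : ℝ × ℝ → ℝ} {C : ℝ≥0} (hη : LipschitzWith C η) (hηc : HasCompactSupport η)
    (hηU : tsupport η ⊆ U) (hη0 : ∀ z, 0 ≤ η z) {M S V : ℝ} (hM : 0 < M)
    (hηM : ∀ z, |dx η z| ≤ M ∧ |dy η z| ≤ M)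
    (hS : ∀ z ∈ tsupport η, |v z| ≤ S) (hV : volume.real (tsupport η) ≤ V) :
    ∫ z, η z ^ 2 * (p z ^ 2 + q z ^ 2) ≤ (16 + 256 * K ^ 2) * S ^ 2 * M ^ 2 * V ∧
    ∫ z, η z ^ 4 * energy p q z
      ≤ 32 * K ^ 2 * M ^ 2 * ((16 + 256 * K ^ 2) * S ^ 2 * M ^ 2 * V) := by
  have hU := h.isOpen
  have hp := h.lip_fst
  have hq := h.lip_snd
  have hK := h.pos
  have lη := locBdd_of_locallyLipschitzOn (locallyLipschitzOn_of_lipschitzWith (U := U) hη)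
  have lηl := locallyLipschitzOn_of_lipschitzWith (U := U) hη
  have lp := locBdd_of_locallyLipschitzOn hp
  have lq := locBdd_of_locallyLipschitzOn hq
  have lv := locBdd_of_locallyLipschitzOn hv
  obtain ⟨C2, hη2⟩ := exists_lipschitzWith_mul hη hηc hη
  have hη2c : HasCompactSupport (fun z => η z * η z) := hηc.mul_right
  obtain ⟨C4, hη4⟩ := exists_lipschitzWith_mul hη2 hη2c hη2
  have hη4c : HasCompactSupport (fun z => (η z * η z) * (η z * η z)) := hη2c.mul_right
  have hη2U : tsupport (fun z => η z * η z) ⊆ U := (tsupport_mul_subset_left).trans hηU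
  have hη4U : tsupport (fun z => (η z * η z) * (η z * η z)) ⊆ U :=
    (tsupport_mul_subset_left).trans hη2U
  set T := tsupport η with hT
  have h0 : ∀ z, z ∉ T → η z = 0 := fun z hz => image_eq_zero_of_notMem_tsupport hz
  set A := ∫ z, η z ^ 4 * energy p q z with hA
  set B := ∫ z, η z ^ 2 * (p z ^ 2 + q z ^ 2) with hB
  have l4 : LocBdd U (fun z => η z ^ 4 * energy p q z) := by
    have := (lη.sq.sq).mul h.locBdd_energy
    simpa only [← pow_mul] using this
  have iA : Integrable (fun z => η z ^ 4 * energy p q z) :=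
    l4.integrable hηc hηU (fun z hz => by rw [h0 z hz]; simp)
  have iB : Integrable (fun z => η z ^ 2 * (p z ^ 2 + q z ^ 2)) :=
    (lη.sq.mul (lp.sq.add lq.sq)).integrable hηc hηU (fun z hz => by rw [h0 z hz]; simp)
  have hAB : A ≤ 32 * K ^ 2 * M ^ 2 * B := by
    have h1 := h.integral_mul_energy_le hη4 hη4c hη4U
      (fun z => mul_nonneg (mul_self_nonneg _) (mul_self_nonneg _)) 0
    have e1 : ∫ z, (η z * η z) * (η z * η z) * energy p q z = A := by
      rw [hA]; congr 1; funext z; ring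
    rw [e1, ← integral_const_mul] at h1
    have h2 : ∫ z, K * ((p z - 0) * (dx (fun z => (η z * η z) * (η z * η z)) z * dy q z
        - dy (fun z => (η z * η z) * (η z * η z)) z * dx q z))
        ≤ ∫ z, ((1 / 2) * (η z ^ 4 * energy p q z)
          + 16 * K ^ 2 * M ^ 2 * (η z ^ 2 * (p z ^ 2 + q z ^ 2))) := by
      refine integral_mono_ae ?_ ((iA.const_mul _).add (iB.const_mul _)) ?_
      · have l := locallyLipschitzOn_of_lipschitzWith (U := U) hη4
        refine (((LocBdd.const K).mul ((lp.sub (LocBdd.const 0)).mul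
          (((locBdd_dx hU l).mul (locBdd_dy hU hq)).sub
          ((locBdd_dy hU l).mul (locBdd_dx hU hq)))))).integrable hη4c hη4U fun z hz => ?_
        rw [dx_eq_zero_of_notMem_tsupport hz, dy_eq_zero_of_notMem_tsupport hz]
        ring
      · filter_upwards [hη.ae_differentiableAt] with z hz
        have d1 : dx (fun z => (η z * η z) * (η z * η z)) z = 4 * η z ^ 3 * dx η z :=
          fderiv_pow_four_apply hz _
        have d2 : dy (fun z => (η z * η z) * (η z * η z)) z = 4 * η z ^ 3 * dy η z :=
          fderiv_pow_four_apply hz _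
        simp only [d1, d2]
        have := jacobian_term_le (p z) (dx p z) (dy p z) (dx q z) (dy q z) hK.le (hη0 z)
          (hηM z).1 (hηM z).2 (q z)
        unfold energy
        linarith
    have h3 : ∫ z, ((1 / 2) * (η z ^ 4 * energy p q z)
        + 16 * K ^ 2 * M ^ 2 * (η z ^ 2 * (p z ^ 2 + q z ^ 2)))
        = (1 / 2) * A + 16 * K ^ 2 * M ^ 2 * B := by
      rw [integral_add (iA.const_mul _) (iB.const_mul _), integral_const_mul, integral_const_mul]
    linarith
  have hBA : B ≤ B / 2 + (128 * K ^ 2 * M ^ 2)⁻¹ * A + (4 + 64 * K ^ 2) * S ^ 2 * M ^ 2 * V := by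
    have h1 := integral_mul_mul_fderiv hU hp hv hη2 hη2c hη2U (1, 0)
    have h2 := integral_mul_mul_fderiv hU hq hv hη2 hη2c hη2U (0, 1)
    have l2 := locallyLipschitzOn_of_lipschitzWith (U := U) hη2
    have z2 : ∀ z, z ∉ T → η z * η z = 0 := fun z hz => by rw [h0 z hz]; simp
    have j1 : Integrable (fun z => η z * η z * p z * fderiv ℝ v z (1, 0)) :=
      (((lη.mul lη).mul lp).mul (locBdd_dx hU hv)).integrable hηc hηU
        (fun z hz => by rw [z2 z hz]; simp)
    have j2 : Integrable (fun z => η z * η z * q z * fderiv ℝ v z (0, 1)) :=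
      (((lη.mul lη).mul lq).mul (locBdd_dy hU hv)).integrable hηc hηU
        (fun z hz => by rw [z2 z hz]; simp)
    have j3 : Integrable (fun z => v z * (fderiv ℝ (fun z => η z * η z) z (1, 0) * p z
        + η z * η z * fderiv ℝ p z (1, 0))) := by
      refine (lv.mul (((locBdd_dx hU l2).mul lp).add
        ((lη.mul lη).mul (locBdd_dx hU hp)))).integrable hη2c hη2U fun z hz => ?_
      rw [dx_eq_zero_of_notMem_tsupport hz, image_eq_zero_of_notMem_tsupport hz]; ring
    have j4 : Integrable (fun z => v z * (fderiv ℝ (fun z => η z * η z) z (0, 1) * q z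
        + η z * η z * fderiv ℝ q z (0, 1))) := by
      refine (lv.mul (((locBdd_dy hU l2).mul lq).add
        ((lη.mul lη).mul (locBdd_dy hU hq)))).integrable hη2c hη2U fun z hz => ?_
      rw [dy_eq_zero_of_notMem_tsupport hz, image_eq_zero_of_notMem_tsupport hz]; ring
    have e1 : B = ∫ z, (η z * η z * p z * fderiv ℝ v z (1, 0)
        + η z * η z * q z * fderiv ℝ v z (0, 1)) := by
      refine integral_congr_ae ?_
      filter_upwards [hgrad] with z hz
      by_cases hzT : z ∈ T
      · obtain ⟨g1, g2⟩ := hz (hηU hzT)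
        simp only [dx, dy] at g1 g2
        rw [g1, g2]
        ring
      · rw [h0 z hzT]; simp
    rw [integral_add j1 j2, h1, h2, ← neg_add, ← integral_add j3 j4, ← integral_neg] at e1
    set τ := (128 * K ^ 2 * M ^ 2)⁻¹ with hτ
    have hτ0 : 0 < τ := by positivity
    have hT1 : Integrable (T.indicator fun _ => (4 + 64 * K ^ 2) * S ^ 2 * M ^ 2) :=
      (integrable_indicator_iff hηc.measurableSet).2
        (integrableOn_const hηc.measure_lt_top.ne)
    have h3 : B ≤ ∫ z, ((1 / 2) * (η z ^ 2 * (p z ^ 2 + q z ^ 2)) + τ * (η z ^ 4 * energy p q z)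
        + T.indicator (fun _ => (4 + 64 * K ^ 2) * S ^ 2 * M ^ 2) z) := by
      rw [e1]
      refine integral_mono_ae (j3.add j4).neg
        (((iB.const_mul _).add (iA.const_mul _)).add hT1) ?_
      filter_upwards [hη.ae_differentiableAt] with z hz
      by_cases hzT : z ∈ T
      · rw [indicator_of_mem hzT, fderiv_mul_apply hz hz, fderiv_mul_apply hz hz]
        have := potential_term_le (p z) (q z) (dx p z) (dy p z) (dx q z) (dy q z) hK hM (hη0 z)
          (hηM z).1 (hηM z).2 (hS z hzT)
        simp only [dx, dy] at this
        simp only [energy, dx, dy]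
        linarith
      · rw [indicator_of_notMem hzT]
        have f0 : fderiv ℝ (fun z => η z * η z) z = 0 := by
          have : (fun z => η z * η z) =ᶠ[𝓝 z] 0 := by
            filter_upwards [notMem_tsupport_iff_eventuallyEq.1 hzT] with y hy
            simp [hy]
          rw [this.fderiv_eq]; simp
        simp only [h0 z hzT, f0]
        simp
    have iAB : Integrable (fun z => 1 / 2 * (η z ^ 2 * (p z ^ 2 + q z ^ 2))
        + τ * (η z ^ 4 * energy p q z)) := (iB.const_mul _).add (iA.const_mul _)
    rw [integral_add iAB hT1,
      integral_add (iB.const_mul _) (iA.const_mul _), integral_const_mul, integral_const_mul,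
      integral_indicator hηc.measurableSet, setIntegral_const, smul_eq_mul] at h3
    have h4 : volume.real T * ((4 + 64 * K ^ 2) * S ^ 2 * M ^ 2)
        ≤ V * ((4 + 64 * K ^ 2) * S ^ 2 * M ^ 2) := by gcongr
    linarith
  have hpos : 0 < 128 * K ^ 2 * M ^ 2 := by positivity
  have hAB' : (128 * K ^ 2 * M ^ 2)⁻¹ * A ≤ B / 4 := by
    rw [inv_mul_le_iff₀ hpos]
    linarith
  have hfin : B ≤ (16 + 256 * K ^ 2) * S ^ 2 * M ^ 2 * V := by linarith
  exact ⟨hfin, hAB.trans (by gcongr)⟩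

/-! ### Poincaré inequalities -/

/-- The one-dimensional Sobolev inequality on an interval. -/
lemma sq_sub_le_of_lipschitzWith {g : ℝ → ℝ} {C : ℝ≥0} (hg : LipschitzWith C g) {a b x y : ℝ}
    (hx : x ∈ Icc a b) (hy : y ∈ Icc a b) :
    (g x - g y) ^ 2 ≤ (b - a) * ∫ s in Icc a b, deriv g s ^ 2 := by
  have hfin : IsFiniteMeasure (volume.restrict (Icc a b)) :=
    isFiniteMeasure_restrict.2 isCompact_Icc.measure_lt_top.ne
  have hb : ∀ s, ‖deriv g s‖ ≤ C := fun s => norm_deriv_le_of_lipschitz hg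
  have hab : a ≤ b := hx.1.trans hx.2
  have m : Measurable (deriv g) := measurable_deriv g
  have i1 : IntegrableOn (fun s => |deriv g s|) (Icc a b) :=
    Integrable.of_bound m.norm.aestronglyMeasurable C
      (Eventually.of_forall fun s => by simpa using hb s)
  have i2 : IntegrableOn (fun s => deriv g s ^ 2) (Icc a b) :=
    Integrable.of_bound (m.pow_const 2).aestronglyMeasurable ((C : ℝ) ^ 2)
      (Eventually.of_forall fun s => by
        rw [norm_pow]; exact pow_le_pow_left₀ (norm_nonneg _) (hb s) 2)
  set I := ∫ s in Icc a b, |deriv g s| with hI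
  set J := ∫ s in Icc a b, deriv g s ^ 2 with hJ
  have key : ∀ u v, u ∈ Icc a b → v ∈ Icc a b → u ≤ v → |g v - g u| ≤ I := by
    intro u v hu hv huv
    have ac : AbsolutelyContinuousOnInterval g u v :=
      (hg.lipschitzOnWith (s := uIcc u v)).absolutelyContinuousOnInterval
    rw [← ac.integral_deriv_eq_sub]
    calc _ ≤ ∫ s in u..v, |deriv g s| := intervalIntegral.abs_integral_le_integral_abs huv
      _ = ∫ s in Ioc u v, |deriv g s| := intervalIntegral.integral_of_le huv
      _ ≤ I := setIntegral_mono_set i1 (Eventually.of_forall fun _ => abs_nonneg _)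
          (LE.le.eventuallyLE fun s hs => ⟨hu.1.trans hs.1.le, hs.2.trans hv.2⟩)
  have h1 : |g x - g y| ≤ I := by
    rcases le_total y x with h | h
    · exact key y x hy hx h
    · rw [abs_sub_comm]; exact key x y hx hy h
  -- the Cauchy-Schwarz inequality, from the variance of `|deriv g|`
  have h2 : I ^ 2 ≤ (b - a) * J := by
    rcases hab.eq_or_lt with h | h
    · have : I = 0 := by rw [hI, h]; simp
      rw [this, h]; simp
    have h3 : 0 ≤ ∫ s in Icc a b, ((b - a) * |deriv g s| - I) ^ 2 :=
      integral_nonneg fun _ => sq_nonneg _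
    have h4 : ∀ s, ((b - a) * |deriv g s| - I) ^ 2
        = ((b - a) ^ 2 * deriv g s ^ 2 - 2 * (b - a) * I * |deriv g s|) + I ^ 2 := fun s => by
      rw [← sq_abs (deriv g s)]; ring
    have j1 := i2.const_mul ((b - a) ^ 2)
    have j2 := i1.const_mul (2 * (b - a) * I)
    have j3 : IntegrableOn (fun s => (b - a) ^ 2 * deriv g s ^ 2 - 2 * (b - a) * I * |deriv g s|)
      (Icc a b) := j1.sub j2
    simp_rw [h4] at h3
    rw [integral_add j3 (integrable_const _), integral_sub j1 j2, integral_const_mul,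
      integral_const_mul, setIntegral_const, Real.volume_real_Icc_of_le hab, smul_eq_mul,
      ← hI, ← hJ] at h3
    have h5 : 0 < b - a := sub_pos.2 h
    have h6 : (b - a) * I ^ 2 ≤ (b - a) * ((b - a) * J) := by linarith
    exact le_of_mul_le_mul_left h6 h5
  calc (g x - g y) ^ 2 = |g x - g y| ^ 2 := (sq_abs _).symm
    _ ≤ I ^ 2 := pow_le_pow_left₀ (abs_nonneg _) h1 2
    _ ≤ _ := h2

lemma lineDeriv_fst_eq (F : ℝ × ℝ → ℝ) (s t : ℝ) :
    lineDeriv ℝ F (s, t) (1, 0) = deriv (fun s => F (s, t)) s := by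
  have := deriv_comp_const_add (fun s => F (s, t)) s 0
  simp only [add_zero] at this
  rw [← this]
  simp [lineDeriv]

lemma lineDeriv_snd_eq (F : ℝ × ℝ → ℝ) (s t : ℝ) :
    lineDeriv ℝ F (s, t) (0, 1) = deriv (fun t => F (s, t)) t := by
  have := deriv_comp_const_add (fun t => F (s, t)) t 0
  simp only [add_zero] at this
  rw [← this]
  simp [lineDeriv]

/-- The Poincaré inequality on a rectangle with sides at most `ℓ`. The mean value is replaced by the
value at a suitable point: one is chosen on a vertical line of at most average energy. -/
lemma poincare_rectangle {U : Set (ℝ × ℝ)} (hU : IsOpen U) {f : ℝ × ℝ → ℝ}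
    (hf : LocallyLipschitzOn U f) {a b c d ℓ : ℝ} (hab : a < b) (hcd : c < d)
    (hℓ : b - a ≤ ℓ) (hℓ' : d - c ≤ ℓ) (hR : Icc a b ×ˢ Icc c d ⊆ U) :
    ∃ y ∈ Icc a b ×ˢ Icc c d, ∫ z in Icc a b ×ˢ Icc c d, (f z - f y) ^ 2
      ≤ 2 * ℓ ^ 2 * ∫ z in Icc a b ×ˢ Icc c d, (dx f z ^ 2 + dy f z ^ 2) := by
  have hRc : IsCompact (Icc a b ×ˢ Icc c d) := isCompact_Icc.prod isCompact_Icc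
  obtain ⟨F, C, hF, hFc, hfF⟩ := exists_lipschitzWith_eventuallyEq hU hRc hR hf
  have hgx : ∀ t, LipschitzWith C (fun s => F (s, t)) := fun t =>
    LipschitzWith.of_dist_le_mul fun x y => by
      simpa [Prod.dist_eq] using hF.dist_le_mul (x, t) (y, t)
  have hgy : ∀ s, LipschitzWith C (fun t => F (s, t)) := fun s =>
    LipschitzWith.of_dist_le_mul fun x y => by
      simpa [Prod.dist_eq] using hF.dist_le_mul (s, x) (s, y)
  set gx : ℝ × ℝ → ℝ := fun z => lineDeriv ℝ F z (1, 0) ^ 2 with hgxd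
  set gy : ℝ × ℝ → ℝ := fun z => lineDeriv ℝ F z (0, 1) ^ 2 with hgyd
  set μ := (volume : Measure ℝ).restrict (Icc a b) with hμ
  set ν := (volume : Measure ℝ).restrict (Icc c d) with hν
  have fμ : IsFiniteMeasure μ := isFiniteMeasure_restrict.2 isCompact_Icc.measure_lt_top.ne
  have fν : IsFiniteMeasure ν := isFiniteMeasure_restrict.2 isCompact_Icc.measure_lt_top.ne
  have hprod : (volume : Measure (ℝ × ℝ)).restrict (Icc a b ×ˢ Icc c d) = μ.prod ν := by
    rw [hμ, hν, Measure.prod_restrict, Measure.volume_eq_prod]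
  have bd : ∀ z v, ‖lineDeriv ℝ F z v ^ 2‖ ≤ (C * ‖v‖) ^ 2 := fun z v => by
    rw [norm_pow]
    exact pow_le_pow_left₀ (norm_nonneg _) (norm_lineDeriv_le_of_lipschitz ℝ hF) 2
  have igx : Integrable gx (μ.prod ν) :=
    Integrable.of_bound ((measurable_lineDeriv hF.continuous).pow_const 2).aestronglyMeasurable
      _ (Eventually.of_forall fun z => bd z _)
  have igy : Integrable gy (μ.prod ν) :=
    Integrable.of_bound ((measurable_lineDeriv hF.continuous).pow_const 2).aestronglyMeasurable
      _ (Eventually.of_forall fun z => bd z _)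
  set h : ℝ → ℝ := fun t => ∫ s, gx (s, t) ∂μ with hh
  set k : ℝ → ℝ := fun s => ∫ t, gy (s, t) ∂ν with hk
  have ih : Integrable h ν := igx.integral_prod_right
  have ik : Integrable k μ := igy.integral_prod_left
  have eh : ∫ z, gx z ∂(μ.prod ν) = ∫ t, h t ∂ν := integral_prod_symm _ igx
  have ek : ∫ z, gy z ∂(μ.prod ν) = ∫ s, k s ∂μ := integral_prod _ igy
  have hvol : volume (Icc a b) ≠ 0 := by
    rw [Real.volume_Icc]; simpa using hab
  obtain ⟨x₀, hx₀, hkx⟩ := exists_le_setAverage (μ := volume) (f := k) hvol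
    isCompact_Icc.measure_lt_top.ne ik
  rw [setAverage_eq, Real.volume_real_Icc_of_le hab.le, smul_eq_mul,
    le_inv_mul_iff₀ (sub_pos.2 hab), ← hμ] at hkx
  have hcmem : c ∈ Icc c d := ⟨le_rfl, hcd.le⟩
  refine ⟨(x₀, c), ⟨hx₀, hcmem⟩, ?_⟩
  have hpt : ∀ z ∈ Icc a b ×ˢ Icc c d,
      (f z - f (x₀, c)) ^ 2 ≤ 2 * (b - a) * h z.2 + 2 * (d - c) * k x₀ := by
    rintro ⟨s, t⟩ ⟨hs, ht⟩
    rw [(hfF (s, t) ⟨hs, ht⟩).eq_of_nhds, (hfF (x₀, c) ⟨hx₀, hcmem⟩).eq_of_nhds]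
    have h1 := sq_sub_le_of_lipschitzWith (hgx t) hs hx₀
    have h2 := sq_sub_le_of_lipschitzWith (hgy x₀) ht hcmem
    have e1 : ∫ s in Icc a b, deriv (fun s => F (s, t)) s ^ 2 = h t := by
      simp only [hh, hgxd, lineDeriv_fst_eq, hμ]
    have e2 : ∫ t in Icc c d, deriv (fun t => F (x₀, t)) t ^ 2 = k x₀ := by
      simp only [hk, hgyd, lineDeriv_snd_eq, hν]
    rw [e1] at h1
    rw [e2] at h2
    simp only at h1 h2 ⊢
    nlinarith [sq_nonneg (F (s, t) - F (x₀, t) - (F (x₀, t) - F (x₀, c)))]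
  have ex : ∫ z, gx z ∂(μ.prod ν) = ∫ z in Icc a b ×ˢ Icc c d, dx f z ^ 2 := by
    rw [← hprod]
    refine setIntegral_congr_ae hRc.measurableSet ?_
    filter_upwards [lineDeriv_ae_eq hF (1, 0)] with z hz hzR
    simp only [hgxd, dx, hz, (hfF z hzR).fderiv_eq]
  have ey : ∫ z, gy z ∂(μ.prod ν) = ∫ z in Icc a b ×ˢ Icc c d, dy f z ^ 2 := by
    rw [← hprod]
    refine setIntegral_congr_ae hRc.measurableSet ?_
    filter_upwards [lineDeriv_ae_eq hF (0, 1)] with z hz hzR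
    simp only [hgyd, dy, hz, (hfF z hzR).fderiv_eq]
  have lf := locBdd_of_locallyLipschitzOn hf
  have i1 : Integrable (fun z : ℝ × ℝ => 2 * (b - a) * h z.2) (μ.prod ν) :=
    (ih.comp_snd μ).const_mul _
  have hμr : μ.real univ = b - a := by
    rw [hμ, measureReal_restrict_apply_univ, Real.volume_real_Icc_of_le hab.le]
  have hνr : ν.real univ = d - c := by
    rw [hν, measureReal_restrict_apply_univ, Real.volume_real_Icc_of_le hcd.le]
  calc ∫ z in Icc a b ×ˢ Icc c d, (f z - f (x₀, c)) ^ 2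
      ≤ ∫ z in Icc a b ×ˢ Icc c d, (2 * (b - a) * h z.2 + 2 * (d - c) * k x₀) := by
        refine setIntegral_mono_on ?_ ?_ hRc.measurableSet hpt
        · exact (lf.sub (LocBdd.const _)).sq.integrableOn hRc hR
        · rw [IntegrableOn, hprod]; exact i1.add (integrable_const _)
    _ = 2 * (b - a) ^ 2 * (∫ z, gx z ∂(μ.prod ν))
          + 2 * (d - c) ^ 2 * ((b - a) * k x₀) := by
        rw [hprod, integral_add i1 (integrable_const _), integral_const_mul,
          integral_fun_snd (μ := μ) (ν := ν) h, integral_const, ← eh, ← univ_prod_univ,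
          measureReal_prod_prod, hμr, hνr]
        simp only [smul_eq_mul]
        ring
    _ ≤ 2 * ℓ ^ 2 * (∫ z, gx z ∂(μ.prod ν)) + 2 * ℓ ^ 2 * (∫ z, gy z ∂(μ.prod ν)) := by
        have n1 : 0 ≤ ∫ z, gx z ∂(μ.prod ν) := integral_nonneg fun _ => sq_nonneg _
        have n2 : 0 ≤ ∫ z, gy z ∂(μ.prod ν) := integral_nonneg fun _ => sq_nonneg _
        have s1 : (b - a) ^ 2 ≤ ℓ ^ 2 := pow_le_pow_left₀ (sub_pos.2 hab).le hℓ 2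
        have s2 : (d - c) ^ 2 ≤ ℓ ^ 2 := pow_le_pow_left₀ (sub_pos.2 hcd).le hℓ' 2
        rw [← ek] at hkx
        have t1 : 2 * (d - c) ^ 2 * ((b - a) * k x₀) ≤ 2 * (d - c) ^ 2 * ∫ z, gy z ∂(μ.prod ν) := by
          gcongr
        have t2 : 2 * (d - c) ^ 2 * (∫ z, gy z ∂(μ.prod ν))
            ≤ 2 * ℓ ^ 2 * ∫ z, gy z ∂(μ.prod ν) := by gcongr
        have t3 : 2 * (b - a) ^ 2 * (∫ z, gx z ∂(μ.prod ν))
            ≤ 2 * ℓ ^ 2 * ∫ z, gx z ∂(μ.prod ν) := by gcongr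
        linarith
    _ = _ := by
        rw [ex, ey, ← mul_add, ← integral_add]
        · exact (locBdd_dx hU hf).sq.integrableOn hRc hR
        · exact (locBdd_dy hU hf).sq.integrableOn hRc hR

section Constants

variable {U S T : Set (ℝ × ℝ)} {f : ℝ × ℝ → ℝ}

lemma sq_sub_mul_volume_le (hf : LocBdd U f) (hS : IsCompact S) (hSU : S ⊆ U) (c c' : ℝ) :
    (c - c') ^ 2 * volume.real S
      ≤ 2 * (∫ z in S, (f z - c) ^ 2) + 2 * ∫ z in S, (f z - c') ^ 2 := by
  have i : ∀ c, IntegrableOn (fun z => 2 * (f z - c) ^ 2) S := fun c =>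
    ((LocBdd.const 2).mul (hf.sub (LocBdd.const c)).sq).integrableOn hS hSU
  rw [← integral_const_mul, ← integral_const_mul, ← integral_add (i c) (i c')]
  calc _ = ∫ z in S, (c - c') ^ 2 := by rw [setIntegral_const, smul_eq_mul, mul_comm]
    _ ≤ _ := by
      refine setIntegral_mono_on (integrableOn_const hS.measure_lt_top.ne) ((i c).add (i c'))
        hS.measurableSet fun z _ => ?_
      nlinarith [sq_nonneg ((f z - c) + (f z - c'))]

lemma setIntegral_sq_sub_le (hf : LocBdd U f) (hS : IsCompact S) (hSU : S ⊆ U) (c c' : ℝ) :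
    ∫ z in S, (f z - c') ^ 2
      ≤ 2 * (∫ z in S, (f z - c) ^ 2) + 2 * ((c - c') ^ 2 * volume.real S) := by
  have i : ∀ a c, IntegrableOn (fun z => a * (f z - c) ^ 2) S := fun a c =>
    ((LocBdd.const a).mul (hf.sub (LocBdd.const c)).sq).integrableOn hS hSU
  have e : 2 * ((c - c') ^ 2 * volume.real S) = ∫ z in S, 2 * (c - c') ^ 2 := by
    rw [setIntegral_const, smul_eq_mul]; ring
  rw [e, ← integral_const_mul, ← integral_add (i 2 c) (integrableOn_const hS.measure_lt_top.ne)]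
  refine setIntegral_mono_on (by simpa using i 1 c') ((i 2 c).add
    (integrableOn_const hS.measure_lt_top.ne)) hS.measurableSet fun z _ => ?_
  nlinarith [sq_nonneg ((f z - c) - (c - c'))]

lemma setIntegral_mono_of_subset (hf : LocBdd U f) (h0 : ∀ z, 0 ≤ f z) (hT : IsCompact T)
    (hTU : T ⊆ U) (hST : S ⊆ T) : ∫ z in S, f z ≤ ∫ z in T, f z :=
  setIntegral_mono_set (hf.integrableOn hT hTU) (Eventually.of_forall h0)
    (LE.le.eventuallyLE hST)

lemma setIntegral_union_le (hf : LocBdd U f) (h0 : ∀ z, 0 ≤ f z) (hS : IsCompact S)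
    (hSU : S ⊆ U) (hT : IsCompact T) (hTU : T ⊆ U) :
    ∫ z in S ∪ T, f z ≤ (∫ z in S, f z) + ∫ z in T, f z := by
  rw [← union_sdiff_self, setIntegral_union disjoint_sdiff_right
    (hT.measurableSet.diff hS.measurableSet) (hf.integrableOn hS hSU)
    ((hf.integrableOn hT hTU).mono_set sdiff_subset)]
  exact add_le_add le_rfl (setIntegral_mono_of_subset hf h0 hT hTU sdiff_subset)

end Constants

lemma LocBdd.gradSq {U : Set (ℝ × ℝ)} (hU : IsOpen U) {f : ℝ × ℝ → ℝ}
    (hf : LocallyLipschitzOn U f) : LocBdd U (fun z => dx f z ^ 2 + dy f z ^ 2) :=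
  (locBdd_dx hU hf).sq.add (locBdd_dy hU hf).sq

lemma poincare_square {U : Set (ℝ × ℝ)} (hU : IsOpen U) {f : ℝ × ℝ → ℝ}
    (hf : LocallyLipschitzOn U f) {x₀ : ℝ × ℝ} {r : ℝ} (hr : 0 < r) (hB : closedBall x₀ r ⊆ U) :
    ∃ y ∈ closedBall x₀ r, ∫ z in closedBall x₀ r, (f z - f y) ^ 2
      ≤ 8 * r ^ 2 * ∫ z in closedBall x₀ r, (dx f z ^ 2 + dy f z ^ 2) := by
  rw [closedBall_eq_prod] at hB ⊢
  obtain ⟨y, hy, h⟩ := poincare_rectangle hU hf (ℓ := 2 * r) (by linarith) (by linarith)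
    (by linarith) (by linarith) hB
  exact ⟨y, hy, h.trans (le_of_eq (by ring))⟩

/-- The Poincaré inequality on a square annulus of ratio between two and four, from the inequality
on the four overlapping rectangles that make it up. -/
lemma poincare_ann {U : Set (ℝ × ℝ)} (hU : IsOpen U) {f : ℝ × ℝ → ℝ}
    (hf : LocallyLipschitzOn U f) {x₀ : ℝ × ℝ} {r : ℝ} {s : ℝ} (hr : 0 < r) (hrs : 2 * r ≤ s)
    (hs : s ≤ 4 * r) (hA : ann x₀ r s ⊆ U) :
    ∃ c, ∫ z in ann x₀ r s, (f z - c) ^ 2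
      ≤ 153600 * r ^ 2 * ∫ z in ann x₀ r s, (dx f z ^ 2 + dy f z ^ 2) := by
  obtain ⟨x, y⟩ := x₀
  have lf := locBdd_of_locallyLipschitzOn hf
  have lg := LocBdd.gradSq hU hf
  have mem : ∀ z : ℝ × ℝ, z ∈ ann (x, y) r s ↔
      (r ≤ |z.1 - x| ∨ r ≤ |z.2 - y|) ∧ |z.1 - x| ≤ s ∧ |z.2 - y| ≤ s := fun z => by
    simp [ann, Prod.norm_def]
  set R₁ := Icc (x - s) (x + s) ×ˢ Icc (y - s) (y - r) with hR₁
  set R₂ := Icc (x + r) (x + s) ×ˢ Icc (y - s) (y + s) with hR₂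
  set R₃ := Icc (x - s) (x + s) ×ˢ Icc (y + r) (y + s) with hR₃
  set R₄ := Icc (x - s) (x - r) ×ˢ Icc (y - s) (y + s) with hR₄
  set A := ann (x, y) r s with hAdef
  have s₁ : R₁ ⊆ A := by
    rintro ⟨a, b⟩ ⟨⟨h1, h2⟩, h3, h4⟩
    simp only at h1 h2 h3 h4
    exact (mem _).2 ⟨Or.inr (le_abs.2 (Or.inr (by simp only; linarith))),
      abs_le.2 ⟨by simp only; linarith, by simp only; linarith⟩,
      abs_le.2 ⟨by simp only; linarith, by simp only; linarith⟩⟩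
  have s₂ : R₂ ⊆ A := by
    rintro ⟨a, b⟩ ⟨⟨h1, h2⟩, h3, h4⟩
    simp only at h1 h2 h3 h4
    exact (mem _).2 ⟨Or.inl (le_abs.2 (Or.inl (by simp only; linarith))),
      abs_le.2 ⟨by simp only; linarith, by simp only; linarith⟩,
      abs_le.2 ⟨by simp only; linarith, by simp only; linarith⟩⟩
  have s₃ : R₃ ⊆ A := by
    rintro ⟨a, b⟩ ⟨⟨h1, h2⟩, h3, h4⟩
    simp only at h1 h2 h3 h4
    exact (mem _).2 ⟨Or.inr (le_abs.2 (Or.inl (by simp only; linarith))),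
      abs_le.2 ⟨by simp only; linarith, by simp only; linarith⟩,
      abs_le.2 ⟨by simp only; linarith, by simp only; linarith⟩⟩
  have s₄ : R₄ ⊆ A := by
    rintro ⟨a, b⟩ ⟨⟨h1, h2⟩, h3, h4⟩
    simp only at h1 h2 h3 h4
    exact (mem _).2 ⟨Or.inl (le_abs.2 (Or.inr (by simp only; linarith))),
      abs_le.2 ⟨by simp only; linarith, by simp only; linarith⟩,
      abs_le.2 ⟨by simp only; linarith, by simp only; linarith⟩⟩
  have cover : A ⊆ (R₁ ∪ R₂) ∪ (R₃ ∪ R₄) := by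
    rintro ⟨a, b⟩ hz
    obtain ⟨h | h, h2, h3⟩ := (mem _).1 hz
    all_goals
      simp only at h h2 h3
      rw [abs_le] at h2 h3
      rw [le_abs] at h
    · rcases h with h | h
      · exact Or.inl (Or.inr ⟨⟨by simp only; linarith, by simp only; linarith⟩,
          by simp only; linarith, by simp only; linarith⟩)
      · exact Or.inr (Or.inr ⟨⟨by simp only; linarith, by simp only; linarith⟩,
          by simp only; linarith, by simp only; linarith⟩)
    · rcases h with h | h
      · exact Or.inr (Or.inl ⟨⟨by simp only; linarith, by simp only; linarith⟩,
          by simp only; linarith, by simp only; linarith⟩)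
      · exact Or.inl (Or.inl ⟨⟨by simp only; linarith, by simp only; linarith⟩,
          by simp only; linarith, by simp only; linarith⟩)
  set E := ∫ z in A, (dx f z ^ 2 + dy f z ^ 2) with hE
  have hAc : IsCompact A := isCompact_ann _ _ _
  have k : ∀ a b c d : ℝ, IsCompact (Icc a b ×ˢ Icc c d) := fun a b c d =>
    isCompact_Icc.prod isCompact_Icc
  have vol : ∀ {a b c d : ℝ}, a ≤ b → c ≤ d →
      volume.real (Icc a b ×ˢ Icc c d) = (b - a) * (d - c) := fun h h' => by
    rw [Measure.volume_eq_prod, measureReal_prod_prod, Real.volume_real_Icc_of_le h,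
      Real.volume_real_Icc_of_le h']
  have P : ∀ {a b c d : ℝ}, a < b → c < d → b - a ≤ 8 * r → d - c ≤ 8 * r →
      Icc a b ×ˢ Icc c d ⊆ A →
      ∃ m, ∫ z in Icc a b ×ˢ Icc c d, (f z - m) ^ 2 ≤ 128 * r ^ 2 * E := by
    intro a b c d h1 h2 h3 h4 h5
    obtain ⟨w, -, hw⟩ := poincare_rectangle hU hf h1 h2 h3 h4 (h5.trans hA)
    refine ⟨f w, hw.trans ?_⟩
    have := setIntegral_mono_of_subset lg (fun z => by positivity) hAc hA h5
    calc _ ≤ 2 * (8 * r) ^ 2 * E := by gcongr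
      _ = _ := by ring
  obtain ⟨c₁, h₁⟩ := P (by linarith) (by linarith) (by linarith) (by linarith) s₁
  obtain ⟨c₂, h₂⟩ := P (by linarith) (by linarith) (by linarith) (by linarith) s₂
  obtain ⟨c₃, h₃⟩ := P (by linarith) (by linarith) (by linarith) (by linarith) s₃
  obtain ⟨c₄, h₄⟩ := P (by linarith) (by linarith) (by linarith) (by linarith) s₄
  set e := 128 * r ^ 2 * E with he
  have he0 : 0 ≤ e := by
    have : 0 ≤ E := integral_nonneg fun z => by positivity
    positivity
  -- two rectangles that share a square of side `r` have comparable constants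
  have D : ∀ {S T : Set (ℝ × ℝ)} {m n a b : ℝ}, IsCompact S → IsCompact T → S ⊆ A → T ⊆ A →
      Icc a (a + r) ×ˢ Icc b (b + r) ⊆ S → Icc a (a + r) ×ˢ Icc b (b + r) ⊆ T →
      ∫ z in S, (f z - m) ^ 2 ≤ e → ∫ z in T, (f z - n) ^ 2 ≤ e → (m - n) ^ 2 * r ^ 2 ≤ 4 * e := by
    intro S T m n a b hS hT hSA hTA hQS hQT h1 h2
    have h := sq_sub_mul_volume_le lf (k a (a + r) b (b + r)) (hQS.trans (hSA.trans hA)) m n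
    have e1 := setIntegral_mono_of_subset (lf.sub (LocBdd.const m)).sq (fun z => sq_nonneg _) hS
      (hSA.trans hA) hQS
    have e2 := setIntegral_mono_of_subset (lf.sub (LocBdd.const n)).sq (fun z => sq_nonneg _) hT
      (hTA.trans hA) hQT
    rw [vol (by linarith) (by linarith)] at h
    have : (m - n) ^ 2 * ((a + r - a) * (b + r - b)) = (m - n) ^ 2 * r ^ 2 := by ring
    linarith
  have d₁₂ := D (a := x + r) (b := y - s) (k _ _ _ _) (k _ _ _ _) s₁ s₂
    (prod_mono (Icc_subset_Icc (by linarith) (by linarith))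
      (Icc_subset_Icc (by linarith) (by linarith)))
    (prod_mono (Icc_subset_Icc (by linarith) (by linarith))
      (Icc_subset_Icc (by linarith) (by linarith))) h₁ h₂
  have d₂₃ := D (a := x + r) (b := y + r) (k _ _ _ _) (k _ _ _ _) s₂ s₃
    (prod_mono (Icc_subset_Icc (by linarith) (by linarith))
      (Icc_subset_Icc (by linarith) (by linarith)))
    (prod_mono (Icc_subset_Icc (by linarith) (by linarith))
      (Icc_subset_Icc (by linarith) (by linarith))) h₂ h₃
  have d₁₄ := D (a := x - s) (b := y - s) (k _ _ _ _) (k _ _ _ _) s₁ s₄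
    (prod_mono (Icc_subset_Icc (by linarith) (by linarith))
      (Icc_subset_Icc (by linarith) (by linarith)))
    (prod_mono (Icc_subset_Icc (by linarith) (by linarith))
      (Icc_subset_Icc (by linarith) (by linarith))) h₁ h₄
  have d₁₃ : (c₁ - c₃) ^ 2 * r ^ 2 ≤ 16 * e := by
    have : (c₁ - c₃) ^ 2 * r ^ 2 ≤ 2 * ((c₁ - c₂) ^ 2 * r ^ 2) + 2 * ((c₂ - c₃) ^ 2 * r ^ 2) := by
      nlinarith [mul_nonneg (sq_nonneg ((c₁ - c₂) - (c₂ - c₃))) (sq_nonneg r)]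
    linarith
  have v₂ := setIntegral_sq_sub_le lf (k _ _ _ _) (s₂.trans hA) c₂ c₁
  have v₃ := setIntegral_sq_sub_le lf (k _ _ _ _) (s₃.trans hA) c₃ c₁
  have v₄ := setIntegral_sq_sub_le lf (k _ _ _ _) (s₄.trans hA) c₄ c₁
  rw [vol (by linarith) (by linarith)] at v₂ v₃ v₄
  have lc := (lf.sub (LocBdd.const c₁)).sq
  have n0 : ∀ z, 0 ≤ (f z - c₁) ^ 2 := fun z => sq_nonneg _
  have u12 := setIntegral_union_le lc n0 (k _ _ _ _) (s₁.trans hA) (k _ _ _ _) (s₂.trans hA)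
  have u34 := setIntegral_union_le lc n0 (k _ _ _ _) (s₃.trans hA) (k _ _ _ _) (s₄.trans hA)
  have u := setIntegral_union_le lc n0 ((k _ _ _ _).union (k _ _ _ _))
    (union_subset (s₁.trans hA) (s₂.trans hA)) ((k _ _ _ _).union (k _ _ _ _))
    (union_subset (s₃.trans hA) (s₄.trans hA))
  have uA := setIntegral_mono_of_subset lc n0
    (((k _ _ _ _).union (k _ _ _ _)).union ((k _ _ _ _).union (k _ _ _ _)))
    (union_subset (union_subset (s₁.trans hA) (s₂.trans hA))
      (union_subset (s₃.trans hA) (s₄.trans hA))) cover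
  refine ⟨c₁, uA.trans (u.trans ?_)⟩
  have hfin : 153600 * r ^ 2 * E = 1200 * e := by rw [he]; ring
  rw [hfin]
  have area : (s - r) * (2 * s) ≤ 24 * r ^ 2 := by nlinarith
  have w : ∀ {c a : ℝ}, (c₁ - c) ^ 2 * r ^ 2 ≤ a →
      (c - c₁) ^ 2 * ((s - r) * (2 * s)) ≤ 24 * a := by
    intro c a h
    have := mul_le_mul_of_nonneg_left area (sq_nonneg (c - c₁))
    nlinarith
  have w₂ : (c₂ - c₁) ^ 2 * ((x + s - (x + r)) * (y + s - (y - s))) ≤ 24 * (4 * e) := by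
    convert w d₁₂ using 2; ring
  have w₃ : (c₃ - c₁) ^ 2 * ((x + s - (x - s)) * (y + s - (y + r))) ≤ 24 * (16 * e) := by
    convert w d₁₃ using 2; ring
  have w₄ : (c₄ - c₁) ^ 2 * ((x - r - (x - s)) * (y + s - (y - s))) ≤ 24 * (4 * e) := by
    convert w d₁₄ using 2; ring
  linarith

/-! ### Interior decay of the energy and Hölder continuity -/

/-- The constant in the hole-filling inequality `∫_{B_r} ≤ Γ ∫_{B_{2r} \ B_r}` for the energy. -/
noncomputable def holeConst (K : ℝ) : ℝ := 153601 * K + 1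

/-- The square root of the factor by which the energy on a square decays when the side is halved.
It is at least `1/2`, so that the Hölder exponent it gives is less than one. -/
noncomputable def rate (K : ℝ) : ℝ := √(holeConst K / (1 + holeConst K))

section rate

variable {K : ℝ}

lemma holeConst_ge_one (hK : 0 < K) : 1 ≤ holeConst K := by unfold holeConst; linarith

lemma rate_sq (hK : 0 < K) : rate K ^ 2 = holeConst K / (1 + holeConst K) := by
  have := holeConst_ge_one hK
  exact Real.sq_sqrt (by positivity)

lemma rate_pos (hK : 0 < K) : 0 < rate K := by
  have := holeConst_ge_one hK
  exact Real.sqrt_pos.2 (by positivity)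

lemma rate_lt_one (hK : 0 < K) : rate K < 1 := by
  have := holeConst_ge_one hK
  have h : rate K ^ 2 < 1 := by
    rw [rate_sq hK, div_lt_one (by positivity)]; linarith
  nlinarith [rate_pos hK]

lemma half_lt_rate (hK : 0 < K) : 1 / 2 < rate K := by
  have h1 := holeConst_ge_one hK
  have h : 1 / 2 ≤ rate K ^ 2 := by
    rw [rate_sq hK, le_div_iff₀ (by positivity)]; linarith
  nlinarith [rate_pos hK]

lemma le_rate_sq_mul (hK : 0 < K) {x y : ℝ} (h : x ≤ holeConst K * (y - x)) :
    x ≤ rate K ^ 2 * y := by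
  have h1 := holeConst_ge_one hK
  rw [rate_sq hK, div_mul_eq_mul_div, le_div_iff₀ (by positivity)]
  linarith

/-- The Hölder exponent: halving a length multiplies its `α`-th power by `rate K`. -/
lemma exists_exponent (hK : 0 < K) : ∃ α : ℝ, 0 < α ∧ α < 1 ∧ (1 / 2 : ℝ) ^ α = rate K := by
  have hl : Real.log (1 / 2) < 0 := Real.log_neg (by norm_num) (by norm_num)
  have hs := rate_pos hK
  refine ⟨Real.log (rate K) / Real.log (1 / 2), ?_, ?_, ?_⟩
  · exact div_pos_of_neg_of_neg (Real.log_neg hs (rate_lt_one hK)) hl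
  · rw [div_lt_one_of_neg hl]
    exact Real.log_lt_log (by norm_num) (half_lt_rate hK)
  · rw [Real.rpow_def_of_pos (by norm_num), mul_div_cancel₀ _ hl.ne, Real.exp_log hs]

end rate

/-- The constant of the pointwise estimate `abs_sub_le_of_energy`. -/
noncomputable def pointConst (K : ℝ) : ℝ := 7 / (1 - rate K)

namespace QuasiregularOn

variable {U : Set (ℝ × ℝ)} {K : ℝ} {p q f : ℝ × ℝ → ℝ}

lemma gradSq_fst_le (p q : ℝ × ℝ → ℝ) (z : ℝ × ℝ) : dx p z ^ 2 + dy p z ^ 2 ≤ energy p q z := by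
  unfold energy
  nlinarith [sq_nonneg (dx q z), sq_nonneg (dy q z)]

lemma gradSq_snd_le (p q : ℝ × ℝ → ℝ) (z : ℝ × ℝ) : dx q z ^ 2 + dy q z ^ 2 ≤ energy p q z := by
  unfold energy
  nlinarith [sq_nonneg (dx p z), sq_nonneg (dy p z)]

lemma setIntegral_gradSq_le (h : QuasiregularOn U K p q) (hf : LocallyLipschitzOn U f)
    (hfE : ∀ z, dx f z ^ 2 + dy f z ^ 2 ≤ energy p q z) {S : Set (ℝ × ℝ)} (hS : IsCompact S)
    (hSU : S ⊆ U) : ∫ z in S, (dx f z ^ 2 + dy f z ^ 2) ≤ ∫ z in S, energy p q z :=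
  setIntegral_mono ((LocBdd.gradSq h.isOpen hf).integrableOn hS hSU)
    (h.locBdd_energy.integrableOn hS hSU) hfE

/-- Hole filling: Caccioppoli's inequality with a cutoff between `B_r` and `B_{2r}` and Poincaré's
inequality on the annulus `B_{2r} \ B_r` bound the energy on `B_r` by that on the annulus. -/
lemma energy_halve (h : QuasiregularOn U K p q) {x : ℝ × ℝ} {r : ℝ} (hr : 0 < r)
    (hB : closedBall x (2 * r) ⊆ U) :
    ∫ z in closedBall x r, energy p q z
      ≤ rate K ^ 2 * ∫ z in closedBall x (2 * r), energy p q z := by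
  refine le_rate_sq_mul h.pos ?_
  have hlt : r < 2 * r := by linarith
  have hAU : ann x r (2 * r) ⊆ U := (ann_subset_closedBall _ _ _).trans hB
  have hlip := lipschitzWith_cutoff x hlt
  have htU : tsupport (cutoff x r (2 * r)) ⊆ U :=
    (tsupport_cutoff_subset x hlt).trans ((ann_subset_closedBall _ _ _).trans hB)
  obtain ⟨c, hc⟩ := poincare_ann h.isOpen h.lip_fst (x₀ := x) (s := 2 * r) hr le_rfl
    (by linarith) hAU
  have hcac := h.caccioppoli hlip (hasCompactSupport_cutoff x hlt) htU
    (cutoff_nonneg x r (2 * r)) c (isCompact_ann x r (2 * r)) isCompact_empty hAU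
    (empty_subset U) (M₁ := (2 * r - r)⁻¹) (M₂ := 0) one_pos one_pos
    (fun z _ => abs_dx_dy_le_of_lipschitzWith (inv_nonneg.2 (by linarith)) hlip z)
    (fun z hz => absurd hz (notMem_empty z)) (fun z hz _ => dx_dy_cutoff_eq_zero hlt hz)
  have hB' : closedBall x r ⊆ U := (closedBall_subset_closedBall hlt.le).trans hB
  have iE : IntegrableOn (energy p q) (ann x 0 (2 * r)) := by
    rw [ann_zero]; exact h.locBdd_energy.integrableOn (isCompact_closedBall _ _) hB
  have hadd := setIntegral_ann_add (x₀ := x) hr.le hlt.le iE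
  rw [ann_zero, ann_zero] at hadd
  have hlow : ∫ z in closedBall x r, energy p q z
      ≤ ∫ z, cutoff x r (2 * r) z * energy p q z :=
    setIntegral_le_integral_mul h.locBdd_energy (energy_nonneg p q) hlip
      (hasCompactSupport_cutoff x hlt) htU (cutoff_nonneg x r (2 * r))
      (isCompact_closedBall x r) hB' fun z hz =>
        cutoff_eq_one hlt (by simpa [dist_eq_norm] using hz)
  have hgr := h.setIntegral_gradSq_le h.lip_fst (gradSq_fst_le p q) (isCompact_ann x r (2 * r)) hAU
  have hr2 : (2 * r - r)⁻¹ ^ 2 * (∫ z in ann x r (2 * r), (p z - c) ^ 2)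
      ≤ 153600 * ∫ z in ann x r (2 * r), energy p q z := by
    have e : 2 * r - r = r := by ring
    rw [e, inv_pow, inv_mul_le_iff₀ (by positivity)]
    refine hc.trans ?_
    calc _ ≤ 153600 * r ^ 2 * ∫ z in ann x r (2 * r), energy p q z := by gcongr
      _ = _ := by ring
  have hE0 : 0 ≤ ∫ z in ann x r (2 * r), energy p q z := integral_nonneg (energy_nonneg p q)
  have hsub : (∫ z in closedBall x (2 * r), energy p q z) - ∫ z in closedBall x r, energy p q z
      = ∫ z in ann x r (2 * r), energy p q z := by linarith
  rw [hsub]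
  refine hlow.trans (hcac.trans ?_)
  simp only [one_mul, inv_one, Measure.restrict_empty, integral_zero_measure, mul_zero, add_zero]
  have hK := h.pos
  unfold holeConst
  nlinarith [mul_le_mul_of_nonneg_left hr2 hK.le]

lemma energy_le_pow (h : QuasiregularOn U K p q) {x : ℝ × ℝ} {r E : ℝ} (hr : 0 < r)
    (hB : closedBall x r ⊆ U) (hE : ∫ z in closedBall x r, energy p q z ≤ E ^ 2) (k : ℕ) :
    ∫ z in closedBall x (r / 2 ^ k), energy p q z ≤ (rate K ^ k * E) ^ 2 := by
  induction k with
  | zero => simpa using hE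
  | succ k ih =>
    have e : 2 * (r / 2 ^ (k + 1)) = r / 2 ^ k := by rw [pow_succ]; field_simp
    have hle : r / 2 ^ k ≤ r := div_le_self hr.le (one_le_pow₀ (by norm_num))
    have h1 := h.energy_halve (x := x) (r := r / 2 ^ (k + 1)) (by positivity)
      (by rw [e]; exact (closedBall_subset_closedBall hle).trans hB)
    rw [e] at h1
    calc _ ≤ rate K ^ 2 * (rate K ^ k * E) ^ 2 := h1.trans (by gcongr)
      _ = _ := by rw [pow_succ]; ring

/-- A component of `(p, q)` at the centre of a square differs from a constant `c` by at most the
energy norm on the square plus the mean deviation from `c`. The values chosen by the Poincaré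
inequality on the concentric dyadic squares form a geometric series, since the energy decays. -/
lemma abs_sub_le_of_energy (h : QuasiregularOn U K p q) (hf : LocallyLipschitzOn U f)
    (hfE : ∀ z, dx f z ^ 2 + dy f z ^ 2 ≤ energy p q z) {x : ℝ × ℝ} {r E V c : ℝ} (hr : 0 < r)
    (hE0 : 0 ≤ E) (hV0 : 0 ≤ V) (hB : closedBall x r ⊆ U)
    (hE : ∫ z in closedBall x r, energy p q z ≤ E ^ 2)
    (hV : ∫ z in closedBall x r, (f z - c) ^ 2 ≤ V ^ 2 * r ^ 2) :
    |f x - c| ≤ pointConst K * (E + V) := by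
  have hK := h.pos
  have lf := locBdd_of_locallyLipschitzOn hf
  have hs0 := rate_pos hK
  have hs1 := rate_lt_one hK
  have hrk : ∀ k : ℕ, 0 < r / 2 ^ k := fun k => by positivity
  have hBk : ∀ k : ℕ, closedBall x (r / 2 ^ k) ⊆ U := fun k =>
    (closedBall_subset_closedBall (div_le_self hr.le (one_le_pow₀ (by norm_num)))).trans hB
  have hP : ∀ k : ℕ, ∃ y ∈ closedBall x (r / 2 ^ k),
      ∫ z in closedBall x (r / 2 ^ k), (f z - f y) ^ 2
        ≤ 8 * (r / 2 ^ k) ^ 2 * (rate K ^ k * E) ^ 2 := fun k => by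
    obtain ⟨y, hy, hyi⟩ := poincare_square h.isOpen hf (hrk k) (hBk k)
    refine ⟨y, hy, hyi.trans ?_⟩
    have := (h.setIntegral_gradSq_le hf hfE (isCompact_closedBall x _) (hBk k)).trans
      (h.energy_le_pow hr hB hE k)
    gcongr
  choose y hy hyi using hP
  have hstep : ∀ k, dist (f (y k)) (f (y (k + 1))) ≤ 5 * E * rate K ^ k := fun k => by
    have hsub : closedBall x (r / 2 ^ (k + 1)) ⊆ closedBall x (r / 2 ^ k) := by
      refine closedBall_subset_closedBall ?_
      gcongr
      · norm_num
      · omega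
    have h1 := sq_sub_mul_volume_le lf (isCompact_closedBall x (r / 2 ^ (k + 1))) (hBk (k + 1))
      (f (y k)) (f (y (k + 1)))
    rw [volume_real_closedBall x (hrk (k + 1)).le] at h1
    have h2 := (setIntegral_mono_of_subset (lf.sub (LocBdd.const (f (y k)))).sq
      (fun z => sq_nonneg _) (isCompact_closedBall x (r / 2 ^ k)) (hBk k) hsub).trans (hyi k)
    have h3 := hyi (k + 1)
    have e : r / 2 ^ k = 2 * (r / 2 ^ (k + 1)) := by rw [pow_succ]; field_simp
    rw [e] at h2
    set ρ := r / 2 ^ (k + 1) with hρ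
    have hρ0 : 0 < ρ := hrk (k + 1)
    have h4 : (rate K ^ (k + 1) * E) ^ 2 ≤ (rate K ^ k * E) ^ 2 := by
      have : rate K ^ (k + 1) ≤ rate K ^ k := pow_le_pow_of_le_one hs0.le hs1.le (by omega)
      gcongr
    have h5 : 8 * ρ ^ 2 * (rate K ^ (k + 1) * E) ^ 2 ≤ 8 * ρ ^ 2 * (rate K ^ k * E) ^ 2 := by
      gcongr
    have h6 : (4 * ρ ^ 2) * (f (y k) - f (y (k + 1))) ^ 2
        ≤ (4 * ρ ^ 2) * (5 * E * rate K ^ k) ^ 2 := by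
      have : 0 ≤ ρ ^ 2 * (rate K ^ k * E) ^ 2 := by positivity
      nlinarith
    have h7 := le_of_mul_le_mul_left h6 (by positivity)
    rw [Real.dist_eq]
    exact abs_le_of_sq_le_sq h7 (by positivity)
  have hlim : Tendsto (fun k => f (y k)) atTop (𝓝 (f x)) := by
    have hyx : Tendsto y atTop (𝓝 x) := by
      rw [tendsto_iff_dist_tendsto_zero]
      refine squeeze_zero (fun _ => dist_nonneg) (fun k => hy k) ?_
      have := (tendsto_pow_atTop_nhds_zero_of_lt_one (r := (1 / 2 : ℝ)) (by norm_num)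
        (by norm_num)).const_mul r
      simpa [div_eq_mul_inv] using this
    have hxU : U ∈ 𝓝 x := h.isOpen.mem_nhds (hB (mem_closedBall_self hr.le))
    exact (hf.continuousOn.continuousAt hxU).tendsto.comp hyx
  have h0 := dist_le_of_le_geometric_of_tendsto₀ (rate K) (5 * E) hs1 hstep hlim
  have h1 := sq_sub_mul_volume_le lf (isCompact_closedBall x r) hB c (f (y 0))
  have h2 := hyi 0
  simp only [pow_zero, div_one, one_mul] at h2
  rw [volume_real_closedBall x hr.le] at h1
  have h3 : (4 * r ^ 2) * (c - f (y 0)) ^ 2 ≤ (4 * r ^ 2) * (V + 2 * E) ^ 2 := by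
    have : 0 ≤ r ^ 2 * (V * E) := by positivity
    have : 0 ≤ r ^ 2 * V ^ 2 := by positivity
    nlinarith
  have h4 : |c - f (y 0)| ≤ V + 2 * E :=
    abs_le_of_sq_le_sq (le_of_mul_le_mul_left h3 (by positivity)) (by positivity)
  rw [Real.dist_eq] at h0
  have h5 : |f x - c| ≤ 5 * E / (1 - rate K) + (V + 2 * E) := by
    have : f x - c = -(f (y 0) - f x) - (c - f (y 0)) := by ring
    rw [this]
    refine (abs_sub _ _).trans ?_
    rw [abs_neg]
    linarith
  refine h5.trans ?_
  unfold pointConst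
  have hd : 0 < 1 - rate K := by linarith
  rw [div_add' _ _ _ hd.ne', div_mul_eq_mul_div]
  gcongr
  nlinarith

/-- The Hölder estimate for the components of `(p, q)` in a quarter of a square. -/
lemma abs_sub_le_rpow (h : QuasiregularOn U K p q) (hf : LocallyLipschitzOn U f)
    (hfE : ∀ z, dx f z ^ 2 + dy f z ^ 2 ≤ energy p q z) {α : ℝ} (hα0 : 0 < α) (hα1 : α < 1)
    (hα : (1 / 2 : ℝ) ^ α = rate K) {x y : ℝ × ℝ} {r E : ℝ} (hr : 0 < r) (hE0 : 0 ≤ E)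
    (hB : closedBall x r ⊆ U) (hE : ∫ z in closedBall x r, energy p q z ≤ E ^ 2)
    (hxy : ‖x - y‖ ≤ r / 4) :
    |f x - f y| ≤ 88 * pointConst K * E * (‖x - y‖ / r) ^ α := by
  have hK := h.pos
  have hs0 := rate_pos hK
  have hN : 0 < pointConst K := div_pos (by norm_num) (by linarith [rate_lt_one hK])
  have lf := locBdd_of_locallyLipschitzOn hf
  rcases eq_or_ne x y with rfl | hne
  · simp [Real.zero_rpow hα0.ne']
  have hd : 0 < ‖x - y‖ := norm_pos_iff.2 (sub_ne_zero.2 hne)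
  obtain ⟨k, hk1, hk2⟩ := exists_nat_pow_near_of_lt_one (x := 4 * ‖x - y‖ / r) (y := 1 / 2)
    (by positivity) (by rw [div_le_one hr]; linarith) (by norm_num) (by norm_num)
  have ek : r / 2 ^ k = (1 / 2) ^ k * r := by rw [one_div, inv_pow]; field_simp
  rw [div_le_iff₀ hr, ← ek] at hk2
  set ρ := r / 2 ^ k with hρ
  have hρ0 : 0 < ρ := by positivity
  set F := rate K ^ k * E with hF
  have hF0 : 0 ≤ F := by positivity
  have hρr : ρ ≤ r := div_le_self hr.le (one_le_pow₀ (by norm_num))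
  have hBx : closedBall x ρ ⊆ U := (closedBall_subset_closedBall hρr).trans hB
  have hEx : ∫ z in closedBall x ρ, energy p q z ≤ F ^ 2 := h.energy_le_pow hr hB hE k
  obtain ⟨w, -, hw⟩ := poincare_square h.isOpen hf hρ0 hBx
  have hVx : ∫ z in closedBall x ρ, (f z - f w) ^ 2 ≤ (3 * F) ^ 2 * ρ ^ 2 := by
    have h1 := (h.setIntegral_gradSq_le hf hfE (isCompact_closedBall x ρ) hBx).trans hEx
    have h2 : 8 * ρ ^ 2 * (∫ z in closedBall x ρ, (dx f z ^ 2 + dy f z ^ 2))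
        ≤ 8 * ρ ^ 2 * F ^ 2 := by gcongr
    have h3 : 0 ≤ ρ ^ 2 * F ^ 2 := by positivity
    nlinarith
  have hsub : closedBall y (ρ / 2) ⊆ closedBall x ρ := by
    refine closedBall_subset_closedBall' ?_
    rw [dist_comm, dist_eq_norm]
    linarith
  have hEy := (setIntegral_mono_of_subset h.locBdd_energy (energy_nonneg p q)
    (isCompact_closedBall x ρ) hBx hsub).trans hEx
  have hVy : ∫ z in closedBall y (ρ / 2), (f z - f w) ^ 2 ≤ (6 * F) ^ 2 * (ρ / 2) ^ 2 := by
    refine ((setIntegral_mono_of_subset (lf.sub (LocBdd.const (f w))).sq (fun z => sq_nonneg _)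
      (isCompact_closedBall x ρ) hBx hsub).trans hVx).trans (le_of_eq (by ring))
  have h1 := h.abs_sub_le_of_energy hf hfE hρ0 hF0 (by positivity) hBx hEx hVx
  have h2 := h.abs_sub_le_of_energy hf hfE (half_pos hρ0) hF0 (by positivity) (hsub.trans hBx)
    hEy hVy
  have h3 : |f x - f y| ≤ 11 * pointConst K * F := by
    have : f x - f y = (f x - f w) - (f y - f w) := by ring
    rw [this]
    refine (abs_sub _ _).trans ?_
    linarith
  have h4 : rate K ^ k ≤ 8 * (‖x - y‖ / r) ^ α := by
    have e1 : rate K ^ k = ((1 / 2 : ℝ) ^ k) ^ α := by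
      rw [← hα, ← Real.rpow_natCast, ← Real.rpow_mul (by norm_num), mul_comm,
        Real.rpow_mul (by norm_num), Real.rpow_natCast]
    have e2 : (1 / 2 : ℝ) ^ k ≤ 8 * (‖x - y‖ / r) := by
      rw [pow_succ] at hk1
      have : 4 * ‖x - y‖ / r = 4 * (‖x - y‖ / r) := by ring
      linarith
    rw [e1]
    calc _ ≤ (8 * (‖x - y‖ / r)) ^ α := Real.rpow_le_rpow (by positivity) e2 hα0.le
      _ = 8 ^ α * (‖x - y‖ / r) ^ α := Real.mul_rpow (by norm_num) (by positivity)
      _ ≤ 8 ^ (1 : ℝ) * (‖x - y‖ / r) ^ α := by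
          gcongr
          norm_num
      _ = _ := by norm_num
  calc _ ≤ 11 * pointConst K * (rate K ^ k * E) := h3
    _ ≤ 11 * pointConst K * ((8 * (‖x - y‖ / r) ^ α) * E) := by gcongr
    _ = _ := by ring

end QuasiregularOn

/-! ### Decay of the energy at infinity -/

/-- `(p, q)` is a quasiregular gradient map, with potential `v` of linear growth, on an open set
that contains the exterior of the unit square. -/
structure ExteriorGradient (U : Set (ℝ × ℝ)) (K Cb : ℝ) (p q v : ℝ × ℝ → ℝ) : Prop extends
    QuasiregularOn U K p q where
  nonneg : 0 ≤ Cb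
  mem_of_one_lt : ∀ z, 1 < ‖z‖ → z ∈ U
  lip_pot : LocallyLipschitzOn U v
  grad_pot : ∀ᵐ z, z ∈ U → dx v z = p z ∧ dy v z = q z
  growth : ∀ z ∈ U, |v z| ≤ Cb * (1 + 2 * ‖z‖)

/-- The constant in the bound for `∫ |Dv|²` on dyadic annuli. -/
noncomputable def growthConst (K Cb : ℝ) : ℝ := (16 + 256 * K ^ 2) * 49 * 16 * 36 * Cb ^ 2

/-- The bound for the energy outside the square `‖z‖ ≤ 4`. -/
noncomputable def totalConst (K Cb : ℝ) : ℝ :=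
  2 * (K * (growthConst K Cb + 512 * K ^ 2 * growthConst K Cb))

namespace ExteriorGradient

variable {U : Set (ℝ × ℝ)} {K Cb : ℝ} {p q v f : ℝ × ℝ → ℝ}

lemma ann_subset (h : ExteriorGradient U K Cb p q v) {r s : ℝ} (hr : 1 < r) : ann 0 r s ⊆ U :=
  fun z hz => h.mem_of_one_lt z (hr.trans_le (by simpa using hz.1))

lemma one_lt_two_pow {k : ℕ} (hk : 1 ≤ k) : (2 : ℝ) ≤ 2 ^ k := by
  calc (2 : ℝ) = 2 ^ 1 := by norm_num
    _ ≤ 2 ^ k := pow_le_pow_right₀ (by norm_num) hk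

lemma growthConst_nonneg (h : ExteriorGradient U K Cb p q v) : 0 ≤ growthConst K Cb := by
  have := h.nonneg
  unfold growthConst; positivity

lemma totalConst_nonneg (h : ExteriorGradient U K Cb p q v) : 0 ≤ totalConst K Cb := by
  have := h.growthConst_nonneg
  have := h.pos
  unfold totalConst; positivity

/-- Linear growth of the potential bounds the mean square of the gradient and the energy on dyadic
annuli, uniformly in the annulus. -/
lemma integral_dyadic_le (h : ExteriorGradient U K Cb p q v) {k : ℕ} (hk : 1 ≤ k) :
    ∫ z in ann 0 (2 ^ k) (2 ^ (k + 1)), (p z ^ 2 + q z ^ 2) ≤ growthConst K Cb * 4 ^ k ∧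
    ∫ z in ann 0 (2 ^ k) (2 ^ (k + 1)), energy p q z ≤ 512 * K ^ 2 * growthConst K Cb := by
  have h2 := one_lt_two_pow hk
  have h4 : (4 : ℝ) ^ k = (2 ^ k) ^ 2 := by rw [← pow_mul, mul_comm, pow_mul]; norm_num
  have hCb := h.nonneg
  rw [h4, pow_succ]
  set L : ℝ := 2 ^ k with hL
  have hr1 : 3 / 4 * L < L := by linarith
  have hr2 : L * 2 < 3 * L := by linarith
  have hcs := hasCompactSupport_ringCutoff (x₀ := 0) hr1 hr2
  have hts := tsupport_ringCutoff_subset (x₀ := 0) hr1 hr2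
  have htU : tsupport (ringCutoff 0 (3 / 4 * L) L (L * 2) (3 * L)) ⊆ U :=
    hts.trans (h.ann_subset (by linarith))
  have hlip := lipschitzWith_ringCutoff (x₀ := 0) hr1 hr2
  have hlip4 : LipschitzWith (4 / L).toNNReal (ringCutoff 0 (3 / 4 * L) L (L * 2) (3 * L)) := by
    refine hlip.weaken (max_le (Real.toNNReal_le_toNNReal ?_) (Real.toNNReal_le_toNNReal ?_))
    · rw [inv_le_comm₀ (by linarith) (by positivity), inv_div]; linarith
    · rw [inv_le_comm₀ (by linarith) (by positivity), inv_div]; linarith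
  have hM : 0 < 4 / L := by positivity
  have hvol : volume.real (tsupport (ringCutoff 0 (3 / 4 * L) L (L * 2) (3 * L)))
      ≤ 36 * L ^ 2 := by
    refine (measureReal_mono (hts.trans (ann_subset_closedBall _ _ _))
      (isCompact_closedBall _ _).measure_lt_top.ne).trans ?_
    rw [volume_real_closedBall _ (by linarith)]
    exact le_of_eq (by ring)
  obtain ⟨hB, hA⟩ := h.integral_energy_le_of_potential h.lip_pot h.grad_pot hlip4 hcs htU
    ringCutoff_nonneg hM (abs_dx_dy_le_of_lipschitzWith hM.le hlip4) (S := 7 * Cb * L)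
    (fun z hz => by
      refine (h.growth z (htU hz)).trans ?_
      have hz3 : ‖z‖ ≤ 3 * L := by simpa using (hts hz).2
      have : 1 + 2 * ‖z‖ ≤ 7 * L := by linarith
      calc _ ≤ Cb * (7 * L) := by gcongr
        _ = _ := by ring) hvol
  have hann : ann 0 L (L * 2) ⊆ U := h.ann_subset (by linarith)
  have e1 : (16 + 256 * K ^ 2) * (7 * Cb * L) ^ 2 * (4 / L) ^ 2 * (36 * L ^ 2)
      = growthConst K Cb * L ^ 2 := by unfold growthConst; field_simp; ring
  rw [e1] at hB hA
  have e2 : 32 * K ^ 2 * (4 / L) ^ 2 * (growthConst K Cb * L ^ 2)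
      = 512 * K ^ 2 * growthConst K Cb := by field_simp; ring
  rw [e2] at hA
  have lp := locBdd_of_locallyLipschitzOn h.lip_fst
  have lq := locBdd_of_locallyLipschitzOn h.lip_snd
  obtain ⟨C2, hη2⟩ := exists_lipschitzWith_mul hlip hcs hlip
  have hη2c := hcs.mul_right (f' := ringCutoff 0 (3 / 4 * L) L (L * 2) (3 * L))
  obtain ⟨C4, hη4⟩ := exists_lipschitzWith_mul hη2 hη2c hη2
  have hη2U := (tsupport_mul_subset_left (f := ringCutoff 0 (3 / 4 * L) L (L * 2) (3 * L))
    (g := ringCutoff 0 (3 / 4 * L) L (L * 2) (3 * L))).trans htU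
  constructor
  · refine (setIntegral_le_integral_mul (lp.sq.add lq.sq) (fun z => by positivity) hη2 hη2c
      hη2U (fun z => mul_self_nonneg _) (isCompact_ann _ _ _) hann
      (fun z hz => ?_)).trans (le_trans (le_of_eq ?_) hB)
    · rw [ringCutoff_eq_one hr1 hr2 hz, one_mul]
    · congr 1; funext z; ring
  · refine (setIntegral_le_integral_mul h.locBdd_energy (energy_nonneg p q) hη4
      hη2c.mul_right (tsupport_mul_subset_left.trans hη2U)
      (fun z => mul_nonneg (mul_self_nonneg _) (mul_self_nonneg _)) (isCompact_ann _ _ _) hann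
      (fun z hz => ?_)).trans (le_trans (le_of_eq ?_) hA)
    · rw [ringCutoff_eq_one hr1 hr2 hz]; norm_num
    · congr 1; funext z; ring

/-- The Caccioppoli inequality between two dyadic annuli. -/
lemma energy_le_of_ring (h : ExteriorGradient U K Cb p q v) {j n : ℕ} (hj : 1 ≤ j)
    (hn : j + 2 ≤ n) (c : ℝ) {τ : ℝ} (hτ : 0 < τ) :
    ∫ z in ann 0 (2 ^ (j + 1)) (2 ^ n), energy p q z
      ≤ K * ((4 ^ j)⁻¹ * (∫ z in ann 0 (2 ^ j) (2 ^ (j + 1)), (p z - c) ^ 2)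
          + ∫ z in ann 0 (2 ^ j) (2 ^ (j + 1)), energy p q z)
        + K * (τ * (4 ^ n)⁻¹ * (∫ z in ann 0 (2 ^ n) (2 ^ (n + 1)), (p z - c) ^ 2)
          + τ⁻¹ * ∫ z in ann 0 (2 ^ n) (2 ^ (n + 1)), energy p q z) := by
  have hp : ∀ {a b : ℕ}, a < b → (2 : ℝ) ^ a < 2 ^ b := fun hab =>
    pow_lt_pow_right₀ (by norm_num) hab
  have hr1 : (2 : ℝ) ^ j < 2 ^ (j + 1) := hp (by omega)
  have hr2 : (2 : ℝ) ^ n < 2 ^ (n + 1) := hp (by omega)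
  have hr3 : (2 : ℝ) ^ (j + 1) < 2 ^ n := hp (by omega)
  have h2 := one_lt_two_pow hj
  have hcs := hasCompactSupport_ringCutoff (x₀ := 0) hr1 hr2
  have htU : tsupport (ringCutoff 0 (2 ^ j) (2 ^ (j + 1)) (2 ^ n) (2 ^ (n + 1))) ⊆ U :=
    (tsupport_ringCutoff_subset (x₀ := 0) hr1 hr2).trans (h.ann_subset (by linarith))
  have hlip := lipschitzWith_ringCutoff (x₀ := 0) hr1 hr2
  have hc := h.caccioppoli hlip hcs htU ringCutoff_nonneg c
    (isCompact_ann 0 (2 ^ j) (2 ^ (j + 1))) (isCompact_ann 0 (2 ^ n) (2 ^ (n + 1)))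
    (h.ann_subset (by linarith)) (h.ann_subset (by linarith)) one_pos hτ
    (fun z hz => abs_dx_dy_ringCutoff_inner hr1 hr3 hr2 hz)
    (fun z hz => abs_dx_dy_ringCutoff_outer hr1 hr3 hr2 hz)
    (fun z hz hz' => dx_dy_ringCutoff_eq_zero hr1 hr2 hz hz')
  have hlow := setIntegral_le_integral_mul h.locBdd_energy (energy_nonneg p q) hlip hcs htU
    ringCutoff_nonneg (isCompact_ann 0 (2 ^ (j + 1)) (2 ^ n)) (h.ann_subset (by linarith))
    (fun z hz => ringCutoff_eq_one hr1 hr2 hz)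
  have e : ∀ k : ℕ, (((2 : ℝ) ^ (k + 1) - 2 ^ k)⁻¹) ^ 2 = (4 ^ k)⁻¹ := fun k => by
    rw [inv_pow, show (2 : ℝ) ^ (k + 1) - 2 ^ k = 2 ^ k by ring, ← pow_mul, mul_comm, pow_mul]
    norm_num
  rw [e, e, one_mul, inv_one, one_mul] at hc
  exact hlow.trans hc

/-- The energy on the `k`-th dyadic annulus. -/
noncomputable def dyadicEnergy (p q : ℝ × ℝ → ℝ) (k : ℕ) : ℝ :=
  ∫ z in ann 0 (2 ^ k) (2 ^ (k + 1)), energy p q z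

/-- The energy outside the square `‖z‖ ≤ 2 ^ j`, as a sum over dyadic annuli. -/
noncomputable def tailEnergy (p q : ℝ × ℝ → ℝ) (j : ℕ) : ℝ := ∑' i, dyadicEnergy p q (j + i)

lemma dyadicEnergy_nonneg (p q : ℝ × ℝ → ℝ) (k : ℕ) : 0 ≤ dyadicEnergy p q k :=
  integral_nonneg (energy_nonneg p q)

lemma sum_dyadicEnergy (h : ExteriorGradient U K Cb p q v) {j : ℕ} (hj : 1 ≤ j) (N : ℕ) :
    ∑ i ∈ Finset.range N, dyadicEnergy p q (j + i)
      = ∫ z in ann 0 (2 ^ j) (2 ^ (j + N)), energy p q z := by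
  induction N with
  | zero =>
    have : volume (ann 0 ((2 : ℝ) ^ j) (2 ^ (j + 0))) = 0 :=
      measure_mono_null (fun z hz => le_antisymm hz.2 hz.1) (volume_sphere 0 (2 ^ j))
    rw [setIntegral_measure_zero _ this]
    simp
  | succ N ih =>
    have h2 := one_lt_two_pow hj
    rw [Finset.sum_range_succ, ih, dyadicEnergy, ← add_assoc j N 1]
    refine setIntegral_ann_add ?_ ?_ (h.locBdd_energy.integrableOn (isCompact_ann _ _ _)
      (h.ann_subset (by linarith)))
    · exact pow_le_pow_right₀ (by norm_num) (by omega)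
    · exact pow_le_pow_right₀ (by norm_num) (by omega)

lemma sum_dyadicEnergy_le (h : ExteriorGradient U K Cb p q v) (N : ℕ) :
    ∑ i ∈ Finset.range N, dyadicEnergy p q (2 + i) ≤ totalConst K Cb := by
  rcases Nat.eq_zero_or_pos N with rfl | hN
  · simpa using h.totalConst_nonneg
  rw [h.sum_dyadicEnergy (by norm_num)]
  have hc := h.energy_le_of_ring (j := 1) (n := 2 + N) le_rfl (by omega) 0 one_pos
  refine hc.trans ?_
  have hK := h.pos
  have key : ∀ k : ℕ, 1 ≤ k → (4 ^ k)⁻¹ * (∫ z in ann 0 (2 ^ k) (2 ^ (k + 1)), (p z - 0) ^ 2)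
      + ∫ z in ann 0 (2 ^ k) (2 ^ (k + 1)), energy p q z
      ≤ growthConst K Cb + 512 * K ^ 2 * growthConst K Cb := fun k hk => by
    obtain ⟨h1, h2⟩ := h.integral_dyadic_le hk
    have h2k := one_lt_two_pow hk
    have lp := locBdd_of_locallyLipschitzOn h.lip_fst
    have lq := locBdd_of_locallyLipschitzOn h.lip_snd
    have hU : ann 0 ((2 : ℝ) ^ k) (2 ^ (k + 1)) ⊆ U := h.ann_subset (by linarith)
    have h3 : ∫ z in ann 0 (2 ^ k) (2 ^ (k + 1)), (p z - 0) ^ 2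
        ≤ ∫ z in ann 0 (2 ^ k) (2 ^ (k + 1)), (p z ^ 2 + q z ^ 2) := by
      refine setIntegral_mono ((lp.sub (LocBdd.const 0)).sq.integrableOn (isCompact_ann _ _ _) hU)
        ((lp.sq.add lq.sq).integrableOn (isCompact_ann _ _ _) hU) fun z => ?_
      simp only [sub_zero]
      nlinarith [sq_nonneg (q z)]
    have h4 : (4 ^ k)⁻¹ * (∫ z in ann 0 (2 ^ k) (2 ^ (k + 1)), (p z - 0) ^ 2)
        ≤ growthConst K Cb := by
      rw [inv_mul_le_iff₀ (by positivity)]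
      linarith
    linarith
  have k1 := key 1 le_rfl
  have k2 := key (2 + N) (by omega)
  unfold totalConst
  have := mul_le_mul_of_nonneg_left k1 hK.le
  have := mul_le_mul_of_nonneg_left k2 hK.le
  rw [one_mul, inv_one, one_mul]
  linarith

lemma summable_dyadicEnergy (h : ExteriorGradient U K Cb p q v) (j : ℕ) :
    Summable fun i => dyadicEnergy p q (j + i) := by
  have h2 : Summable fun i => dyadicEnergy p q (2 + i) :=
    summable_of_sum_range_le (fun _ => dyadicEnergy_nonneg p q _) h.sum_dyadicEnergy_le
  have h0 : Summable (dyadicEnergy p q) := by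
    rw [← summable_nat_add_iff 2]
    simpa only [add_comm] using h2
  simpa only [add_comm] using (summable_nat_add_iff j).2 h0

lemma tailEnergy_two_le (h : ExteriorGradient U K Cb p q v) :
    tailEnergy p q 2 ≤ totalConst K Cb :=
  Real.tsum_le_of_sum_range_le (fun _ => dyadicEnergy_nonneg p q _) h.sum_dyadicEnergy_le

lemma tailEnergy_eq_add (h : ExteriorGradient U K Cb p q v) (j : ℕ) :
    tailEnergy p q j = dyadicEnergy p q j + tailEnergy p q (j + 1) := by
  unfold tailEnergy
  rw [(h.summable_dyadicEnergy j).tsum_eq_zero_add, add_zero]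
  congr 2
  funext i
  congr 1
  omega

lemma setIntegral_ann_le_tailEnergy (h : ExteriorGradient U K Cb p q v) {j : ℕ} (hj : 1 ≤ j)
    (N : ℕ) : ∫ z in ann 0 (2 ^ j) (2 ^ (j + N)), energy p q z ≤ tailEnergy p q j := by
  rw [← h.sum_dyadicEnergy hj]
  exact (h.summable_dyadicEnergy j).sum_le_tsum _ (fun _ _ => dyadicEnergy_nonneg p q _)

/-- Hole filling at infinity. The contribution of the far annulus to the Caccioppoli inequality
disappears in the limit, since the total energy is finite. -/
lemma tailEnergy_succ_le (h : ExteriorGradient U K Cb p q v) {j : ℕ} (hj : 1 ≤ j) :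
    tailEnergy p q (j + 1) ≤ rate K ^ 2 * tailEnergy p q j := by
  have hK := h.pos
  have h2j := one_lt_two_pow hj
  have lp := locBdd_of_locallyLipschitzOn h.lip_fst
  have lq := locBdd_of_locallyLipschitzOn h.lip_snd
  have hU : ∀ k : ℕ, 1 ≤ k → ann 0 ((2 : ℝ) ^ k) (2 ^ (k + 1)) ⊆ U := fun k hk =>
    h.ann_subset (by linarith [one_lt_two_pow hk])
  have e2 : ∀ k : ℕ, (4 : ℝ) ^ k = (2 ^ k) ^ 2 := fun k => by
    rw [← pow_mul, mul_comm, pow_mul]; norm_num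
  obtain ⟨c, hc⟩ := poincare_ann h.isOpen h.lip_fst (x₀ := 0) (r := 2 ^ j) (s := 2 ^ (j + 1))
    (by positivity) (by rw [pow_succ]; linarith) (by rw [pow_succ]; linarith) (hU j hj)
  set H := 2 * growthConst K Cb + 32 * c ^ 2 with hH
  have hH0 : 0 ≤ H := by have := h.growthConst_nonneg; positivity
  have hinner : (4 ^ j)⁻¹ * (∫ z in ann 0 (2 ^ j) (2 ^ (j + 1)), (p z - c) ^ 2)
      ≤ 153600 * dyadicEnergy p q j := by
    rw [inv_mul_le_iff₀ (by positivity), e2]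
    have := h.setIntegral_gradSq_le h.lip_fst (QuasiregularOn.gradSq_fst_le p q)
      (isCompact_ann 0 (2 ^ j) (2 ^ (j + 1))) (hU j hj)
    calc _ ≤ 153600 * (2 ^ j) ^ 2 * dyadicEnergy p q j := hc.trans (by
          unfold dyadicEnergy; gcongr)
      _ = _ := by ring
  have houter : ∀ n : ℕ, 1 ≤ n →
      (4 ^ n)⁻¹ * (∫ z in ann 0 (2 ^ n) (2 ^ (n + 1)), (p z - c) ^ 2) ≤ H := fun n hn => by
    rw [inv_mul_le_iff₀ (by positivity)]
    have h1 := setIntegral_sq_sub_le lp (isCompact_ann 0 (2 ^ n) (2 ^ (n + 1))) (hU n hn) 0 c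
    have h2 := volume_real_ann_le 0 (2 ^ n) (s := 2 ^ (n + 1)) (by positivity)
    have h3 : ∫ z in ann 0 (2 ^ n) (2 ^ (n + 1)), (p z - 0) ^ 2
        ≤ ∫ z in ann 0 (2 ^ n) (2 ^ (n + 1)), (p z ^ 2 + q z ^ 2) := by
      refine setIntegral_mono
        ((lp.sub (LocBdd.const 0)).sq.integrableOn (isCompact_ann _ _ _) (hU n hn))
        ((lp.sq.add lq.sq).integrableOn (isCompact_ann _ _ _) (hU n hn)) fun z => ?_
      simp only [sub_zero]
      nlinarith [sq_nonneg (q z)]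
    have h4 := (h.integral_dyadic_le hn).1
    have h5 : (0 - c) ^ 2 * volume.real (ann 0 ((2 : ℝ) ^ n) (2 ^ (n + 1)))
        ≤ c ^ 2 * (16 * 4 ^ n) := by
      have : (4 : ℝ) * (2 ^ (n + 1)) ^ 2 = 16 * 4 ^ n := by rw [e2, pow_succ]; ring
      rw [this] at h2
      rw [zero_sub, neg_sq]
      gcongr
    rw [hH]
    linarith
  -- let the outer radius tend to infinity
  have hlim : ∀ τ : ℝ, 0 < τ →
      tailEnergy p q (j + 1) ≤ 153601 * K * dyadicEnergy p q j + K * (τ * H) := by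
    intro τ hτ
    have hb0 : Tendsto (fun N => dyadicEnergy p q (j + 1 + N)) atTop (𝓝 0) :=
      (h.summable_dyadicEnergy (j + 1)).tendsto_atTop_zero
    have hR : Tendsto (fun N => 153601 * K * dyadicEnergy p q j
        + K * (τ * H + τ⁻¹ * dyadicEnergy p q (j + 1 + N))) atTop
        (𝓝 (153601 * K * dyadicEnergy p q j + K * (τ * H + τ⁻¹ * 0))) :=
      tendsto_const_nhds.add ((tendsto_const_nhds.add (hb0.const_mul _)).const_mul _)
    rw [mul_zero, add_zero] at hR
    have hL := (h.summable_dyadicEnergy (j + 1)).hasSum.tendsto_sum_nat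
    refine le_of_tendsto_of_tendsto hL hR ?_
    filter_upwards [eventually_ge_atTop 1] with N hN
    rw [h.sum_dyadicEnergy (by omega)]
    refine (h.energy_le_of_ring hj (n := j + 1 + N) (by omega) c hτ).trans ?_
    have o := mul_le_mul_of_nonneg_left (houter (j + 1 + N) (by omega)) hτ.le
    have i' := mul_le_mul_of_nonneg_left hinner hK.le
    have o' := mul_le_mul_of_nonneg_left o hK.le
    change K * ((4 ^ j)⁻¹ * _ + dyadicEnergy p q j)
      + K * (τ * (4 ^ (j + 1 + N))⁻¹ * _ + τ⁻¹ * dyadicEnergy p q (j + 1 + N)) ≤ _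
    linarith
  -- let `τ` tend to zero
  have hmain : tailEnergy p q (j + 1) ≤ 153601 * K * dyadicEnergy p q j := by
    refine le_of_forall_pos_le_add fun ε hε => ?_
    refine (hlim (ε / (K * H + 1)) (by positivity)).trans ?_
    gcongr
    have : K * (ε / (K * H + 1) * H) = ε * (K * H / (K * H + 1)) := by ring
    rw [this]
    exact mul_le_of_le_one_right hε.le ((div_le_one (by positivity)).2 (by linarith))
  refine le_rate_sq_mul hK ?_
  have e := h.tailEnergy_eq_add j
  have hb := dyadicEnergy_nonneg p q j
  have : tailEnergy p q j - tailEnergy p q (j + 1) = dyadicEnergy p q j := by linarith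
  rw [this]
  unfold holeConst
  linarith

lemma tailEnergy_le_pow (h : ExteriorGradient U K Cb p q v) (i : ℕ) :
    tailEnergy p q (2 + i) ≤ (rate K ^ i * √(totalConst K Cb)) ^ 2 := by
  induction i with
  | zero => simpa [Real.sq_sqrt h.totalConst_nonneg] using h.tailEnergy_two_le
  | succ i ih =>
    calc _ ≤ rate K ^ 2 * tailEnergy p q (2 + i) := h.tailEnergy_succ_le (by omega)
      _ ≤ rate K ^ 2 * (rate K ^ i * √(totalConst K Cb)) ^ 2 := by gcongr
      _ = _ := by rw [pow_succ]; ring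

/-! ### The limit at infinity and the global estimates -/

/-- The constant of the decay estimate on dyadic annuli. -/
noncomputable def decayConst (K Cb : ℝ) : ℝ := 801 * pointConst K * √(totalConst K Cb)

lemma pointConst_pos (h : ExteriorGradient U K Cb p q v) : 0 < pointConst K :=
  div_pos (by norm_num) (by linarith [rate_lt_one h.pos])

/-- On the middle part of a large annulus, `f` is close to a constant. -/
lemma exists_const_dyadic (h : ExteriorGradient U K Cb p q v) (hf : LocallyLipschitzOn U f)
    (hfE : ∀ z, dx f z ^ 2 + dy f z ^ 2 ≤ energy p q z) (i : ℕ) :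
    ∃ c, ∀ x : ℝ × ℝ, 3 / 2 * 2 ^ (2 + i) ≤ ‖x‖ → ‖x‖ ≤ 3 * 2 ^ (2 + i) →
      |f x - c| ≤ decayConst K Cb * rate K ^ i := by
  have hK := h.pos
  have hs := rate_pos hK
  set L : ℝ := 2 ^ (2 + i) with hL
  have hL2 : 2 ≤ L := one_lt_two_pow (by omega)
  set E := rate K ^ i * √(totalConst K Cb) with hE
  have hE0 : 0 ≤ E := by positivity
  have hU : ann 0 L (4 * L) ⊆ U := h.ann_subset (by linarith)
  have lf := locBdd_of_locallyLipschitzOn hf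
  obtain ⟨c, hc⟩ := poincare_ann h.isOpen hf (x₀ := 0) (r := L) (s := 4 * L) (by positivity)
    (by linarith) le_rfl hU
  have hEn : ∫ z in ann 0 L (4 * L), energy p q z ≤ E ^ 2 := by
    have h1 := h.setIntegral_ann_le_tailEnergy (j := 2 + i) (by omega) 2
    have e : (2 : ℝ) ^ (2 + i + 2) = 4 * L := by rw [hL, pow_add _ (2 + i) 2]; ring
    rw [e] at h1
    exact h1.trans (h.tailEnergy_le_pow i)
  refine ⟨c, fun x hx1 hx2 => ?_⟩
  have hsub : closedBall x (L / 2) ⊆ ann 0 L (4 * L) := by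
    intro z hz
    rw [mem_closedBall, dist_eq_norm] at hz
    have h1 := abs_norm_sub_norm_le z x
    rw [abs_le] at h1
    constructor
    · rw [sub_zero]; linarith
    · rw [sub_zero]; linarith
  have hE' := (setIntegral_mono_of_subset h.locBdd_energy (energy_nonneg p q)
    (isCompact_ann _ _ _) hU hsub).trans hEn
  have hV' : ∫ z in closedBall x (L / 2), (f z - c) ^ 2 ≤ (800 * E) ^ 2 * (L / 2) ^ 2 := by
    refine (setIntegral_mono_of_subset (lf.sub (LocBdd.const c)).sq (fun z => sq_nonneg _)
      (isCompact_ann _ _ _) hU hsub).trans (hc.trans ?_)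
    have h1 := (h.setIntegral_gradSq_le hf hfE (isCompact_ann 0 L (4 * L)) hU).trans hEn
    calc _ ≤ 153600 * L ^ 2 * E ^ 2 := by gcongr
      _ ≤ _ := by nlinarith [mul_nonneg (sq_nonneg L) (sq_nonneg E)]
  have := h.abs_sub_le_of_energy hf hfE (by positivity) hE0 (by positivity) (hsub.trans hU) hE' hV'
  refine this.trans (le_of_eq ?_)
  rw [hE, decayConst]
  ring

/-- The constants of consecutive annuli are compared at a point that both annuli contain, so they
form a Cauchy sequence; its limit is the limit of `f` at infinity. -/
lemma exists_limit (h : ExteriorGradient U K Cb p q v) (hf : LocallyLipschitzOn U f)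
    (hfE : ∀ z, dx f z ^ 2 + dy f z ^ 2 ≤ energy p q z) {α : ℝ} (hα0 : 0 < α) (hα1 : α < 1)
    (hα : (1 / 2 : ℝ) ^ α = rate K) :
    ∃ l, ∀ x : ℝ × ℝ, 6 ≤ ‖x‖ →
      |f x - l| ≤ 36 * decayConst K Cb / (1 - rate K) * ‖x‖ ^ (-α) := by
  have hK := h.pos
  have hs := rate_pos hK
  have hs1 := rate_lt_one hK
  have hD : 0 ≤ decayConst K Cb := by
    have := h.pointConst_pos
    unfold decayConst; positivity
  choose c hc using h.exists_const_dyadic hf hfE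
  -- the point `(3 * 2 ^ (2 + i), 0)` belongs to both annuli
  have hstep : ∀ i, dist (c i) (c (i + 1)) ≤ 2 * decayConst K Cb * rate K ^ i := fun i => by
    have hx : ‖(((3 : ℝ) * 2 ^ (2 + i), 0) : ℝ × ℝ)‖ = 3 * 2 ^ (2 + i) := by
      rw [Prod.norm_mk, norm_zero, Real.norm_of_nonneg (by positivity),
        max_eq_left (by positivity)]
    have hp : (2 : ℝ) ^ (2 + (i + 1)) = 2 * 2 ^ (2 + i) := by rw [← add_assoc, pow_succ]; ring
    have hpos : (0 : ℝ) < 2 ^ (2 + i) := by positivity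
    have h1 := hc i _ (by rw [hx]; linarith) hx.le
    have h2 := hc (i + 1) _ (by rw [hx, hp]; linarith) (by rw [hx, hp]; linarith)
    have h3 : rate K ^ (i + 1) ≤ rate K ^ i := pow_le_pow_of_le_one hs.le hs1.le (by omega)
    have h4 := mul_le_mul_of_nonneg_left h3 hD
    rw [Real.dist_eq]
    rw [abs_le] at h1 h2 ⊢
    constructor <;> linarith
  obtain ⟨l, hl⟩ := cauchySeq_tendsto_of_complete (cauchySeq_of_le_geometric _ _ hs1 hstep)
  refine ⟨l, fun x hx => ?_⟩
  have hx0 : 0 < ‖x‖ := by linarith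
  obtain ⟨n, hn1, hn2⟩ := exists_nat_pow_near (x := ‖x‖ / (3 / 2)) (y := 2)
    (by rw [le_div_iff₀ (by norm_num)]; linarith) (by norm_num)
  have hn : 2 ≤ n := by
    by_contra hlt
    have h1 : (2 : ℝ) ^ (n + 1) ≤ 2 ^ 2 := pow_le_pow_right₀ (by norm_num) (by omega)
    rw [div_lt_iff₀ (by norm_num)] at hn2
    linarith
  obtain ⟨i, rfl⟩ := Nat.exists_eq_add_of_le hn
  rw [le_div_iff₀ (by norm_num)] at hn1
  rw [div_lt_iff₀ (by norm_num), pow_succ] at hn2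
  have h1 := hc i x (by linarith) (by linarith)
  have h2 := dist_le_of_le_geometric_of_tendsto (rate K) _ hs1 hstep hl i
  rw [Real.dist_eq] at h2
  have hd : 0 < 1 - rate K := by linarith
  have h3 : |f x - l| ≤ 3 * decayConst K Cb / (1 - rate K) * rate K ^ i := by
    have e : f x - l = (f x - c i) + (c i - l) := by ring
    have h4 : decayConst K Cb * rate K ^ i ≤ decayConst K Cb * rate K ^ i / (1 - rate K) := by
      rw [le_div_iff₀ hd]
      exact mul_le_of_le_one_right (by positivity) (by linarith)
    rw [e]
    calc _ ≤ |f x - c i| + |c i - l| := abs_add_le _ _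
      _ ≤ decayConst K Cb * rate K ^ i / (1 - rate K)
          + 2 * decayConst K Cb * rate K ^ i / (1 - rate K) := by linarith
      _ = _ := by ring
  have h5 : rate K ^ i ≤ 12 * ‖x‖ ^ (-α) := by
    have e1 : rate K ^ i = ((1 / 2 : ℝ) ^ i) ^ α := by
      rw [← hα, ← Real.rpow_natCast, ← Real.rpow_mul (by norm_num), mul_comm,
        Real.rpow_mul (by norm_num), Real.rpow_natCast]
    have e2 : (1 / 2 : ℝ) ^ i ≤ 12 * ‖x‖⁻¹ := by
      rw [← div_eq_mul_inv, le_div_iff₀ hx0, one_div, inv_pow, inv_mul_le_iff₀ (by positivity)]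
      rw [pow_add] at hn2
      linarith
    rw [e1, Real.rpow_neg hx0.le, ← Real.inv_rpow hx0.le]
    calc _ ≤ (12 * ‖x‖⁻¹) ^ α := Real.rpow_le_rpow (by positivity) e2 hα0.le
      _ = 12 ^ α * ‖x‖⁻¹ ^ α := Real.mul_rpow (by norm_num) (by positivity)
      _ ≤ 12 ^ (1 : ℝ) * ‖x‖⁻¹ ^ α := by
          gcongr
          norm_num
      _ = _ := by norm_num
  calc _ ≤ 3 * decayConst K Cb / (1 - rate K) * (12 * ‖x‖ ^ (-α)) := h3.trans (by gcongr)
    _ = _ := by ring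

/-- The constant in the bound for `∫ |Dv|²` on a square at bounded distance from the origin. -/
noncomputable def nearConst (K Cb : ℝ) : ℝ := (16 + 256 * K ^ 2) * 289 * 16 * Cb ^ 2

lemma nearConst_nonneg (h : ExteriorGradient U K Cb p q v) : 0 ≤ nearConst K Cb := by
  have := h.nonneg
  unfold nearConst; positivity

/-- The counterpart of `integral_dyadic_le` on squares at bounded distance from the origin. -/
lemma integral_near_le (h : ExteriorGradient U K Cb p q v) {x : ℝ × ℝ} {δ : ℝ} (hδ : 0 < δ)
    (hδ1 : δ ≤ 1) (hB : closedBall x (2 * δ) ⊆ U) (hx : ‖x‖ ≤ 6) :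
    ∫ z in closedBall x δ, (p z ^ 2 + q z ^ 2) ≤ nearConst K Cb ∧
    ∫ z in closedBall x δ, energy p q z ≤ 32 * K ^ 2 * nearConst K Cb / δ ^ 2 := by
  have hCb := h.nonneg
  have hlt : δ < 2 * δ := by linarith
  have hcs := hasCompactSupport_cutoff x hlt
  have hts := (tsupport_cutoff_subset x hlt).trans (ann_subset_closedBall x 0 (2 * δ))
  have htU := hts.trans hB
  have hlip := lipschitzWith_cutoff x hlt
  have e0 : 2 * δ - δ = δ := by ring
  rw [e0] at hlip
  have hM : 0 < δ⁻¹ := inv_pos.2 hδ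
  have hvol : volume.real (tsupport (cutoff x δ (2 * δ))) ≤ 16 * δ ^ 2 := by
    refine (measureReal_mono hts (isCompact_closedBall _ _).measure_lt_top.ne).trans ?_
    rw [volume_real_closedBall _ (by linarith)]
    exact le_of_eq (by ring)
  obtain ⟨hB', hA⟩ := h.integral_energy_le_of_potential h.lip_pot h.grad_pot hlip hcs htU
    (cutoff_nonneg x δ (2 * δ)) hM (abs_dx_dy_le_of_lipschitzWith hM.le hlip) (S := 17 * Cb)
    (fun z hz => by
      refine (h.growth z (htU hz)).trans ?_
      have hz' := hts hz
      rw [mem_closedBall, dist_eq_norm] at hz'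
      have h1 := norm_le_norm_add_norm_sub x z
      rw [norm_sub_rev] at h1
      have : 1 + 2 * ‖z‖ ≤ 17 := by linarith
      calc _ ≤ Cb * 17 := by gcongr
        _ = _ := by ring) hvol
  have hBδ : closedBall x δ ⊆ U := (closedBall_subset_closedBall hlt.le).trans hB
  have e1 : (16 + 256 * K ^ 2) * (17 * Cb) ^ 2 * δ⁻¹ ^ 2 * (16 * δ ^ 2) = nearConst K Cb := by
    unfold nearConst; field_simp; ring
  rw [e1] at hB' hA
  have e2 : 32 * K ^ 2 * δ⁻¹ ^ 2 * nearConst K Cb = 32 * K ^ 2 * nearConst K Cb / δ ^ 2 := by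
    field_simp
  rw [e2] at hA
  have lp := locBdd_of_locallyLipschitzOn h.lip_fst
  have lq := locBdd_of_locallyLipschitzOn h.lip_snd
  obtain ⟨C2, hη2⟩ := exists_lipschitzWith_mul hlip hcs hlip
  have hη2c := hcs.mul_right (f' := cutoff x δ (2 * δ))
  obtain ⟨C4, hη4⟩ := exists_lipschitzWith_mul hη2 hη2c hη2
  have hη2U := (tsupport_mul_subset_left (f := cutoff x δ (2 * δ))
    (g := cutoff x δ (2 * δ))).trans htU
  have hone : ∀ z ∈ closedBall x δ, cutoff x δ (2 * δ) z = 1 := fun z hz =>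
    cutoff_eq_one hlt (by simpa [dist_eq_norm] using hz)
  constructor
  · refine (setIntegral_le_integral_mul (lp.sq.add lq.sq) (fun z => by positivity) hη2 hη2c
      hη2U (fun z => mul_self_nonneg _) (isCompact_closedBall _ _) hBδ
      (fun z hz => ?_)).trans (le_trans (le_of_eq ?_) hB')
    · rw [hone z hz, one_mul]
    · congr 1; funext z; ring
  · refine (setIntegral_le_integral_mul h.locBdd_energy (energy_nonneg p q) hη4
      hη2c.mul_right (tsupport_mul_subset_left.trans hη2U)
      (fun z => mul_nonneg (mul_self_nonneg _) (mul_self_nonneg _)) (isCompact_closedBall _ _) hBδ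
      (fun z hz => ?_)).trans (le_trans (le_of_eq ?_) hA)
    · rw [hone z hz]; norm_num
    · congr 1; funext z; ring

/-- A bound for the square root of the energy on every square of side `2δ` whose double stays in the
domain. -/
noncomputable def localConst (K Cb δ : ℝ) : ℝ :=
  √(32 * K ^ 2 * nearConst K Cb / δ ^ 2) + √(totalConst K Cb)

lemma localConst_nonneg (K Cb δ : ℝ) : 0 ≤ localConst K Cb δ :=
  add_nonneg (Real.sqrt_nonneg _) (Real.sqrt_nonneg _)

lemma integral_energy_le_local (h : ExteriorGradient U K Cb p q v) {x : ℝ × ℝ} {δ : ℝ}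
    (hδ : 0 < δ) (hδ1 : δ ≤ 1) (hB : closedBall x (2 * δ) ⊆ U) :
    ∫ z in closedBall x δ, energy p q z ≤ localConst K Cb δ ^ 2 := by
  have n1 := Real.sqrt_nonneg (32 * K ^ 2 * nearConst K Cb / δ ^ 2)
  have n2 := Real.sqrt_nonneg (totalConst K Cb)
  have s1 := Real.sq_sqrt (x := 32 * K ^ 2 * nearConst K Cb / δ ^ 2)
    (by have := h.nearConst_nonneg; positivity)
  have s2 := Real.sq_sqrt h.totalConst_nonneg
  unfold localConst
  rcases le_total ‖x‖ 6 with hx | hx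
  · have := (h.integral_near_le hδ hδ1 hB hx).2
    nlinarith [mul_nonneg n1 n2]
  · obtain ⟨N, hN⟩ := pow_unbounded_of_one_lt (‖x‖ + δ) (one_lt_two : (1 : ℝ) < 2)
    have hle : (2 : ℝ) ^ N ≤ 2 ^ (2 + N) := pow_le_pow_right₀ (by norm_num) (by omega)
    have hsub : closedBall x δ ⊆ ann 0 (2 ^ 2) (2 ^ (2 + N)) := by
      intro z hz
      rw [mem_closedBall, dist_eq_norm] at hz
      have h1 := abs_norm_sub_norm_le z x
      rw [abs_le] at h1
      constructor
      · rw [sub_zero]; linarith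
      · rw [sub_zero]; linarith
    have h1 := setIntegral_mono_of_subset h.locBdd_energy (energy_nonneg p q)
      (isCompact_ann 0 (2 ^ 2) (2 ^ (2 + N))) (h.ann_subset (by norm_num)) hsub
    have h2 := h.setIntegral_ann_le_tailEnergy (j := 2) (by norm_num) N
    have h3 := h.tailEnergy_two_le
    nlinarith [mul_nonneg n1 n2]

/-- The supremum bound for the components of the gradient near the origin. -/
lemma abs_le_near (h : ExteriorGradient U K Cb p q v) (hf : LocallyLipschitzOn U f)
    (hfE : ∀ z, dx f z ^ 2 + dy f z ^ 2 ≤ energy p q z)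
    (hfpq : ∀ z, f z ^ 2 ≤ p z ^ 2 + q z ^ 2) {x : ℝ × ℝ} {δ : ℝ} (hδ : 0 < δ)
    (hδ1 : δ ≤ 1) (hB : closedBall x (2 * δ) ⊆ U) (hx : ‖x‖ ≤ 6) :
    |f x| ≤ pointConst K * (localConst K Cb δ + √(nearConst K Cb) / δ) := by
  have hBδ : closedBall x δ ⊆ U := (closedBall_subset_closedBall (by linarith)).trans hB
  have lf := locBdd_of_locallyLipschitzOn hf
  have lp := locBdd_of_locallyLipschitzOn h.lip_fst
  have lq := locBdd_of_locallyLipschitzOn h.lip_snd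
  have h1 := h.abs_sub_le_of_energy hf hfE (c := 0) (V := √(nearConst K Cb) / δ) hδ
    (localConst_nonneg K Cb δ) (by positivity) hBδ
    (h.integral_energy_le_local hδ hδ1 hB) (by
      rw [div_pow, Real.sq_sqrt h.nearConst_nonneg, div_mul_cancel₀ _ (by positivity)]
      refine le_trans (setIntegral_mono ((lf.sub (LocBdd.const 0)).sq.integrableOn
        (isCompact_closedBall _ _) hBδ) ((lp.sq.add lq.sq).integrableOn (isCompact_closedBall _ _)
        hBδ) fun z => ?_) (h.integral_near_le hδ hδ1 hB hx).1
      simpa using hfpq z)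
  simpa using h1

end ExteriorGradient

/-- The estimates of the theorem for each component of an exterior gradient map. -/
theorem exists_limit_and_holder {K : ℝ} (hK : 0 < K) :
    ∃ α : ℝ, 0 < α ∧ α < 1 ∧ ∀ Cb δ : ℝ, 0 < δ → δ ≤ 1 → ∃ C : ℝ, 0 < C ∧
      ∀ (U : Set (ℝ × ℝ)) (p q v f : ℝ × ℝ → ℝ), ExteriorGradient U K Cb p q v → (f = p ∨ f = q) →
        (∃ l, ∀ x, 0 < ‖x‖ → closedBall x (2 * δ) ⊆ U → |f x - l| ≤ C * ‖x‖ ^ (-α)) ∧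
        ∀ x y, closedBall x (2 * δ) ⊆ U → closedBall y (2 * δ) ⊆ U →
          |f x - f y| ≤ C * ‖x - y‖ ^ α := by
  obtain ⟨α, hα0, hα1, hα⟩ := exists_exponent hK
  refine ⟨α, hα0, hα1, fun Cb δ hδ hδ1 => ?_⟩
  have hd : 0 < 1 - rate K := by linarith [rate_lt_one hK]
  have hN : 0 < pointConst K := div_pos (by norm_num) hd
  set D := 36 * ExteriorGradient.decayConst K Cb / (1 - rate K) with hD
  set B := pointConst K * (ExteriorGradient.localConst K Cb δ
    + √(ExteriorGradient.nearConst K Cb) / δ) with hBdef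
  set E := ExteriorGradient.localConst K Cb δ with hE
  have hE0 : 0 ≤ E := ExteriorGradient.localConst_nonneg K Cb δ
  have hB0 : 0 ≤ B := by positivity
  have hD0 : 0 ≤ D := by
    rw [hD, ExteriorGradient.decayConst]; positivity
  set C := 1 + 6 * (2 * B + D) + 88 * pointConst K * E / δ + (2 * B + D) * 8 / δ with hC
  refine ⟨C, by positivity, fun U p q v f h hfpq => ?_⟩
  have hf : LocallyLipschitzOn U f := by
    rcases hfpq with rfl | rfl
    · exact h.lip_fst
    · exact h.lip_snd
  have hfE : ∀ z, dx f z ^ 2 + dy f z ^ 2 ≤ energy p q z := by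
    rcases hfpq with rfl | rfl
    · exact QuasiregularOn.gradSq_fst_le _ _
    · exact QuasiregularOn.gradSq_snd_le _ _
  have hsq : ∀ z, f z ^ 2 ≤ p z ^ 2 + q z ^ 2 := by
    rcases hfpq with rfl | rfl
    · intro z; nlinarith [sq_nonneg (q z)]
    · intro z; nlinarith [sq_nonneg (p z)]
  obtain ⟨l, hl⟩ := h.exists_limit hf hfE hα0 hα1 hα
  have hnear : ∀ x, closedBall x (2 * δ) ⊆ U → ‖x‖ ≤ 6 → |f x| ≤ B := fun x hx hx6 =>
    h.abs_le_near hf hfE hsq hδ hδ1 hx hx6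
  have hone : ∀ x : ℝ × ℝ, 6 ≤ ‖x‖ → ‖x‖ ^ (-α) ≤ 1 := fun x hx =>
    Real.rpow_le_one_of_one_le_of_nonpos (by linarith) (by linarith)
  -- the point `(6, 0)` has distance at least two from the boundary, and lies in the range of both
  -- the near and the far estimate
  have hlB : |l| ≤ B + D := by
    have hn : ‖((6, 0) : ℝ × ℝ)‖ = 6 := by simp [Prod.norm_def]
    have h1 := hl (6, 0) hn.ge
    have h2 := hnear (6, 0) (fun z hz => h.mem_of_one_lt z (by
      rw [mem_closedBall, dist_eq_norm] at hz
      have h1 := abs_norm_sub_norm_le z ((6, 0) : ℝ × ℝ)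
      rw [abs_le, hn] at h1
      linarith)) hn.le
    have h3 := mul_le_mul_of_nonneg_left (hone (6, 0) hn.ge) hD0
    rw [abs_le] at h1 h2 ⊢
    constructor <;> linarith
  have hbd : ∀ x, closedBall x (2 * δ) ⊆ U → |f x - l| ≤ 2 * B + D := fun x hx => by
    rcases le_total ‖x‖ 6 with h6 | h6
    · have h1 := hnear x hx h6
      refine (abs_sub _ _).trans ?_
      linarith
    · have h1 := hl x h6
      have h3 := mul_le_mul_of_nonneg_left (hone x h6) hD0
      linarith
  have hx1 : 0 ≤ 88 * pointConst K * E / δ := by positivity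
  have hx2 : 0 ≤ (2 * B + D) * 8 / δ := by positivity
  refine ⟨⟨l, fun x hx0 hx => ?_⟩, fun x y hx hy => ?_⟩
  · rcases le_total ‖x‖ 6 with h6 | h6
    · have h1 := hbd x hx
      have h2 : (1 : ℝ) ≤ 6 * ‖x‖ ^ (-α) := by
        rw [Real.rpow_neg hx0.le, ← div_eq_mul_inv, one_le_div (by positivity)]
        calc ‖x‖ ^ α ≤ 6 ^ α := Real.rpow_le_rpow hx0.le h6 hα0.le
          _ ≤ 6 ^ (1 : ℝ) := Real.rpow_le_rpow_of_exponent_le (by norm_num) hα1.le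
          _ = 6 := by norm_num
      calc _ ≤ (2 * B + D) * (6 * ‖x‖ ^ (-α)) :=
          h1.trans (le_mul_of_one_le_right (by positivity) h2)
        _ = (6 * (2 * B + D)) * ‖x‖ ^ (-α) := by ring
        _ ≤ _ := by gcongr; linarith
    · refine (hl x h6).trans ?_
      gcongr
      linarith
  · rcases le_total ‖x - y‖ (δ / 4) with hxy | hxy
    · have h1 := h.abs_sub_le_rpow hf hfE hα0 hα1 hα hδ hE0
        ((closedBall_subset_closedBall (by linarith)).trans hx)
        (h.integral_energy_le_local hδ hδ1 hx) hxy
      refine h1.trans ?_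
      have h2 : (‖x - y‖ / δ) ^ α ≤ ‖x - y‖ ^ α / δ := by
        rw [Real.div_rpow (norm_nonneg _) hδ.le]
        have : δ ≤ δ ^ α := by
          calc δ = δ ^ (1 : ℝ) := (Real.rpow_one δ).symm
            _ ≤ _ := Real.rpow_le_rpow_of_exponent_ge hδ hδ1 hα1.le
        gcongr
      calc _ ≤ 88 * pointConst K * E * (‖x - y‖ ^ α / δ) := by gcongr
        _ = 88 * pointConst K * E / δ * ‖x - y‖ ^ α := by ring
        _ ≤ _ := by gcongr; linarith
    · have h1 := hbd x hx
      have h2 := hbd y hy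
      have h3 : |f x - f y| ≤ 2 * (2 * B + D) := by
        have : f x - f y = (f x - l) - (f y - l) := by ring
        rw [this]
        refine (abs_sub _ _).trans ?_
        linarith
      have h4 : δ / 4 ≤ ‖x - y‖ ^ α := by
        calc δ / 4 = (δ / 4) ^ (1 : ℝ) := (Real.rpow_one _).symm
          _ ≤ (δ / 4) ^ α :=
            Real.rpow_le_rpow_of_exponent_ge (by positivity) (by linarith) hα1.le
          _ ≤ _ := Real.rpow_le_rpow (by positivity) hxy hα0.le
      calc _ ≤ 2 * (2 * B + D) := h3
        _ = (2 * B + D) * 8 / δ * (δ / 4) := by field_simp; ring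
        _ ≤ (2 * B + D) * 8 / δ * ‖x - y‖ ^ α := by gcongr
        _ ≤ _ := by gcongr; linarith

/-! ### Reflection across the flat boundary -/

/-- The closed upper half-plane. -/
def upperHalf : Set (ℝ × ℝ) := {z | 0 ≤ z.2}

/-- The reflection across the horizontal axis. -/
noncomputable def flip : (ℝ × ℝ) ≃L[ℝ] (ℝ × ℝ) :=
  (ContinuousLinearEquiv.refl ℝ ℝ).prodCongr (ContinuousLinearEquiv.neg ℝ)

@[simp] lemma flip_apply (z : ℝ × ℝ) : flip z = (z.1, -z.2) := rfl

/-- The even extension of a function on the upper half-plane. -/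
noncomputable def evenExt (f : ℝ × ℝ → ℝ) (z : ℝ × ℝ) : ℝ := f (z.1, |z.2|)

/-- The odd extension of a function on the upper half-plane. -/
noncomputable def oddExt (f : ℝ × ℝ → ℝ) (z : ℝ × ℝ) : ℝ := if 0 ≤ z.2 then f z else -f (flip z)

lemma evenExt_of_nonneg (f : ℝ × ℝ → ℝ) {z : ℝ × ℝ} (hz : 0 ≤ z.2) : evenExt f z = f z := by
  simp [evenExt, abs_of_nonneg hz]

lemma oddExt_of_nonneg (f : ℝ × ℝ → ℝ) {z : ℝ × ℝ} (hz : 0 ≤ z.2) : oddExt f z = f z := by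
  simp [oddExt, hz]

lemma evenExt_of_neg (f : ℝ × ℝ → ℝ) {z : ℝ × ℝ} (hz : z.2 < 0) : evenExt f z = f (flip z) := by
  simp [evenExt, abs_of_neg hz]

lemma oddExt_of_neg (f : ℝ × ℝ → ℝ) {z : ℝ × ℝ} (hz : z.2 < 0) : oddExt f z = -f (flip z) := by
  simp [oddExt, not_le.2 hz]

lemma eventually_snd_pos {z : ℝ × ℝ} (hz : 0 < z.2) : ∀ᶠ y in 𝓝 z, 0 < y.2 :=
  continuousAt_const.eventually_lt continuousAt_snd hz

lemma eventually_snd_neg {z : ℝ × ℝ} (hz : z.2 < 0) : ∀ᶠ y in 𝓝 z, y.2 < 0 :=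
  continuousAt_snd.eventually_lt continuousAt_const hz

lemma evenExt_eventuallyEq_of_pos (f : ℝ × ℝ → ℝ) {z : ℝ × ℝ} (hz : 0 < z.2) :
    evenExt f =ᶠ[𝓝 z] f := by
  filter_upwards [eventually_snd_pos hz] with y hy using evenExt_of_nonneg f hy.le

lemma oddExt_eventuallyEq_of_pos (f : ℝ × ℝ → ℝ) {z : ℝ × ℝ} (hz : 0 < z.2) :
    oddExt f =ᶠ[𝓝 z] f := by
  filter_upwards [eventually_snd_pos hz] with y hy using oddExt_of_nonneg f hy.le

lemma evenExt_eventuallyEq_of_neg (f : ℝ × ℝ → ℝ) {z : ℝ × ℝ} (hz : z.2 < 0) :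
    evenExt f =ᶠ[𝓝 z] f ∘ flip := by
  filter_upwards [eventually_snd_neg hz] with y hy using evenExt_of_neg f hy

lemma oddExt_eventuallyEq_of_neg (f : ℝ × ℝ → ℝ) {z : ℝ × ℝ} (hz : z.2 < 0) :
    oddExt f =ᶠ[𝓝 z] -(f ∘ flip) := by
  filter_upwards [eventually_snd_neg hz] with y hy using oddExt_of_neg f hy

lemma fderiv_comp_flip (f : ℝ × ℝ → ℝ) (z w : ℝ × ℝ) :
    fderiv ℝ (f ∘ flip) z w = fderiv ℝ f (flip z) (flip w) := by
  rw [flip.comp_right_fderiv]; rfl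

lemma dx_evenExt_of_neg (f : ℝ × ℝ → ℝ) {z : ℝ × ℝ} (hz : z.2 < 0) :
    dx (evenExt f) z = dx f (flip z) := by
  rw [dx_congr (evenExt_eventuallyEq_of_neg f hz), dx, fderiv_comp_flip]; simp [dx]

lemma dy_evenExt_of_neg (f : ℝ × ℝ → ℝ) {z : ℝ × ℝ} (hz : z.2 < 0) :
    dy (evenExt f) z = -dy f (flip z) := by
  rw [dy_congr (evenExt_eventuallyEq_of_neg f hz), dy, fderiv_comp_flip, dy, ← map_neg]; simp

lemma dx_oddExt_of_neg (f : ℝ × ℝ → ℝ) {z : ℝ × ℝ} (hz : z.2 < 0) :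
    dx (oddExt f) z = -dx f (flip z) := by
  rw [dx_congr (oddExt_eventuallyEq_of_neg f hz), dx, fderiv_neg, neg_apply,
    fderiv_comp_flip]
  simp [dx]

lemma dy_oddExt_of_neg (f : ℝ × ℝ → ℝ) {z : ℝ × ℝ} (hz : z.2 < 0) :
    dy (oddExt f) z = dy f (flip z) := by
  rw [dy_congr (oddExt_eventuallyEq_of_neg f hz), dy, fderiv_neg, neg_apply,
    fderiv_comp_flip, dy, ← map_neg]
  simp

lemma exists_lipschitzOnWith_ball {U : Set (ℝ × ℝ)} (hU : IsOpen U) {f : ℝ × ℝ → ℝ}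
    (hf : ContDiffOn ℝ 1 f (upperHalf ∩ U)) {x : ℝ × ℝ} (hx : x ∈ upperHalf ∩ U) :
    ∃ C, ∃ ε > 0, ball x ε ⊆ U ∧ LipschitzOnWith C f (ball x ε ∩ upperHalf) := by
  have hconv : Convex ℝ upperHalf := by
    have : upperHalf = (ContinuousLinearMap.snd ℝ ℝ ℝ) ⁻¹' Ici 0 := rfl
    rw [this]
    exact (convex_Ici 0).is_linear_preimage (ContinuousLinearMap.snd ℝ ℝ ℝ).isLinear
  have h1 := (contDiffWithinAt_inter (hU.mem_nhds hx.2)).1 (hf x hx)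
  obtain ⟨C, t, ht, hC⟩ := h1.exists_lipschitzOnWith hconv
  obtain ⟨ε, hε, hεt⟩ := mem_nhdsWithin_iff.1 ht
  obtain ⟨ε', hε', hεU⟩ := Metric.mem_nhds_iff.1 (hU.mem_nhds hx.2)
  refine ⟨C, min ε ε', lt_min hε hε', (ball_subset_ball (min_le_right _ _)).trans hεU,
    hC.mono ?_⟩
  exact (inter_subset_inter_left _ (ball_subset_ball (min_le_left _ _))).trans hεt

lemma dist_fold_le (a b : ℝ × ℝ) : dist (a.1, |a.2|) (b.1, |b.2|) ≤ dist a b := by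
  rw [Prod.dist_eq, Prod.dist_eq]
  refine max_le_max le_rfl ?_
  rw [Real.dist_eq, Real.dist_eq]
  exact abs_abs_sub_abs_le_abs_sub _ _

lemma fold_mem {U : Set (ℝ × ℝ)} (hσ : ∀ z ∈ U, flip z ∈ U) {z : ℝ × ℝ} (hz : z ∈ U) :
    (z.1, |z.2|) ∈ upperHalf ∩ U := by
  refine ⟨abs_nonneg z.2, ?_⟩
  rcases le_total 0 z.2 with h | h
  · rw [abs_of_nonneg h]; exact hz
  · rw [abs_of_nonpos h]; exact hσ z hz

lemma locallyLipschitzOn_evenExt {U : Set (ℝ × ℝ)} (hU : IsOpen U) (hσ : ∀ z ∈ U, flip z ∈ U)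
    {f : ℝ × ℝ → ℝ} (hf : ContDiffOn ℝ 1 f (upperHalf ∩ U)) : LocallyLipschitzOn U (evenExt f) := by
  intro z hz
  obtain ⟨C, ε, hε, -, hC⟩ := exists_lipschitzOnWith_ball hU hf (fold_mem hσ hz)
  refine ⟨C, ball z ε, mem_nhdsWithin_of_mem_nhds (ball_mem_nhds z hε),
    LipschitzOnWith.of_dist_le_mul fun a ha b hb => ?_⟩
  have h1 := hC.dist_le_mul (a.1, |a.2|) ⟨(dist_fold_le a z).trans_lt ha, abs_nonneg a.2⟩
    (b.1, |b.2|) ⟨(dist_fold_le b z).trans_lt hb, abs_nonneg b.2⟩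
  exact h1.trans (by gcongr; exact dist_fold_le a b)

/-- The odd extension of a function that vanishes on the axis is locally Lipschitz: across the axis
the two values are compared with the values at the vertical projections, which are zero. -/
lemma locallyLipschitzOn_oddExt {U : Set (ℝ × ℝ)} (hU : IsOpen U) (hσ : ∀ z ∈ U, flip z ∈ U)
    {f : ℝ × ℝ → ℝ} (hf : ContDiffOn ℝ 1 f (upperHalf ∩ U)) (hf0 : ∀ z ∈ U, z.2 = 0 → f z = 0) :
    LocallyLipschitzOn U (oddExt f) := by
  intro z hz
  rcases lt_trichotomy z.2 0 with hz2 | hz2 | hz2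
  · obtain ⟨C, t, ht, hC⟩ := locallyLipschitzOn_evenExt hU hσ hf hz
    refine ⟨C, t ∩ {y | y.2 < 0},
      inter_mem ht (mem_nhdsWithin_of_mem_nhds (eventually_snd_neg hz2)),
      LipschitzOnWith.of_dist_le_mul fun a ha b hb => ?_⟩
    rw [oddExt_of_neg f ha.2, oddExt_of_neg f hb.2, dist_neg_neg, ← evenExt_of_neg f ha.2,
      ← evenExt_of_neg f hb.2]
    exact hC.dist_le_mul a ha.1 b hb.1
  · have hzu : z ∈ upperHalf ∩ U := ⟨hz2.ge, hz⟩
    obtain ⟨C, ε, hε, hεU, hC⟩ := exists_lipschitzOnWith_ball hU hf hzu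
    have hfold : ∀ a ∈ ball z ε, ((a.1, |a.2|) : ℝ × ℝ) ∈ ball z ε ∩ upperHalf := fun a ha => by
      refine ⟨?_, abs_nonneg a.2⟩
      have h := dist_fold_le a z
      rw [hz2, abs_zero, ← hz2] at h
      exact h.trans_lt ha
    have hproj : ∀ a ∈ ball z ε, ((a.1, 0) : ℝ × ℝ) ∈ ball z ε ∩ upperHalf := fun a ha => by
      refine ⟨?_, le_refl (0 : ℝ)⟩
      rw [mem_ball, Prod.dist_eq] at ha ⊢
      refine (max_le_max le_rfl ?_).trans_lt ha
      simp [hz2]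
    have hval : ∀ a ∈ ball z ε, |f (a.1, |a.2|)| ≤ C * |a.2| := fun a ha => by
      have h := hC.dist_le_mul _ (hfold a ha) _ (hproj a ha)
      rw [hf0 _ (hεU (hproj a ha).1) rfl, Real.dist_eq, sub_zero] at h
      simpa [Prod.dist_eq] using h
    refine ⟨C, ball z ε, mem_nhdsWithin_of_mem_nhds (ball_mem_nhds z hε),
      LipschitzOnWith.of_dist_le_mul fun a ha b hb => ?_⟩
    have hab := hC.dist_le_mul _ (hfold a ha) _ (hfold b hb)
    have hab' : dist (f (a.1, |a.2|)) (f (b.1, |b.2|)) ≤ C * dist a b :=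
      hab.trans (by gcongr; exact dist_fold_le a b)
    have hcross : ∀ a b : ℝ × ℝ, 0 ≤ a.2 → b.2 < 0 → |a.2| + |b.2| ≤ dist a b := by
      intro a b ha hb
      rw [abs_of_nonneg ha, abs_of_neg hb, Prod.dist_eq, Real.dist_eq a.2]
      exact le_max_of_le_right (by rw [← sub_eq_add_neg]; exact le_abs_self _)
    have hmix : ∀ a ∈ ball z ε, ∀ b ∈ ball z ε, 0 ≤ a.2 → b.2 < 0 →
        dist (oddExt f a) (oddExt f b) ≤ C * dist a b := by
      intro a ha b hb ha2 hb2
      rw [oddExt_of_nonneg f ha2, oddExt_of_neg f hb2, ← evenExt_of_neg f hb2,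
        ← evenExt_of_nonneg f ha2, Real.dist_eq, sub_neg_eq_add]
      calc _ ≤ |evenExt f a| + |evenExt f b| := abs_add_le _ _
        _ ≤ C * |a.2| + C * |b.2| := add_le_add (hval a ha) (hval b hb)
        _ = C * (|a.2| + |b.2|) := by ring
        _ ≤ _ := by gcongr; exact hcross a b ha2 hb2
    rcases le_or_gt 0 a.2 with ha2 | ha2 <;> rcases le_or_gt 0 b.2 with hb2 | hb2
    · rw [oddExt_of_nonneg f ha2, oddExt_of_nonneg f hb2]
      rwa [abs_of_nonneg ha2, abs_of_nonneg hb2] at hab'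
    · exact hmix a ha b hb ha2 hb2
    · rw [dist_comm, dist_comm a b]
      exact hmix b hb a ha hb2 ha2
    · rw [oddExt_of_neg f ha2, oddExt_of_neg f hb2, dist_neg_neg]
      rwa [abs_of_neg ha2, abs_of_neg hb2] at hab'
  · obtain ⟨C, t, ht, hC⟩ := locallyLipschitzOn_evenExt hU hσ hf hz
    refine ⟨C, t ∩ {y | 0 < y.2},
      inter_mem ht (mem_nhdsWithin_of_mem_nhds (eventually_snd_pos hz2)),
      LipschitzOnWith.of_dist_le_mul fun a ha b hb => ?_⟩
    rw [oddExt_of_nonneg f (le_of_lt ha.2), oddExt_of_nonneg f (le_of_lt hb.2),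
      ← evenExt_of_nonneg f (le_of_lt ha.2), ← evenExt_of_nonneg f (le_of_lt hb.2)]
    exact hC.dist_le_mul a ha.1 b hb.1

lemma uniqueDiffOn_upper_inter {U : Set (ℝ × ℝ)} (hU : IsOpen U) :
    UniqueDiffOn ℝ (upperHalf ∩ U) := by
  refine UniqueDiffOn.inter ?_ hU
  have : upperHalf = univ ×ˢ Ici (0 : ℝ) := by ext z; simp [upperHalf]
  rw [this]
  exact uniqueDiffOn_univ.prod (uniqueDiffOn_Ici 0)

lemma ae_snd_ne_zero : ∀ᵐ z : ℝ × ℝ, z.2 ≠ 0 := by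
  have h : (volume : Measure (ℝ × ℝ)) (univ ×ˢ {0}) = 0 := by
    rw [Measure.volume_eq_prod, Measure.prod_prod]; simp
  filter_upwards [measure_eq_zero_iff_ae_notMem.1 h] with z hz h0
  exact hz ⟨mem_univ _, h0⟩

/-- The tangential derivative vanishes on the axis together with the function. -/
lemma fderivWithin_horizontal_eq_zero {U : Set (ℝ × ℝ)} (hU : IsOpen U) {w : ℝ × ℝ → ℝ}
    (hw : DifferentiableOn ℝ w (upperHalf ∩ U)) (hw0 : ∀ z ∈ U, z.2 = 0 → w z = 0) {z : ℝ × ℝ}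
    (hz : z ∈ U) (hz2 : z.2 = 0) : fderivWithin ℝ w (upperHalf ∩ U) z (1, 0) = 0 := by
  have hmem : z ∈ upperHalf ∩ U := ⟨hz2.ge, hz⟩
  have h1 := (hw z hmem).hasFDerivWithinAt
  set γ : ℝ → ℝ × ℝ := fun t => (t, 0) with hγ
  have hγz : γ z.1 = z := by rw [hγ, ← hz2]
  have h2 : HasDerivAt γ (1, 0) z.1 := (hasDerivAt_id z.1).prodMk (hasDerivAt_const z.1 (0 : ℝ))
  have hU' : ∀ᶠ t in 𝓝 z.1, γ t ∈ U := by
    refine h2.continuousAt.eventually_mem (hU.mem_nhds ?_)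
    rwa [hγz]
  rw [← hγz] at h1
  have h3 := h1.comp_hasDerivAt z.1 h2 (by
    filter_upwards [hU'] with t ht using ⟨le_refl (0 : ℝ), ht⟩)
  have h4 : w ∘ γ =ᶠ[𝓝 z.1] fun _ => 0 := by
    filter_upwards [hU'] with t ht using hw0 _ ht rfl
  rw [hγz] at h3
  exact h3.unique ((hasDerivAt_const z.1 (0 : ℝ)).congr_of_eventuallyEq h4)

/-- The gradient of a function on the upper half-plane that vanishes on the axis, extended by
reflection, is an exterior gradient map if the function has quasiregular gradient in the open
half-plane. -/
lemma exteriorGradient_of_halfPlane {U : Set (ℝ × ℝ)} {K Cb : ℝ} {w : ℝ × ℝ → ℝ} (hK : 0 < K)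
    (hCb : 0 ≤ Cb) (hU : IsOpen U) (hσ : ∀ z ∈ U, flip z ∈ U)
    (hU1 : ∀ z, 1 < ‖z‖ → z ∈ U) (hw : ContDiffOn ℝ 2 w (upperHalf ∩ U))
    (hw0 : ∀ z ∈ U, z.2 = 0 → w z = 0)
    (hqc : ∀ z ∈ U, 0 < z.2 →
      energy (dx w) (dy w) z ≤ K * (dy (dx w) z * dx (dy w) z - dx (dx w) z * dy (dy w) z))
    (hgr : ∀ z ∈ U, 0 < z.2 → |w z| ≤ Cb * (1 + 2 * ‖z‖)) :
    ExteriorGradient U K Cb (oddExt fun z => fderivWithin ℝ w (upperHalf ∩ U) z (1, 0))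
      (evenExt fun z => fderivWithin ℝ w (upperHalf ∩ U) z (0, 1)) (oddExt w) := by
  set P := fun z => fderivWithin ℝ w (upperHalf ∩ U) z (1, 0) with hP
  set Q := fun z => fderivWithin ℝ w (upperHalf ∩ U) z (0, 1) with hQ
  have hD : ContDiffOn ℝ 1 (fderivWithin ℝ w (upperHalf ∩ U)) (upperHalf ∩ U) :=
    hw.fderivWithin (uniqueDiffOn_upper_inter hU) (by norm_num)
  have hPd : ContDiffOn ℝ 1 P (upperHalf ∩ U) := hD.clm_apply contDiffOn_const
  have hQd : ContDiffOn ℝ 1 Q (upperHalf ∩ U) := hD.clm_apply contDiffOn_const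
  have hP0 : ∀ z ∈ U, z.2 = 0 → P z = 0 := fun z hz hz2 =>
    fderivWithin_horizontal_eq_zero hU (hw.differentiableOn (by norm_num)) hw0 hz hz2
  have hnhds : ∀ z ∈ U, 0 < z.2 → ∀ᶠ y in 𝓝 z, upperHalf ∩ U ∈ 𝓝 y := fun z hz hz2 => by
    filter_upwards [eventually_snd_pos hz2, hU.mem_nhds hz] with y hy hyU
    exact inter_mem ((eventually_snd_pos hy).mono fun _ h => le_of_lt h) (hU.mem_nhds hyU)
  have hPw : ∀ z ∈ U, 0 < z.2 → P =ᶠ[𝓝 z] dx w := fun z hz hz2 => by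
    filter_upwards [hnhds z hz hz2] with y hy
    simp only [hP, dx, fderivWithin_of_mem_nhds hy]
  have hQw : ∀ z ∈ U, 0 < z.2 → Q =ᶠ[𝓝 z] dy w := fun z hz hz2 => by
    filter_upwards [hnhds z hz hz2] with y hy
    simp only [hQ, dy, fderivWithin_of_mem_nhds hy]
  have hpos : ∀ z ∈ U, 0 < z.2 →
      dx P z ^ 2 + dy P z ^ 2 + dx Q z ^ 2 + dy Q z ^ 2
        ≤ K * (dy P z * dx Q z - dx P z * dy Q z) := fun z hz hz2 => by
    rw [dx_congr (hPw z hz hz2), dy_congr (hPw z hz hz2), dx_congr (hQw z hz hz2),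
      dy_congr (hQw z hz hz2)]
    exact hqc z hz hz2
  have hlow : ∀ z : ℝ × ℝ, z.2 < 0 → 0 < (flip z).2 := fun z hz => by simpa using hz
  refine
    { isOpen := hU
      pos := hK
      lip_fst := locallyLipschitzOn_oddExt hU hσ hPd hP0
      lip_snd := locallyLipschitzOn_evenExt hU hσ hQd
      energy_le := ?_
      nonneg := hCb
      mem_of_one_lt := hU1
      lip_pot := locallyLipschitzOn_oddExt hU hσ (hw.of_le (by norm_num)) hw0
      grad_pot := ?_
      growth := ?_ }
  · filter_upwards [ae_snd_ne_zero] with z hz2 hz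
    rcases lt_or_gt_of_ne hz2 with hz2 | hz2
    · have h := hpos (flip z) (hσ z hz) (hlow z hz2)
      rw [energy, dx_oddExt_of_neg _ hz2, dy_oddExt_of_neg _ hz2, dx_evenExt_of_neg _ hz2,
        dy_evenExt_of_neg _ hz2]
      linarith
    · rw [energy, dx_congr (oddExt_eventuallyEq_of_pos P hz2),
        dy_congr (oddExt_eventuallyEq_of_pos P hz2), dx_congr (evenExt_eventuallyEq_of_pos Q hz2),
        dy_congr (evenExt_eventuallyEq_of_pos Q hz2)]
      exact hpos z hz hz2
  · filter_upwards [ae_snd_ne_zero] with z hz2 hz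
    rcases lt_or_gt_of_ne hz2 with hz2 | hz2
    · rw [dx_oddExt_of_neg _ hz2, dy_oddExt_of_neg _ hz2, oddExt_of_neg _ hz2,
        evenExt_of_neg _ hz2, (hPw _ (hσ z hz) (hlow z hz2)).eq_of_nhds,
        (hQw _ (hσ z hz) (hlow z hz2)).eq_of_nhds]
      exact ⟨rfl, rfl⟩
    · rw [dx_congr (oddExt_eventuallyEq_of_pos w hz2), dy_congr (oddExt_eventuallyEq_of_pos w hz2),
        oddExt_of_nonneg _ hz2.le, evenExt_of_nonneg _ hz2.le, (hPw z hz hz2).eq_of_nhds,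
        (hQw z hz hz2).eq_of_nhds]
      exact ⟨rfl, rfl⟩
  · intro z hz
    rcases lt_trichotomy z.2 0 with hz2 | hz2 | hz2
    · rw [oddExt_of_neg _ hz2, abs_neg]
      have h := hgr (flip z) (hσ z hz) (hlow z hz2)
      have hn : ‖flip z‖ = ‖z‖ := by simp [Prod.norm_def]
      rwa [hn] at h
    · rw [oddExt_of_nonneg _ hz2.ge, hw0 z hz hz2, abs_zero]
      positivity
    · rw [oddExt_of_nonneg _ hz2.le]
      exact hgr z hz hz2

/-! ### From the equation to quasiregularity -/

/-- In two dimensions, the Hessian `(r, s; s, t)` of a solution of a uniformly elliptic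
nondivergence equation has nonpositive determinant, comparable with the square of its norm. -/
lemma hessian_sq_le_of_elliptic {lam Lam a b c r s t : ℝ} (hlam : 0 < lam)
    (hell : ∀ x y : ℝ, lam * (x ^ 2 + y ^ 2) ≤ a * x ^ 2 + b * (x * y) + c * y ^ 2 ∧
      a * x ^ 2 + b * (x * y) + c * y ^ 2 ≤ Lam * (x ^ 2 + y ^ 2))
    (heq : a * r + b * s + c * t = 0) :
    r ^ 2 + s ^ 2 + s ^ 2 + t ^ 2 ≤ 2 * Lam / lam * (s * s - r * t) := by
  have ha := hell 1 0
  have hc := hell 0 1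
  norm_num at ha hc
  have h1 := (hell r s).1
  have h2 := (hell s t).1
  -- multiply the equation by `r`, and by `t`
  have e1 : a * r ^ 2 + b * (r * s) + c * s ^ 2 = c * (s * s - r * t) := by
    linear_combination r * heq
  have e2 : a * s ^ 2 + b * (s * t) + c * t ^ 2 = a * (s * s - r * t) := by
    linear_combination t * heq
  rw [e1] at h1
  rw [e2] at h2
  have hJ : 0 ≤ s * s - r * t := by
    by_contra hneg
    have : c * (s * s - r * t) < 0 := mul_neg_of_pos_of_neg (by linarith) (not_le.1 hneg)
    nlinarith [sq_nonneg r, sq_nonneg s,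
      mul_nonneg hlam.le (add_nonneg (sq_nonneg r) (sq_nonneg s))]
  have h3 := mul_le_mul_of_nonneg_right hc.2 hJ
  have h4 := mul_le_mul_of_nonneg_right ha.2 hJ
  rw [div_mul_eq_mul_div, le_div_iff₀ hlam]
  linarith

/-- The Euclidean plane in coordinates. -/
noncomputable def toE : (ℝ × ℝ) ≃L[ℝ] EuclideanSpace ℝ (Fin 2) :=
  (ContinuousLinearEquiv.finTwoArrow ℝ ℝ).symm.trans (EuclideanSpace.equiv (Fin 2) ℝ).symm

@[simp] lemma toE_zero (z : ℝ × ℝ) : toE z 0 = z.1 := rfl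

@[simp] lemma toE_one (z : ℝ × ℝ) : toE z 1 = z.2 := rfl

lemma toE_basis_zero : toE (1, 0) = EuclideanSpace.single 0 1 := by
  ext i; fin_cases i <;> simp [toE]

lemma toE_basis_one : toE (0, 1) = EuclideanSpace.single 1 1 := by
  ext i; fin_cases i <;> simp [toE]

lemma norm_sq_toE (z : ℝ × ℝ) : ‖toE z‖ ^ 2 = z.1 ^ 2 + z.2 ^ 2 := by
  simp [EuclideanSpace.norm_sq_eq]

lemma norm_le_norm_toE (z : ℝ × ℝ) : ‖z‖ ≤ ‖toE z‖ := by
  have h := norm_sq_toE z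
  rw [Prod.norm_def]
  refine max_le ?_ ?_
  · exact abs_le_of_sq_le_sq (by nlinarith [sq_nonneg z.2]) (norm_nonneg _)
  · exact abs_le_of_sq_le_sq (by nlinarith [sq_nonneg z.1]) (norm_nonneg _)

lemma norm_toE_le_add (z : ℝ × ℝ) : ‖toE z‖ ≤ |z.1| + |z.2| := by
  have h := norm_sq_toE z
  refine le_of_sq_le_sq ?_ (by positivity)
  rw [h, ← sq_abs z.1, ← sq_abs z.2]
  nlinarith [mul_nonneg (abs_nonneg z.1) (abs_nonneg z.2)]

lemma norm_toE_le (z : ℝ × ℝ) : ‖toE z‖ ≤ 2 * ‖z‖ := by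
  have h1 := norm_fst_le z
  have h2 := norm_snd_le z
  rw [Real.norm_eq_abs] at h1 h2
  linarith [norm_toE_le_add z]

/-- The complement of the closed unit disc, in coordinates. -/
def discExterior : Set (ℝ × ℝ) := {z | 1 < ‖toE z‖}

lemma isOpen_discExterior : IsOpen discExterior :=
  isOpen_lt continuous_const toE.continuous.norm

lemma flip_mem_discExterior {z : ℝ × ℝ} (hz : z ∈ discExterior) : flip z ∈ discExterior := by
  have h : ‖toE (flip z)‖ = ‖toE z‖ := by
    rw [← sq_eq_sq₀ (norm_nonneg _) (norm_nonneg _), norm_sq_toE, norm_sq_toE]; simp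
  change 1 < ‖toE (flip z)‖
  rw [h]
  exact hz

lemma preimage_closedExtHalfPlane : toE ⁻¹' closedExtHalfPlane 1 = upperHalf ∩ discExterior := rfl

lemma mem_openExtHalfPlane {z : ℝ × ℝ} (hz : z ∈ discExterior) (hz2 : 0 < z.2) :
    toE z ∈ openExtHalfPlane 1 := ⟨hz2, hz⟩

lemma dx_comp_toE (u : EuclideanSpace ℝ (Fin 2) → ℝ) (z : ℝ × ℝ) :
    dx (u ∘ toE) z = fderiv ℝ u (toE z) (EuclideanSpace.single 0 1) := by
  rw [dx, toE.comp_right_fderiv, ← toE_basis_zero]; rfl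

lemma dy_comp_toE (u : EuclideanSpace ℝ (Fin 2) → ℝ) (z : ℝ × ℝ) :
    dy (u ∘ toE) z = fderiv ℝ u (toE z) (EuclideanSpace.single 1 1) := by
  rw [dy, toE.comp_right_fderiv, ← toE_basis_one]; rfl

lemma dx_comp_toE_eq (u : EuclideanSpace ℝ (Fin 2) → ℝ) :
    dx (u ∘ toE) = (fun y => fderiv ℝ u y (EuclideanSpace.single 0 1)) ∘ toE :=
  funext fun z => dx_comp_toE u z

lemma dy_comp_toE_eq (u : EuclideanSpace ℝ (Fin 2) → ℝ) :
    dy (u ∘ toE) = (fun y => fderiv ℝ u y (EuclideanSpace.single 1 1)) ∘ toE :=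
  funext fun z => dy_comp_toE u z

lemma dx_dy_comm {w : ℝ × ℝ → ℝ} {z : ℝ × ℝ} (hw : ContDiffAt ℝ 2 w z) :
    dx (dy w) z = dy (dx w) z := by
  have hd : DifferentiableAt ℝ (fderiv ℝ w) z :=
    (hw.fderiv_right (m := 1) (by norm_num)).differentiableAt (by norm_num)
  have e : ∀ a b, fderiv ℝ (fun z => fderiv ℝ w z a) z b = fderiv ℝ (fderiv ℝ w) z b a := by
    intro a b
    rw [fderiv_clm_apply hd (differentiableAt_const a)]
    simp
  have hs := hw.isSymmSndFDerivAt (by simp)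
  change fderiv ℝ (fun z => fderiv ℝ w z (0, 1)) z (1, 0)
    = fderiv ℝ (fun z => fderiv ℝ w z (1, 0)) z (0, 1)
  rw [e, e]
  exact hs _ _

lemma extGradient_toE {u : EuclideanSpace ℝ (Fin 2) → ℝ} {z : ℝ × ℝ}
    (hz : z ∈ upperHalf ∩ discExterior) :
    extGradient u (toE z) 0 = fderivWithin ℝ (u ∘ toE) (upperHalf ∩ discExterior) z (1, 0) ∧
    extGradient u (toE z) 1 = fderivWithin ℝ (u ∘ toE) (upperHalf ∩ discExterior) z (0, 1) := by
  have hcoord : ∀ i, extGradient u (toE z) i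
      = fderivWithin ℝ u (closedExtHalfPlane 1) (toE z) (EuclideanSpace.single i 1) := by
    intro i
    have h := EuclideanSpace.inner_single_right (𝕜 := ℝ) i (1 : ℝ) (extGradient u (toE z))
    rw [extGradient, gradientWithin, InnerProductSpace.toDual_symm_apply] at h
    simpa [extGradient, gradientWithin] using h.symm
  have hud : UniqueDiffWithinAt ℝ (toE ⁻¹' closedExtHalfPlane 1) z :=
    uniqueDiffOn_upper_inter isOpen_discExterior z hz
  have h := toE.comp_right_fderivWithin (f := u) hud
  rw [preimage_closedExtHalfPlane] at h
  rw [hcoord, hcoord, h, ← toE_basis_zero, ← toE_basis_one]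
  exact ⟨rfl, rfl⟩

/-- The hypotheses of the theorem, in coordinates. -/
lemma exteriorGradient_of_solution {lam Lam Cbar : ℝ} (hlam : 0 < lam) (hLam : lam ≤ Lam)
    (hCbar : 0 < Cbar) {a : EuclideanSpace ℝ (Fin 2) → Matrix (Fin 2) (Fin 2) ℝ}
    {u : EuclideanSpace ℝ (Fin 2) → ℝ}
    (hell : ∀ x ∈ openExtHalfPlane 1, ∀ ξ : EuclideanSpace ℝ (Fin 2),
      lam * ‖ξ‖ ^ 2 ≤ ∑ i, ∑ j, a x i j * ξ i * ξ j ∧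
        ∑ i, ∑ j, a x i j * ξ i * ξ j ≤ Lam * ‖ξ‖ ^ 2)
    (hu : ContDiffOn ℝ 2 u (closedExtHalfPlane 1))
    (heq : ∀ x ∈ openExtHalfPlane 1, ∑ i, ∑ j, a x i j * secondPartial u i j x = 0)
    (hbdry : ∀ x ∈ closedExtHalfPlane 1, x 1 = 0 → u x = 0)
    (hgr : ∀ x ∈ openExtHalfPlane 1, |u x| ≤ Cbar * (1 + ‖x‖)) :
    ExteriorGradient discExterior (2 * Lam / lam) Cbar
      (oddExt fun z => fderivWithin ℝ (u ∘ toE) (upperHalf ∩ discExterior) z (1, 0))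
      (evenExt fun z => fderivWithin ℝ (u ∘ toE) (upperHalf ∩ discExterior) z (0, 1))
      (oddExt (u ∘ toE)) := by
  have hLam0 : 0 < Lam := hlam.trans_le hLam
  have hw : ContDiffOn ℝ 2 (u ∘ toE) (upperHalf ∩ discExterior) :=
    hu.comp toE.contDiff.contDiffOn fun z hz => hz
  refine exteriorGradient_of_halfPlane (by positivity) hCbar.le isOpen_discExterior
    (fun z hz => flip_mem_discExterior hz) (fun z hz => hz.trans_le (norm_le_norm_toE z)) hw
    (fun z hz hz2 => hbdry (toE z) ⟨hz2.ge, hz⟩ hz2) (fun z hz hz2 => ?_) (fun z hz hz2 => ?_)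
  · have hx := mem_openExtHalfPlane hz hz2
    have hnhds : upperHalf ∩ discExterior ∈ 𝓝 z :=
      inter_mem ((eventually_snd_pos hz2).mono fun _ h => le_of_lt h)
        (isOpen_discExterior.mem_nhds hz)
    have hsymm := dx_dy_comm (hw.contDiffAt hnhds)
    have e := heq _ hx
    simp only [Fin.sum_univ_two, secondPartial] at e
    have e00 : dx (dx (u ∘ toE)) z
        = fderiv ℝ (fun y => fderiv ℝ u y (EuclideanSpace.single 0 1)) (toE z)
          (EuclideanSpace.single 0 1) := by
      rw [dx_comp_toE_eq, dx_comp_toE]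
    have e01 : dy (dx (u ∘ toE)) z
        = fderiv ℝ (fun y => fderiv ℝ u y (EuclideanSpace.single 0 1)) (toE z)
          (EuclideanSpace.single 1 1) := by
      rw [dx_comp_toE_eq, dy_comp_toE]
    have e10 : dx (dy (u ∘ toE)) z
        = fderiv ℝ (fun y => fderiv ℝ u y (EuclideanSpace.single 1 1)) (toE z)
          (EuclideanSpace.single 0 1) := by
      rw [dy_comp_toE_eq, dx_comp_toE]
    have e11 : dy (dy (u ∘ toE)) z
        = fderiv ℝ (fun y => fderiv ℝ u y (EuclideanSpace.single 1 1)) (toE z)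
          (EuclideanSpace.single 1 1) := by
      rw [dy_comp_toE_eq, dy_comp_toE]
    rw [← e00, ← e01, ← e10, ← e11, hsymm] at e
    have key := hessian_sq_le_of_elliptic (Lam := Lam) hlam (a := a (toE z) 0 0)
      (b := a (toE z) 0 1 + a (toE z) 1 0) (c := a (toE z) 1 1) (r := dx (dx (u ∘ toE)) z)
      (s := dy (dx (u ∘ toE)) z) (t := dy (dy (u ∘ toE)) z) (fun x y => by
        have h := hell _ hx (toE (x, y))
        rw [norm_sq_toE] at h
        simp only [Fin.sum_univ_two, toE_zero, toE_one] at h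
        constructor <;> linarith [h.1, h.2]) (by linarith)
    rw [energy, hsymm]
    exact key
  · refine (hgr _ (mem_openExtHalfPlane hz hz2)).trans ?_
    have := norm_toE_le z
    change Cbar * (1 + ‖toE z‖) ≤ _
    gcongr

lemma closedBall_subset_discExterior {R : ℝ} (hR : 1 < R) {δ : ℝ} (hδ : δ ≤ (R - 1) / 8)
    {z : ℝ × ℝ} (hz : R < ‖toE z‖) : closedBall z (2 * δ) ⊆ discExterior := by
  intro y hy
  rw [mem_closedBall, dist_eq_norm] at hy
  have h1 := norm_toE_le (y - z)
  rw [map_sub] at h1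
  have h2 := norm_le_norm_add_norm_sub (toE y) (toE z)
  change 1 < ‖toE y‖
  linarith

lemma norm_le_abs_add_abs (x : EuclideanSpace ℝ (Fin 2)) : ‖x‖ ≤ |x 0| + |x 1| := by
  have h := norm_toE_le_add (x 0, x 1)
  have e : toE (x 0, x 1) = x := by ext i; fin_cases i <;> rfl
  rwa [e] at h

end PlanarQuasiregular
end

open PlanarQuasiregular in
theorem corollary4p3 (lam Lam : ℝ) (hlam : 0 < lam) (hLam : lam ≤ Lam) :
    -- `α` depends only on the ellipticity constants
    ∃ α : ℝ, 0 < α ∧ α < 1 ∧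
      -- `C` depends only on the ellipticity constants, the growth constant and `R`
      ∀ Cbar : ℝ, 0 < Cbar → ∀ R : ℝ, 1 < R → ∃ C : ℝ, 0 < C ∧
        ∀ (a : EuclideanSpace ℝ (Fin 2) → Matrix (Fin 2) (Fin 2) ℝ)
          (u : EuclideanSpace ℝ (Fin 2) → ℝ),
          -- uniform ellipticity
          (∀ x ∈ openExtHalfPlane 1, ∀ ξ : EuclideanSpace ℝ (Fin 2),
            lam * ‖ξ‖ ^ 2 ≤ ∑ i, ∑ j, a x i j * ξ i * ξ j ∧
              ∑ i, ∑ j, a x i j * ξ i * ξ j ≤ Lam * ‖ξ‖ ^ 2) →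
          -- `u` is `C²` up to the flat boundary
          ContDiffOn ℝ 2 u (closedExtHalfPlane 1) →
          -- the equation, the boundary condition, and linear growth
          (∀ x ∈ openExtHalfPlane 1, ∑ i, ∑ j, a x i j * secondPartial u i j x = 0) →
          (∀ x ∈ closedExtHalfPlane 1, x 1 = 0 → u x = 0) →
          (∀ x ∈ openExtHalfPlane 1, |u x| ≤ Cbar * (1 + ‖x‖)) →
          -- Hölder estimate for the gradient
          (∀ x ∈ closedExtHalfPlane R, ∀ y ∈ closedExtHalfPlane R,
            ‖extGradient u x - extGradient u y‖ ≤ C * ‖x - y‖ ^ α) ∧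
          -- limit of the gradient at infinity, with rate
          ∃ l : ℝ,
            Tendsto (extGradient u)
              (Bornology.cobounded (EuclideanSpace ℝ (Fin 2)) ⊓ 𝓟 (closedExtHalfPlane 1))
              (𝓝 !₂[0, l]) ∧
            ∀ x ∈ closedExtHalfPlane R,
              ‖extGradient u x - !₂[0, l]‖ ≤ C * ‖x‖ ^ (-α) := by
  have hK : 0 < 2 * Lam / lam := by have := hlam.trans_le hLam; positivity
  obtain ⟨α, hα0, hα1, hmain⟩ := exists_limit_and_holder hK
  refine ⟨α, hα0, hα1, fun Cbar hCbar R hR => ?_⟩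
  set δ := min 1 ((R - 1) / 8) with hδ
  have hδ0 : 0 < δ := lt_min one_pos (by linarith)
  have hδ1 : δ ≤ 1 := min_le_left _ _
  have hδR : δ ≤ (R - 1) / 8 := min_le_right _ _
  obtain ⟨C, hC0, hC⟩ := hmain Cbar δ hδ0 hδ1
  refine ⟨4 * C, by positivity, fun a u hell hu heq hbdry hgr => ?_⟩
  have hext := exteriorGradient_of_solution hlam hLam hCbar hell hu heq hbdry hgr
  set P := fun z => fderivWithin ℝ (u ∘ toE) (upperHalf ∩ discExterior) z (1, 0) with hP
  set Q := fun z => fderivWithin ℝ (u ∘ toE) (upperHalf ∩ discExterior) z (0, 1) with hQ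
  obtain ⟨⟨m, hm⟩, hp⟩ := hC _ _ _ _ _ hext (Or.inl rfl)
  obtain ⟨⟨l, hl⟩, hq⟩ := hC _ _ _ _ _ hext (Or.inr rfl)
  have hgrad : ∀ z ∈ upperHalf ∩ discExterior,
      extGradient u (toE z) 0 = oddExt P z ∧ extGradient u (toE z) 1 = evenExt Q z := fun z hz => by
    rw [oddExt_of_nonneg P hz.1, evenExt_of_nonneg Q hz.1]
    exact extGradient_toE hz
  have hball : ∀ z : ℝ × ℝ, R < ‖toE z‖ → Metric.closedBall z (2 * δ) ⊆ discExterior :=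
    fun z hz => closedBall_subset_discExterior hR hδR hz
  have hmem : ∀ z : ℝ × ℝ, toE z ∈ closedExtHalfPlane R → z ∈ upperHalf ∩ discExterior :=
    fun z hz => ⟨hz.1, hR.trans hz.2⟩
  have hsurj : ∀ x : EuclideanSpace ℝ (Fin 2), ∃ z, toE z = x := toE.surjective
  -- the horizontal derivative vanishes on the flat boundary, which identifies its limit
  have hm0 : m = 0 := by
    have hlim : Tendsto (fun t : ℝ => C * t ^ (-α)) atTop (𝓝 0) := by
      simpa using (tendsto_rpow_neg_atTop hα0).const_mul C
    have hle : |m| ≤ 0 := by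
      refine ge_of_tendsto hlim ?_
      filter_upwards [eventually_gt_atTop (max R 1)] with t ht
      have ht1 : 1 < t := (le_max_right _ _).trans_lt ht
      have htR : R < t := (le_max_left _ _).trans_lt ht
      have hn : ‖((t, 0) : ℝ × ℝ)‖ = t := by
        rw [Prod.norm_mk, norm_zero, Real.norm_of_nonneg (by linarith), max_eq_left (by linarith)]
      have hnE : t ≤ ‖toE (t, 0)‖ := by
        have := norm_le_norm_toE (t, 0)
        rwa [hn] at this
      have hU : ((t, 0) : ℝ × ℝ) ∈ discExterior := ht1.trans_le hnE
      have h := hm (t, 0) (by rw [hn]; linarith) (hball _ (htR.trans_le hnE))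
      have hz : P (t, 0) = 0 :=
        fderivWithin_horizontal_eq_zero isOpen_discExterior
          ((hu.comp toE.contDiff.contDiffOn fun z hz => hz).differentiableOn (by norm_num))
          (fun z hz hz2 => hbdry (toE z) ⟨hz2.ge, hz⟩ hz2) hU rfl
      rw [oddExt_of_nonneg P le_rfl, hz, hn, zero_sub, abs_neg] at h
      exact h
    exact abs_nonpos_iff.1 hle
  have hrate : ∀ x ∈ closedExtHalfPlane R,
      ‖extGradient u x - !₂[0, l]‖ ≤ 4 * C * ‖x‖ ^ (-α) := by
    intro x hx
    obtain ⟨z, rfl⟩ := hsurj x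
    have hzE : 0 < ‖toE z‖ := by linarith [hx.2]
    have hz2 := norm_toE_le z
    have hz0 : 0 < ‖z‖ := by linarith
    obtain ⟨g0, g1⟩ := hgrad z (hmem z hx)
    have h1 := hm z hz0 (hball z hx.2)
    have h2 := hl z hz0 (hball z hx.2)
    rw [hm0] at h1
    have h3 : ‖z‖ ^ (-α) ≤ 2 * ‖toE z‖ ^ (-α) := by
      calc ‖z‖ ^ (-α) ≤ (‖toE z‖ / 2) ^ (-α) :=
            Real.rpow_le_rpow_of_nonpos (by positivity) (by linarith) (by linarith)
        _ = 2 ^ α * ‖toE z‖ ^ (-α) := by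
            rw [Real.div_rpow hzE.le (by norm_num), Real.rpow_neg (by norm_num : (0 : ℝ) ≤ 2)]
            field_simp
        _ ≤ 2 ^ (1 : ℝ) * ‖toE z‖ ^ (-α) := by
            gcongr
            norm_num
        _ = _ := by norm_num
    calc _ ≤ |oddExt P z - 0| + |evenExt Q z - l| := by
          refine (norm_le_abs_add_abs _).trans (le_of_eq ?_)
          simp [g0, g1]
      _ ≤ C * ‖z‖ ^ (-α) + C * ‖z‖ ^ (-α) := add_le_add h1 h2
      _ = 2 * C * ‖z‖ ^ (-α) := by ring
      _ ≤ 2 * C * (2 * ‖toE z‖ ^ (-α)) := by gcongr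
      _ = _ := by ring
  refine ⟨fun x hx y hy => ?_, l, ?_, hrate⟩
  · obtain ⟨z, rfl⟩ := hsurj x
    obtain ⟨w, rfl⟩ := hsurj y
    obtain ⟨g0, g1⟩ := hgrad z (hmem z hx)
    obtain ⟨k0, k1⟩ := hgrad w (hmem w hy)
    have h1 := hp z w (hball z hx.2) (hball w hy.2)
    have h2 := hq z w (hball z hx.2) (hball w hy.2)
    have h3 : ‖z - w‖ ^ α ≤ ‖toE z - toE w‖ ^ α := by
      rw [← map_sub]
      exact Real.rpow_le_rpow (norm_nonneg _) (norm_le_norm_toE _) hα0.le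
    calc _ ≤ |oddExt P z - oddExt P w| + |evenExt Q z - evenExt Q w| := by
          refine (norm_le_abs_add_abs _).trans (le_of_eq ?_)
          simp [g0, g1, k0, k1]
      _ ≤ C * ‖z - w‖ ^ α + C * ‖z - w‖ ^ α := add_le_add h1 h2
      _ = 2 * C * ‖z - w‖ ^ α := by ring
      _ ≤ 4 * C * ‖toE z - toE w‖ ^ α := by gcongr; norm_num
  · rw [tendsto_iff_norm_sub_tendsto_zero]
    have hlim : Tendsto (fun x : EuclideanSpace ℝ (Fin 2) => 4 * C * ‖x‖ ^ (-α))
        (Bornology.cobounded (EuclideanSpace ℝ (Fin 2)) ⊓ 𝓟 (closedExtHalfPlane 1)) (𝓝 0) := by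
      have h := ((tendsto_rpow_neg_atTop hα0).comp (tendsto_norm_cobounded_atTop
        (E := EuclideanSpace ℝ (Fin 2)))).const_mul (4 * C)
      rw [mul_zero] at h
      exact h.mono_left inf_le_left
    refine squeeze_zero' (Eventually.of_forall fun _ => norm_nonneg _) ?_ hlim
    have hR' : ∀ᶠ x in Bornology.cobounded (EuclideanSpace ℝ (Fin 2)) ⊓
        𝓟 (closedExtHalfPlane 1), R < ‖x‖ :=
      ((tendsto_norm_cobounded_atTop (E := EuclideanSpace ℝ (Fin 2))).eventually_gt_atTop
        R).filter_mono inf_le_left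
    have hS : ∀ᶠ x in Bornology.cobounded (EuclideanSpace ℝ (Fin 2)) ⊓
        𝓟 (closedExtHalfPlane 1), x ∈ closedExtHalfPlane 1 :=
      (eventually_principal.2 fun _ h => h).filter_mono inf_le_right
    filter_upwards [hR', hS] with x hx1 hx2
    exact hrate x ⟨hx2.1, hx1⟩
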